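/- Let $\omega,b,h>0$, let $\rho_{r_0},\rho_{r_1},\rho_{i_0},\rho_{i_1}$ be real numbers with $\rho_{r_0}>0$ and $\rho_{i_0}>0$, let $\mathcal S=\mathbb R/2\pi\mathbb Z$, $\Omega=\mathcal S\times(-b,0)$, $\Gamma_0=\{y=0\}$, $\Gamma_b=\{y=-b\}$, and $$\mathcal A=\{\rho\in L^\infty(\Omega;\mathbb C):\ \rho_{r_0}\le \operatorname{Re}\rho\le\rho_{r_1},\ \ \rho_{i_0}\le\operatorname{Im}\rho\le\rho_{i_1}\ \text{ a.e. in }\Omega\}.$$ For $\xi\in\mathbb R$ let $\beta(\xi)=\sqrt{\omega^2-\xi^2}$ if $\omega^2-\xi^2>0$ and $\beta(\xi)=i\sqrt{\xi^2-\omega^2}$ otherwise. For $\alpha\in[-\frac12,\frac12]$ let $$T_\alpha f=\sum_{n\in\mathbb Z} i\beta(n+\alpha)\hat f(n)e^{inx},\quad \hat f(n)=\frac1{2\pi}\int_{\mathcal S} f(x)e^{-inx}\,dx,\qquad g_\alpha(x)=\frac{-i}{\pi}\sum_{n\in\mathbb Z}e^{i\beta(n+\alpha)h}e^{inx}.$$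 Consider the problem $$\Delta u+2i\alpha\,\partial_x u-\alpha^2u+\omega^2\rho u=0\ \text{ in }\Omega,\qquad (\partial_y-T_\alpha)u=2g_\alpha\ \text{ on }\Gamma_0,\qquad(\partial_y+T_\alpha)u=0\ \text{ on }\Gamma_b.$$ A weak solution is a function $u\in H^1(\Omega)$ such that for all $v\in H^1(\Omega)$ $$\int_\Omega\nabla u\cdot\overline{\nabla v}-\omega^2\int_\Omega\rho u\overline v+\alpha^2\int_\Omega u\overline v-2i\alpha\int_\Omega(\partial_xu)\overline v-\int_{\Gamma_0}(T_\alpha u)\overline v-\int_{\Gamma_b}(T_\alpha u)\overline v=2\int_{\Gamma_0}g_\alpha\overline v,$$ where boundary values are traces and $\int_{\Gamma}(T_\alpha u)\overline v$ is the pairing of $H^{-1/2}(\mathcal S)$ with $H^{1/2}(\mathcal S)$. Then there is a constant $C$, depending only on $\omega,b,h,\rho_{r_0},\rho_{r_1},\rho_{i_0},\rho_{i_1}$, such that for every $\rho\in\mathcal A$ and every $\alpha\in[-\frac12,\frac12]$ the problem has a unique weak solution $u_\alpha$, and $u_\alpha\in H^2(\Omega)$ with $\|u_\alpha\|_{H^2(\Omega)}\le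 C$. -/

import Mathlib

noncomputable section

namespace HelmholtzSlab

open MeasureTheory

/-- The circle `ℝ / 2πℤ`. Its `volume` has total mass `2π` (Lebesgue measure of one period). -/
abbrev S : Type := AddCircle (2 * Real.pi)

instance factTwoPiPos : Fact (0 < 2 * Real.pi) := ⟨Real.two_pi_pos⟩

/-- The cylinder `(ℝ / 2πℤ) × ℝ`, with points `(x, y)`. -/
abbrev Cyl : Type := S × ℝ

/-- Lebesgue measure `dx dy` on the slab `Ω = S × (-b, 0)`, as a measure on the cylinder. -/
def slabMeasure (b : ℝ) : Measure Cyl :=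
  (volume : Measure S).prod ((volume : Measure ℝ).restrict (Set.Ioo (-b) 0))

/-- `φ` is infinitely differentiable on the cylinder, that is, its lift to `ℝ²`, which is
`2π`-periodic in the first variable, is `C^∞`. -/
def IsSmooth (φ : Cyl → ℂ) : Prop :=
  ContDiff ℝ ((⊤ : ℕ∞) : WithTop ℕ∞) (fun q : ℝ × ℝ => φ ((q.1 : S), q.2))

/-- The classical partial derivatives on the cylinder: `∂_x` for `i = 0`, `∂_y` for `i = 1`. -/
def pd : Fin 2 → (Cyl → ℂ) → Cyl → ℂ
  | 0, φ, p => deriv (fun t : ℝ => φ (p.1 + (t : S), p.2)) 0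
  | 1, φ, p => deriv (fun t : ℝ => φ (p.1, p.2 + t)) 0

/-- Test functions on the open slab: `C_c^∞(Ω)`. -/
def IsTest (b : ℝ) (φ : Cyl → ℂ) : Prop :=
  IsSmooth φ ∧ HasCompactSupport φ ∧ tsupport φ ⊆ Set.univ ×ˢ Set.Ioo (-b) 0

/-- `w ∈ L²(Ω)` is the weak (distributional) `i`-th partial derivative of `u` on the slab. -/
def IsWeakPartial (b : ℝ) (i : Fin 2) (u w : Cyl → ℂ) : Prop :=
  MemLp w 2 (slabMeasure b) ∧
    ∀ φ : Cyl → ℂ, IsTest b φ →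
      ∫ p, u p * pd i φ p ∂(slabMeasure b) = - ∫ p, w p * φ p ∂(slabMeasure b)

open Classical in
/-- The weak `i`-th partial derivative of `u` (unique almost everywhere), and `0` if `u` has no
weak `i`-th partial derivative in `L²(Ω)`. -/
def weakD (b : ℝ) (i : Fin 2) (u : Cyl → ℂ) : Cyl → ℂ :=
  if hw : ∃ w, IsWeakPartial b i u w then hw.choose else 0

/-- `u ∈ H¹(Ω)`. -/
def MemH1 (b : ℝ) (u : Cyl → ℂ) : Prop :=
  MemLp u 2 (slabMeasure b) ∧ ∀ i : Fin 2, ∃ w, IsWeakPartial b i u w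

/-- `u ∈ H²(Ω)`. -/
def MemH2 (b : ℝ) (u : Cyl → ℂ) : Prop :=
  MemH1 b u ∧ ∀ i : Fin 2, MemH1 b (weakD b i u)

/-- The norm of `L²(Ω)`. -/
def normL2 (b : ℝ) (u : Cyl → ℂ) : ℝ := (eLpNorm u 2 (slabMeasure b)).toReal

/-- The norm of `H²(Ω)` (meaningful for `u` with `MemH2 b u`). -/
def normH2 (b : ℝ) (u : Cyl → ℂ) : ℝ :=
  Real.sqrt (normL2 b u ^ 2 + ∑ i : Fin 2, normL2 b (weakD b i u) ^ 2
    + ∑ i : Fin 2, ∑ j : Fin 2, normL2 b (weakD b j (weakD b i u)) ^ 2)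

/-- `τ = (τ₀, τ_b)` is the pair of traces of `u ∈ H¹(Ω)` on `Γ₀ = {y = 0}` and `Γ_b = {y = -b}`:
both are in `L²(S)`, and the Gauss-Green formula in the direction `y` holds against every function
that is smooth up to the boundary. This determines `τ₀` and `τ_b` almost everywhere, and for `u`
continuously differentiable up to the boundary they are the restrictions of `u`. -/
def IsTrace (b : ℝ) (u : Cyl → ℂ) (τ : (S → ℂ) × (S → ℂ)) : Prop :=
  MemLp τ.1 2 (volume : Measure S) ∧ MemLp τ.2 2 (volume : Measure S) ∧
    ∀ φ : Cyl → ℂ, IsSmooth φ →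
      ∫ p, (weakD b 1 u p * φ p + u p * pd 1 φ p) ∂(slabMeasure b)
        = (∫ x : S, τ.1 x * φ (x, 0)) - ∫ x : S, τ.2 x * φ (x, -b)

open Classical in
/-- The traces of `u ∈ H¹(Ω)` on `Γ₀` and on `Γ_b`. -/
def trace (b : ℝ) (u : Cyl → ℂ) : (S → ℂ) × (S → ℂ) :=
  if hτ : ∃ τ, IsTrace b u τ then hτ.choose else 0

/-- `β(ξ) = √(ω² - ξ²)` if the argument is positive, and `i √(ξ² - ω²)` otherwise. -/
def beta (ω ξ : ℝ) : ℂ :=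
  if 0 < ω ^ 2 - ξ ^ 2 then (Real.sqrt (ω ^ 2 - ξ ^ 2) : ℂ)
  else Complex.I * (Real.sqrt (ξ ^ 2 - ω ^ 2) : ℂ)

/-- `g_α(x) = (-i/π) ∑_{n ∈ ℤ} e^{iβ(n+α)h} e^{inx}`. Here `fourier n x = e^{inx}`, since the period
is `2π`; the series converges absolutely for `h > 0`. -/
def gInc (ω h α : ℝ) (x : S) : ℂ :=
  (-Complex.I / (Real.pi : ℂ)) *
    ∑' n : ℤ, Complex.exp (Complex.I * beta ω ((n : ℝ) + α) * (h : ℂ)) * fourier n x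

/-- The pairing `∫_Γ (T_α f) \overline{k} dx` of `T_α f = ∑_n iβ(n+α) f̂(n) e^{inx} ∈ H^{-1/2}(S)` with
`k`, for `f, k ∈ H^{1/2}(S)` (such as traces of functions in `H¹(Ω)`), where the series
converges absolutely. The Fourier coefficient is `f̂(n) = (1/2π) ∫_S f(x) e^{-inx} dx`. -/
def dtnPairing (ω α : ℝ) (f k : S → ℂ) : ℂ :=
  2 * (Real.pi : ℂ) * ∑' n : ℤ,
    (Complex.I * beta ω ((n : ℝ) + α) * fourierCoeff f n) * starRingEnd ℂ (fourierCoeff k n)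

/-- The sesquilinear form
`a(u,v) = ∫_Ω ∇u·∇v̄ - ω² ∫_Ω ρ u v̄ + α² ∫_Ω u v̄ - 2iα ∫_Ω (∂_x u) v̄`
`- ∫_{Γ₀} (T_α u) v̄ - ∫_{Γ_b} (T_α u) v̄`. -/
def form (ω b α : ℝ) (ρ u v : Cyl → ℂ) : ℂ :=
  (∫ p, ∑ i : Fin 2, weakD b i u p * starRingEnd ℂ (weakD b i v p) ∂(slabMeasure b))
    - (ω : ℂ) ^ 2 * (∫ p, ρ p * u p * starRingEnd ℂ (v p) ∂(slabMeasure b))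
    + (α : ℂ) ^ 2 * (∫ p, u p * starRingEnd ℂ (v p) ∂(slabMeasure b))
    - 2 * Complex.I * (α : ℂ) *
        (∫ p, weakD b 0 u p * starRingEnd ℂ (v p) ∂(slabMeasure b))
    - dtnPairing ω α (trace b u).1 (trace b v).1
    - dtnPairing ω α (trace b u).2 (trace b v).2

/-- The antilinear functional `2 ∫_{Γ₀} g_α v̄ dx`. -/
def load (ω b h α : ℝ) (v : Cyl → ℂ) : ℂ :=
  2 * ∫ x : S, gInc ω h α x * starRingEnd ℂ ((trace b v).1 x)

/-- `u ∈ H¹(Ω)` is a weak solution of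
`Δu + 2iα ∂_x u - α² u + ω² ρ u = 0` in `Ω`, `(∂_y - T_α) u = 2 g_α` on `Γ₀`,
`(∂_y + T_α) u = 0` on `Γ_b`. -/
def IsWeakSolution (ω b h α : ℝ) (ρ u : Cyl → ℂ) : Prop :=
  MemH1 b u ∧ ∀ v : Cyl → ℂ, MemH1 b v → form ω b α ρ u v = load ω b h α v

/-- The admissible class of dielectric coefficients: `ρ ∈ L^∞(Ω)` with `r₀ ≤ Re ρ ≤ r₁` and
`i₀ ≤ Im ρ ≤ i₁` almost everywhere in `Ω`. -/
def admissible (b r₀ r₁ i₀ i₁ : ℝ) : Set (Cyl → ℂ) :=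
  {ρ | MemLp ρ ⊤ (slabMeasure b) ∧
    ∀ᵐ p ∂(slabMeasure b),
      r₀ ≤ (ρ p).re ∧ (ρ p).re ≤ r₁ ∧ i₀ ≤ (ρ p).im ∧ (ρ p).im ≤ i₁}

end HelmholtzSlab

end

/-! ### Smooth functions on the cylinder -/

noncomputable section

namespace HelmholtzSlab

open MeasureTheory Set Filter Topology
open scoped ContDiff ComplexConjugate ENNReal

/-! The problem is coercive after rotation in the complex plane, and everything except
multiplication by `ρ` is diagonal in the Fourier variable of `x`.

Well-posedness. `H1 b` is realised as a closed subspace of `L²(Ω)³`, hence a Hilbert space, and the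
form becomes `sesq`. Absorption, `Im ρ ≥ i₀ > 0`, makes the imaginary part of the form at most `-ω²
i₀ ‖u‖²`, while the real part controls the gradient up to a multiple of `‖u‖²`. The
Dirichlet-to-Neumann terms have favourable signs in both parts, because `Re β ≥ 0` and `Im β ≥ 0`
(`dtnSum_self`), and the term with `∂_x u` is real on the diagonal. So `Re a - K Im a` dominates the
`H¹` norm for a suitable `K` (`coercive_sesq`), and `lax_milgram` applies. The constants are uniform
because `α` enters only through `|α| ≤ 1/2` and `ρ` only through its bounds.

Traces. The Gauss-Green formula against `e^{inx}` times a power of order `|n| + 1` in `y` expresses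
the Fourier coefficients of a trace through the function itself. The exponent is tuned so that `(1 +
|n|) |û(n)|²` is bounded by the `H¹` norm of the frequency `n` part (`trCoeff_sq_le`); this weight
matches the linear growth of `β`, so the Dirichlet-to-Neumann form is bounded on `H¹`.

Regularity. As `ρ` is merely bounded, the equation cannot be differentiated. Instead it is tested
with the frequency `n` part of `u`, keeping `ρu` as a datum in `L²` (`mode_energy`). Multiplying by
`n²` and summing, with Parseval for `ρu` and exponential decay for the incident field, bounds
`∂_x²u` and `∂_x∂_y u`. The equation tested on `C_c^∞(Ω)` then gives `∂_y²u`
(`isWeakPartial_grad_one`). -/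

/-- The lift of a function on the cylinder to the plane. -/
def lift (φ : Cyl → ℂ) (q : ℝ × ℝ) : ℂ := φ ((q.1 : S), q.2)

/-- The coordinate directions of the plane. -/
def dir : Fin 2 → ℝ × ℝ
  | 0 => (1, 0)
  | 1 => (0, 1)

lemma IsSmooth.lift {φ : Cyl → ℂ} (hφ : IsSmooth φ) : ContDiff ℝ ∞ (lift φ) := hφ

/-- Smoothness is defined on the plane only; the quotient map carries continuity of the lift down to
the cylinder. -/
lemma isOpenQuotientMap_cyl :
    IsOpenQuotientMap (fun q : ℝ × ℝ => (((q.1 : ℝ) : S), q.2)) :=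
  (QuotientAddGroup.isOpenQuotientMap_mk (N := AddSubgroup.zmultiples (2 * Real.pi))).prodMap
    IsOpenQuotientMap.id

lemma IsSmooth.continuous {φ : Cyl → ℂ} (hφ : IsSmooth φ) : Continuous φ :=
  isOpenQuotientMap_cyl.isQuotientMap.continuous_iff.2 hφ.lift.continuous

lemma lift_pd {φ : Cyl → ℂ} (hφ : IsSmooth φ) (i : Fin 2) (q : ℝ × ℝ) :
    lift (pd i φ) q = fderiv ℝ (lift φ) q (dir i) := by
  have hd : DifferentiableAt ℝ (lift φ) q := hφ.lift.differentiable (by simp) q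
  have key : HasDerivAt (fun t : ℝ => lift φ (q + t • dir i)) (fderiv ℝ (lift φ) q (dir i)) 0 := by
    have h1 : HasDerivAt (fun t : ℝ => q + t • dir i) (dir i) 0 := by
      simpa using ((hasDerivAt_id (0 : ℝ)).smul_const (dir i)).const_add q
    have h2 : HasFDerivAt (lift φ) (fderiv ℝ (lift φ) q) (q + (0 : ℝ) • dir i) := by
      simpa using hd.hasFDerivAt
    exact h2.comp_hasDerivAt 0 h1
  rw [← key.deriv]
  fin_cases i <;> simp [lift, pd, dir]

lemma IsSmooth.pd {φ : Cyl → ℂ} (hφ : IsSmooth φ) (i : Fin 2) : IsSmooth (pd i φ) := by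
  have h : ContDiff ℝ ∞ (fun q => fderiv ℝ (HelmholtzSlab.lift φ) q (dir i)) :=
    (hφ.lift.fderiv_right (m := ∞) (by simp)).clm_apply contDiff_const
  have : (fun q : ℝ × ℝ => HelmholtzSlab.pd i φ ((q.1 : S), q.2))
      = fun q => fderiv ℝ (HelmholtzSlab.lift φ) q (dir i) := by
    ext q; exact lift_pd hφ i q
  rw [IsSmooth, this]; exact h

lemma cyl_ext {φ ψ : Cyl → ℂ} (h : ∀ q, lift φ q = lift ψ q) : φ = ψ := by
  ext ⟨x, y⟩
  obtain ⟨x, rfl⟩ := QuotientAddGroup.mk_surjective x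
  exact h (x, y)

lemma pd_comm {φ : Cyl → ℂ} (hφ : IsSmooth φ) (i j : Fin 2) : pd i (pd j φ) = pd j (pd i φ) := by
  have h : ∀ i j q, lift (pd i (pd j φ)) q = fderiv ℝ (fderiv ℝ (lift φ)) q (dir i) (dir j) := by
    intro i j q
    have h1 : lift (pd j φ) = fun q => fderiv ℝ (lift φ) q (dir j) := by
      ext q; exact lift_pd hφ j q
    have h2 : DifferentiableAt ℝ (fderiv ℝ (lift φ)) q :=
      (hφ.lift.fderiv_right (m := ∞) (by simp)).differentiable (by simp) q
    rw [lift_pd (hφ.pd j), h1, fderiv_clm_apply h2 (by fun_prop)]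
    simp
  refine cyl_ext fun q => ?_
  rw [h, h]
  exact (hφ.lift.contDiffAt.isSymmSndFDerivAt (by simp only [minSmoothness_of_isRCLikeNormedField]; exact WithTop.coe_le_coe.2 (le_top : (2 : ℕ∞) ≤ ⊤))).eq _ _

lemma IsSmooth.mul {φ ψ : Cyl → ℂ} (hφ : IsSmooth φ) (hψ : IsSmooth ψ) :
    IsSmooth (fun p => φ p * ψ p) := ContDiff.mul hφ hψ

lemma IsSmooth.sub {φ ψ : Cyl → ℂ} (hφ : IsSmooth φ) (hψ : IsSmooth ψ) :
    IsSmooth (fun p => φ p - ψ p) := ContDiff.sub hφ hψ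

lemma IsSmooth.conj {φ : Cyl → ℂ} (hφ : IsSmooth φ) : IsSmooth (fun p => conj (φ p)) :=
  Complex.conjCLE.contDiff.comp hφ

lemma isSmooth_snd {χ : ℝ → ℂ} (hχ : ContDiff ℝ ∞ χ) : IsSmooth (fun p => χ p.2) :=
  hχ.comp contDiff_snd

lemma isSmooth_fourier (n : ℤ) : IsSmooth (fun p => fourier n p.1) := by
  have : (fun q : ℝ × ℝ => (fourier n (q.1 : S) : ℂ))
      = fun q => Complex.exp (2 * Real.pi * Complex.I * n * (q.1 : ℂ) / ((2 * Real.pi : ℝ) : ℂ)) := by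
    ext q; exact fourier_coe_apply
  rw [IsSmooth, this]
  have h : ContDiff ℝ ∞ (fun q : ℝ × ℝ => (q.1 : ℂ)) := Complex.ofRealCLM.contDiff.comp contDiff_fst
  exact ((contDiff_const.mul h).div_const _).cexp

lemma IsSmooth.slice {φ : Cyl → ℂ} (hφ : IsSmooth φ) (y : ℝ) : IsSmooth (fun p => φ (p.1, y)) :=
  hφ.lift.comp (contDiff_fst.prodMk contDiff_const)

lemma IsSmooth.hasDerivAt_fst {φ : Cyl → ℂ} (hφ : IsSmooth φ) (x y : ℝ) :
    HasDerivAt (fun t : ℝ => φ ((t : S), y)) (HelmholtzSlab.pd 0 φ ((x : S), y)) x := by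
  have h := lift_pd hφ 0 (x, y)
  have hd : DifferentiableAt ℝ (HelmholtzSlab.lift φ) (x, y) := hφ.lift.differentiable (by simp) _
  have h1 : HasDerivAt (fun t : ℝ => (t, y)) ((1 : ℝ), (0 : ℝ)) x :=
    (hasDerivAt_id x).prodMk (hasDerivAt_const x y)
  have := hd.hasFDerivAt.comp_hasDerivAt x h1
  rw [show ((1 : ℝ), (0 : ℝ)) = dir 0 from rfl, ← h] at this
  exact this

lemma IsSmooth.hasDerivAt_snd {φ : Cyl → ℂ} (hφ : IsSmooth φ) (x : S) (y : ℝ) :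
    HasDerivAt (fun t : ℝ => φ (x, t)) (HelmholtzSlab.pd 1 φ (x, y)) y := by
  obtain ⟨x, rfl⟩ := QuotientAddGroup.mk_surjective x
  have h := lift_pd hφ 1 (x, y)
  have hd : DifferentiableAt ℝ (HelmholtzSlab.lift φ) (x, y) := hφ.lift.differentiable (by simp) _
  have h1 : HasDerivAt (fun t : ℝ => (x, t)) ((0 : ℝ), (1 : ℝ)) y :=
    (hasDerivAt_const y x).prodMk (hasDerivAt_id y)
  have := hd.hasFDerivAt.comp_hasDerivAt y h1
  rw [show ((0 : ℝ), (1 : ℝ)) = dir 1 from rfl, ← h] at this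
  exact this

lemma IsSmooth.pd_zero_eq {φ : Cyl → ℂ} (hφ : IsSmooth φ) {x y : ℝ} {c : ℂ}
    (h : HasDerivAt (fun t : ℝ => φ ((t : S), y)) c x) : HelmholtzSlab.pd 0 φ ((x : S), y) = c :=
  (hφ.hasDerivAt_fst x y).unique h

lemma IsSmooth.pd_one_eq {φ : Cyl → ℂ} (hφ : IsSmooth φ) {x : S} {y : ℝ} {c : ℂ}
    (h : HasDerivAt (fun t : ℝ => φ (x, t)) c y) : HelmholtzSlab.pd 1 φ (x, y) = c :=
  (hφ.hasDerivAt_snd x y).unique h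

lemma pd_mul {φ ψ : Cyl → ℂ} (hφ : IsSmooth φ) (hψ : IsSmooth ψ) (i : Fin 2) (p : Cyl) :
    pd i (fun p => φ p * ψ p) p = pd i φ p * ψ p + φ p * pd i ψ p := by
  obtain ⟨x, y⟩ := p
  fin_cases i
  · obtain ⟨x, rfl⟩ := QuotientAddGroup.mk_surjective x
    exact (hφ.mul hψ).pd_zero_eq ((hφ.hasDerivAt_fst x y).mul (hψ.hasDerivAt_fst x y))
  · exact (hφ.mul hψ).pd_one_eq ((hφ.hasDerivAt_snd x y).mul (hψ.hasDerivAt_snd x y))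

lemma pd_conj {φ : Cyl → ℂ} (hφ : IsSmooth φ) (i : Fin 2) (p : Cyl) :
    pd i (fun p => conj (φ p)) p = conj (pd i φ p) := by
  obtain ⟨x, y⟩ := p
  fin_cases i
  · obtain ⟨x, rfl⟩ := QuotientAddGroup.mk_surjective x
    exact hφ.conj.pd_zero_eq (hφ.hasDerivAt_fst x y).star
  · exact hφ.conj.pd_one_eq (hφ.hasDerivAt_snd x y).star

lemma pd_fourier (n : ℤ) (p : Cyl) :
    pd 0 (fun p => fourier n p.1) p = Complex.I * n * fourier n p.1 := by
  obtain ⟨x, y⟩ := p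
  obtain ⟨x, rfl⟩ := QuotientAddGroup.mk_surjective x
  refine (isSmooth_fourier n).pd_zero_eq ?_
  have h := hasDerivAt_fourier (2 * Real.pi) n x
  convert h using 2
  push_cast
  have : (Real.pi : ℂ) ≠ 0 := by exact_mod_cast Real.pi_ne_zero
  field_simp

lemma pd_one_fst {φ : S → ℂ} (p : Cyl) : pd 1 (fun p => φ p.1) p = 0 := by
  simp [pd]

lemma pd_zero_snd {χ : ℝ → ℂ} (p : Cyl) : pd 0 (fun p => χ p.2) p = 0 := by
  simp [pd]

lemma pd_one_snd {χ : ℝ → ℂ} (hχ : ContDiff ℝ ∞ χ) (p : Cyl) :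
    pd 1 (fun p => χ p.2) p = deriv χ p.2 :=
  (isSmooth_snd hχ).pd_one_eq (hχ.differentiable (by simp) p.2).hasDerivAt

/-! ### Test functions -/

lemma support_pd_subset (i : Fin 2) (φ : Cyl → ℂ) : Function.support (pd i φ) ⊆ tsupport φ := by
  intro p hp
  by_contra hn
  refine hp ?_
  have h0 : φ =ᶠ[𝓝 p] 0 := notMem_tsupport_iff_eventuallyEq.1 hn
  fin_cases i
  · have hc : Tendsto (fun t : ℝ => ((p.1 + (t : S), p.2) : Cyl)) (𝓝 0) (𝓝 p) := by
      have : Continuous (fun t : ℝ => ((p.1 + (t : S), p.2) : Cyl)) :=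
        (continuous_const.add (AddCircle.continuous_mk' _)).prodMk continuous_const
      simpa using this.tendsto 0
    have : (fun t : ℝ => φ (p.1 + (t : S), p.2)) =ᶠ[𝓝 0] fun _ => (0 : ℂ) := hc.eventually h0
    simpa [pd] using this.deriv_eq
  · have hc : Tendsto (fun t : ℝ => ((p.1, p.2 + t) : Cyl)) (𝓝 0) (𝓝 p) := by
      have : Continuous (fun t : ℝ => ((p.1, p.2 + t) : Cyl)) := by fun_prop
      simpa using this.tendsto 0
    have : (fun t : ℝ => φ (p.1, p.2 + t)) =ᶠ[𝓝 0] fun _ => (0 : ℂ) := hc.eventually h0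
    simpa [pd] using this.deriv_eq

lemma IsTest.of_support {b : ℝ} {φ ψ : Cyl → ℂ} (hφ : IsTest b φ) (hψ : IsSmooth ψ)
    (h : Function.support ψ ⊆ tsupport φ) : IsTest b ψ :=
  have hs : tsupport ψ ⊆ tsupport φ := closure_minimal h (isClosed_tsupport φ)
  ⟨hψ, hφ.2.1.of_isClosed_subset (isClosed_tsupport _) hs, hs.trans hφ.2.2⟩

lemma IsTest.pd {b : ℝ} {φ : Cyl → ℂ} (hφ : IsTest b φ) (i : Fin 2) :
    IsTest b (HelmholtzSlab.pd i φ) :=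
  hφ.of_support (hφ.1.pd i) (support_pd_subset i φ)

lemma IsTest.conj {b : ℝ} {φ : Cyl → ℂ} (hφ : IsTest b φ) : IsTest b (fun p => conj (φ p)) := by
  refine hφ.of_support hφ.1.conj fun p hp => subset_tsupport φ ?_
  simpa using hp

lemma IsTest.mul_right {b : ℝ} {φ ψ : Cyl → ℂ} (hφ : IsTest b φ) (hψ : IsSmooth ψ) :
    IsTest b (fun p => φ p * ψ p) :=
  hφ.of_support (hφ.1.mul hψ) fun p hp => subset_tsupport φ fun h => hp (by simp [h])

lemma isTest_snd {b : ℝ} {χ : ℝ → ℂ} (hχ : ContDiff ℝ ∞ χ) (hc : HasCompactSupport χ)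
    (hs : tsupport χ ⊆ Ioo (-b) 0) : IsTest b (fun p => χ p.2) := by
  have h : tsupport (fun p : Cyl => χ p.2) ⊆ univ ×ˢ tsupport χ :=
    closure_minimal (fun p hp => ⟨mem_univ _, subset_tsupport χ hp⟩)
      (isClosed_univ.prod (isClosed_tsupport χ))
  exact ⟨isSmooth_snd hχ, (isCompact_univ.prod hc).of_isClosed_subset (isClosed_tsupport _) h,
    h.trans (prod_mono le_rfl hs)⟩

lemma IsTest.eq_zero {b : ℝ} {φ : Cyl → ℂ} (hφ : IsTest b φ) {x : S} {y : ℝ}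
    (hy : y ∉ Ioo (-b) 0) : φ (x, y) = 0 := by
  by_contra h
  exact hy (hφ.2.2 (subset_tsupport φ h)).2

/-! ### Integration on the slab -/

instance (b : ℝ) : IsFiniteMeasure (slabMeasure b) := by unfold slabMeasure; infer_instance

lemma slabMeasure_eq (b : ℝ) :
    slabMeasure b = (volume : Measure Cyl).restrict (univ ×ˢ Ioo (-b) 0) := by
  rw [slabMeasure, Measure.volume_eq_prod, ← Measure.prod_restrict, Measure.restrict_univ]

lemma ae_mem_slab (b : ℝ) : ∀ᵐ p ∂(slabMeasure b), p.2 ∈ Ioo (-b) 0 := by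
  rw [slabMeasure_eq]
  filter_upwards [ae_restrict_mem (MeasurableSet.univ.prod measurableSet_Ioo)] with p hp using hp.2

lemma exists_bound_slab {F : Cyl → ℂ} (hF : Continuous F) (b : ℝ) :
    ∃ C, 0 ≤ C ∧ ∀ x : S, ∀ y ∈ Icc (-b) 0, ‖F (x, y)‖ ≤ C := by
  have hc : IsCompact ((univ : Set S) ×ˢ Icc (-b) 0) := isCompact_univ.prod isCompact_Icc
  obtain ⟨C, hC⟩ := hc.exists_bound_of_continuousOn hF.continuousOn
  exact ⟨max C 0, le_max_right _ _, fun x y hy => (hC (x, y) ⟨mem_univ _, hy⟩).trans (le_max_left _ _)⟩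

lemma memLp_of_continuous {F : Cyl → ℂ} (hF : Continuous F) (b : ℝ) (p : ENNReal) :
    MemLp F p (slabMeasure b) := by
  obtain ⟨C, -, hC⟩ := exists_bound_slab hF b
  refine MemLp.of_bound hF.aestronglyMeasurable C ?_
  filter_upwards [ae_mem_slab b] with q hq using hC q.1 q.2 (Ioo_subset_Icc_self hq)

lemma integrable_of_continuous {F : Cyl → ℂ} (hF : Continuous F) (b : ℝ) :
    Integrable F (slabMeasure b) :=
  memLp_one_iff_integrable.1 (memLp_of_continuous hF b 1)

lemma integral_slab {F : Cyl → ℂ} {b : ℝ} (hF : Integrable F (slabMeasure b)) :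
    ∫ p, F p ∂(slabMeasure b) = ∫ y in Ioo (-b) 0, ∫ x : S, F (x, y) := by
  unfold slabMeasure at hF ⊢
  exact integral_prod_symm F hF

lemma integral_slab' {F : Cyl → ℂ} {b : ℝ} (hF : Integrable F (slabMeasure b)) :
    ∫ p, F p ∂(slabMeasure b) = ∫ x : S, ∫ y in Ioo (-b) 0, F (x, y) := by
  unfold slabMeasure at hF ⊢
  exact integral_prod F hF

lemma integral_circle_pd_zero {φ : Cyl → ℂ} (hφ : IsSmooth φ) (y : ℝ) :
    ∫ x : S, pd 0 φ (x, y) = 0 := by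
  rw [← AddCircle.intervalIntegral_preimage (2 * Real.pi) 0 (fun x => pd 0 φ (x, y)),
    intervalIntegral.integral_eq_sub_of_hasDerivAt (fun t _ => hφ.hasDerivAt_fst t y)]
  · simp [AddCircle.coe_period]
  · exact ((hφ.pd 0).continuous.comp
      ((AddCircle.continuous_mk' _).prodMk continuous_const)).intervalIntegrable _ _

lemma integral_pd_zero {φ : Cyl → ℂ} (hφ : IsSmooth φ) (b : ℝ) :
    ∫ p, pd 0 φ p ∂(slabMeasure b) = 0 := by
  rw [integral_slab (integrable_of_continuous (hφ.pd 0).continuous b)]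
  simp [integral_circle_pd_zero hφ]

lemma continuous_slice {φ : Cyl → ℂ} (hφ : Continuous φ) (y : ℝ) :
    Continuous (fun x : S => φ (x, y)) := hφ.comp (continuous_id.prodMk continuous_const)

lemma integrable_circle {φ : S → ℂ} (hφ : Continuous φ) : Integrable φ (volume : Measure S) :=
  hφ.integrable_of_hasCompactSupport (HasCompactSupport.of_compactSpace φ)

lemma integral_pd_one {φ : Cyl → ℂ} (hφ : IsSmooth φ) {b : ℝ} (hb : 0 ≤ b) :
    ∫ p, pd 1 φ p ∂(slabMeasure b) = (∫ x : S, φ (x, 0)) - ∫ x : S, φ (x, -b) := by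
  rw [integral_slab' (integrable_of_continuous (hφ.pd 1).continuous b),
    ← integral_sub (integrable_circle (continuous_slice hφ.continuous 0))
      (integrable_circle (continuous_slice hφ.continuous (-b)))]
  congr 1; ext x
  rw [← integral_Ioc_eq_integral_Ioo, ← intervalIntegral.integral_of_le (by linarith)]
  exact intervalIntegral.integral_eq_sub_of_hasDerivAt (fun t _ => hφ.hasDerivAt_snd x t)
    (((hφ.pd 1).continuous.comp (by fun_prop : Continuous fun t : ℝ => (x, t))).intervalIntegrable _ _)

lemma hasDerivAt_integral_circle {φ : Cyl → ℂ} (hφ : IsSmooth φ) (y : ℝ) :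
    HasDerivAt (fun t => ∫ x : S, φ (x, t)) (∫ x : S, pd 1 φ (x, y)) y := by
  have hc : IsCompact ((univ : Set S) ×ˢ Metric.closedBall y 1) :=
    isCompact_univ.prod (isCompact_closedBall y 1)
  obtain ⟨C, hC⟩ := hc.exists_bound_of_continuousOn (hφ.pd 1).continuous.continuousOn
  refine (hasDerivAt_integral_of_dominated_loc_of_deriv_le (𝕜 := ℝ) (μ := (volume : Measure S))
    (F := fun t x => φ (x, t)) (F' := fun t x => pd 1 φ (x, t)) (bound := fun _ => C)
    (s := Metric.closedBall y 1) (Metric.closedBall_mem_nhds y one_pos) ?_ ?_ ?_ ?_ ?_ ?_).2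
  · exact Eventually.of_forall fun t =>
      (continuous_slice hφ.continuous t).aestronglyMeasurable
  · exact integrable_circle (continuous_slice hφ.continuous y)
  · exact (continuous_slice (hφ.pd 1).continuous y).aestronglyMeasurable
  · exact Eventually.of_forall fun x t ht => hC (x, t) ⟨mem_univ _, ht⟩
  · exact integrable_const _
  · exact Eventually.of_forall fun x t _ => hφ.hasDerivAt_snd x t

/-- Differentiating under the integral sign gives an integral of the same kind, with `pd 1 φ` for
`φ`, so induction on the order applies. This makes the Fourier coefficients of test functions smooth
in `y`. -/
lemma contDiff_integral_circle {φ : Cyl → ℂ} (hφ : IsSmooth φ) :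
    ContDiff ℝ ∞ (fun t => ∫ x : S, φ (x, t)) := by
  refine contDiff_infty.2 fun k => ?_
  induction k generalizing φ with
  | zero =>
    exact contDiff_zero.2 (continuous_iff_continuousAt.2 fun y =>
      (hasDerivAt_integral_circle hφ y).continuousAt)
  | succ k ih =>
    have hd : deriv (fun t => ∫ x : S, φ (x, t)) = fun t => ∫ x : S, pd 1 φ (x, t) := by
      ext y; exact (hasDerivAt_integral_circle hφ y).deriv
    refine (contDiff_succ_iff_deriv (n := (k : WithTop ℕ∞))).2
      ⟨fun y => (hasDerivAt_integral_circle hφ y).differentiableAt, by simp, ?_⟩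
    rw [hd]; exact ih (hφ.pd 1)

/-! ### The partial Fourier transform in `x` -/

lemma inner_eq_integral {X : Type*} [MeasurableSpace X] {μ : Measure X} (f g : Lp ℂ 2 μ) :
    inner ℂ f g = ∫ p, conj (f p) * g p ∂μ := by
  rw [L2.inner_def]
  simp [RCLike.inner_apply, mul_comm]

lemma inner_toLp_left {X : Type*} [MeasurableSpace X] {μ : Measure X} {f : X → ℂ}
    (hf : MemLp f 2 μ) (g : Lp ℂ 2 μ) :
    inner ℂ (hf.toLp f) g = ∫ p, conj (f p) * g p ∂μ := by
  rw [inner_eq_integral]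
  refine integral_congr_ae ?_
  filter_upwards [hf.coeFn_toLp] with p hp
  rw [hp]

lemma integrable_conj_mul {X : Type*} [MeasurableSpace X] {μ : Measure X} {f g : X → ℂ}
    (hf : MemLp f 2 μ) (hg : MemLp g 2 μ) : Integrable (fun p => conj (f p) * g p) μ :=
  hf.star.integrable_mul hg

/-- Lebesgue measure on the segment `(-b, 0)`. -/
def segMeasure (b : ℝ) : Measure ℝ := (volume : Measure ℝ).restrict (Ioo (-b) 0)

instance (b : ℝ) : IsFiniteMeasure (segMeasure b) := by unfold segMeasure; infer_instance

lemma slabMeasure_prod (b : ℝ) : slabMeasure b = (volume : Measure S).prod (segMeasure b) := rfl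

/-- The normalising factor `1 / √(2π)`. -/
def kap : ℝ := (Real.sqrt (2 * Real.pi))⁻¹

lemma kap_pos : 0 < kap := by unfold kap; positivity

lemma kap_sq : kap * kap * (2 * Real.pi) = 1 := by
  have h : Real.sqrt (2 * Real.pi) * Real.sqrt (2 * Real.pi) = 2 * Real.pi :=
    Real.mul_self_sqrt (by positivity)
  have h0 : Real.sqrt (2 * Real.pi) ≠ 0 := by positivity
  unfold kap
  rw [← mul_inv, h, inv_mul_cancel₀ (by positivity)]

lemma kap_sq' : (kap : ℂ) * kap * (2 * Real.pi) = 1 := by exact_mod_cast kap_sq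

/-- `e^{inx} c(y) / √(2π)`. -/
def modeFun (n : ℤ) (c : ℝ → ℂ) (p : Cyl) : ℂ := kap * fourier n p.1 * c p.2

/-- The `n`-th Fourier coefficient of `f(·, y)`, normalised so that Parseval holds in `L²(S)`. -/
def rowCoeff (n : ℤ) (f : Cyl → ℂ) (y : ℝ) : ℂ := kap * ∫ x : S, fourier (-n) x * f (x, y)

/-- For `k ≠ 0` the exponential is, up to the factor `ik`, the derivative of a periodic function. -/
lemma integral_fourier (k : ℤ) : ∫ x : S, fourier k x = if k = 0 then 2 * (Real.pi : ℂ) else 0 := by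
  split_ifs with h
  · subst h
    simp [Measure.real, AddCircle.measure_univ, Real.pi_pos.le]
  · have h1 := integral_circle_pd_zero (isSmooth_fourier k) 0
    simp only [pd_fourier] at h1
    rw [integral_const_mul] at h1
    simpa [h] using h1

lemma memLp_modeFun {b : ℝ} (n : ℤ) {c : ℝ → ℂ} (hc : MemLp c 2 (segMeasure b)) :
    MemLp (modeFun n c) 2 (slabMeasure b) := by
  have h1 : MemLp (fun p : Cyl => c p.2) 2 (slabMeasure b) := hc.comp_snd _
  have h2 : MemLp (fun p : Cyl => (kap : ℂ) * fourier n p.1) ∞ (slabMeasure b) :=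
    memLp_of_continuous (continuous_const.mul (isSmooth_fourier n).continuous) b ∞
  exact h1.mul h2

lemma integral_conj_modeFun {b : ℝ} (n : ℤ) {c : ℝ → ℂ} (hc : MemLp c 2 (segMeasure b))
    {f : Cyl → ℂ} (hf : MemLp f 2 (slabMeasure b)) :
    ∫ p, conj (modeFun n c p) * f p ∂(slabMeasure b)
      = ∫ y, conj (c y) * rowCoeff n f y ∂(segMeasure b) := by
  rw [integral_slab (integrable_conj_mul (memLp_modeFun n hc) hf)]
  refine integral_congr_ae (Eventually.of_forall fun y => ?_)
  simp only [modeFun, rowCoeff]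
  rw [← integral_const_mul, ← integral_const_mul]
  congr 1; ext x
  rw [fourier_neg]
  simp only [map_mul, Complex.conj_ofReal]
  ring

lemma rowCoeff_modeFun (n m : ℤ) (c : ℝ → ℂ) (y : ℝ) :
    rowCoeff n (modeFun m c) y = if n = m then c y else 0 := by
  have : ∀ x : S, fourier (-n) x * modeFun m c (x, y) = (kap * c y) * fourier (m - n) x := by
    intro x
    rw [sub_eq_add_neg, fourier_add, modeFun]; ring
  rw [rowCoeff]
  simp only [this]
  rw [integral_const_mul, integral_fourier]
  by_cases h : n = m
  · subst h
    simp only [sub_self, if_true]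
    linear_combination c y * kap_sq'
  · have : m - n ≠ 0 := fun h' => h (by omega)
    simp [h, this]

/-- The linear map `c ↦ e^{inx} c(y) / √(2π)`. -/
def modeLin (b : ℝ) (n : ℤ) : Lp ℂ 2 (segMeasure b) →ₗ[ℂ] Lp ℂ 2 (slabMeasure b) where
  toFun c := (memLp_modeFun n (Lp.memLp c)).toLp _
  map_add' c d := by
    rw [← MemLp.toLp_add]
    refine MemLp.toLp_congr _ _ ?_
    have : (fun p : Cyl => (c + d : Lp ℂ 2 (segMeasure b)) p.2) =ᵐ[slabMeasure b]
        fun p => (c + d : ℝ → ℂ) p.2 :=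
      Measure.quasiMeasurePreserving_snd.ae_eq_comp (Lp.coeFn_add c d)
    filter_upwards [this] with p hp
    simp only [modeFun, hp, Pi.add_apply]; ring
  map_smul' r c := by
    rw [RingHom.id_apply, ← MemLp.toLp_const_smul]
    refine MemLp.toLp_congr _ _ ?_
    have : (fun p : Cyl => (r • c : Lp ℂ 2 (segMeasure b)) p.2) =ᵐ[slabMeasure b]
        fun p => (r • (c : ℝ → ℂ)) p.2 :=
      Measure.quasiMeasurePreserving_snd.ae_eq_comp (Lp.coeFn_smul r c)
    filter_upwards [this] with p hp
    simp only [modeFun, hp, Pi.smul_apply, smul_eq_mul]; ring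

lemma modeLin_coe {b : ℝ} (n : ℤ) (c : Lp ℂ 2 (segMeasure b)) :
    modeLin b n c =ᵐ[slabMeasure b] modeFun n c :=
  MemLp.coeFn_toLp (memLp_modeFun n (Lp.memLp c))

lemma inner_modeLin {b : ℝ} (n : ℤ) (c : Lp ℂ 2 (segMeasure b)) (f : Lp ℂ 2 (slabMeasure b)) :
    inner ℂ (modeLin b n c) f = ∫ y, conj (c y) * rowCoeff n f y ∂(segMeasure b) := by
  rw [← integral_conj_modeFun n (Lp.memLp c) (Lp.memLp f)]
  exact inner_toLp_left (memLp_modeFun n (Lp.memLp c)) f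

lemma inner_modeLin_modeLin {b : ℝ} (n m : ℤ) (c d : Lp ℂ 2 (segMeasure b)) :
    inner ℂ (modeLin b n c) (modeLin b m d) = if n = m then inner ℂ c d else 0 := by
  have h1 : inner ℂ (modeLin b n c) (modeLin b m d)
      = ∫ p, conj (modeFun n c p) * modeFun m d p ∂(slabMeasure b) := by
    refine (inner_toLp_left (memLp_modeFun n (Lp.memLp c)) _).trans (integral_congr_ae ?_)
    filter_upwards [modeLin_coe m d] with p hp
    rw [hp]
  rw [h1, integral_conj_modeFun n (Lp.memLp c) (memLp_modeFun m (Lp.memLp d))]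
  simp only [rowCoeff_modeFun]
  split_ifs with h
  · rw [inner_eq_integral]
  · simp

/-- The isometric embedding `c ↦ e^{inx} c(y) / √(2π)` of `L²(-b, 0)` into `L²(Ω)`. -/
def mode (b : ℝ) (n : ℤ) : Lp ℂ 2 (segMeasure b) →ₗᵢ[ℂ] Lp ℂ 2 (slabMeasure b) where
  toLinearMap := modeLin b n
  norm_map' c := by
    rw [@norm_eq_sqrt_re_inner ℂ, @norm_eq_sqrt_re_inner ℂ, inner_modeLin_modeLin, if_pos rfl]

lemma mode_coe {b : ℝ} (n : ℤ) (c : Lp ℂ 2 (segMeasure b)) :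
    mode b n c =ᵐ[slabMeasure b] modeFun n c := modeLin_coe n c

lemma inner_mode {b : ℝ} (n : ℤ) (c : Lp ℂ 2 (segMeasure b)) (f : Lp ℂ 2 (slabMeasure b)) :
    inner ℂ (mode b n c) f = ∫ y, conj (c y) * rowCoeff n f y ∂(segMeasure b) :=
  inner_modeLin n c f

lemma integrable_rowCoeff {b : ℝ} (n : ℤ) {f : Cyl → ℂ} (hf : Integrable f (slabMeasure b)) :
    Integrable (rowCoeff n f) (segMeasure b) := by
  have h : Integrable (fun p : Cyl => fourier (-n) p.1 * f p) (slabMeasure b) := by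
    refine hf.bdd_mul (c := 1) (isSmooth_fourier (-n)).continuous.aestronglyMeasurable
      (Eventually.of_forall fun p => ?_)
    simp only [fourier_apply, Circle.norm_coe, le_refl]
  rw [slabMeasure_prod] at h
  exact h.integral_prod_right.const_mul _

/-- A square integrable function on the circle all of whose Fourier coefficients vanish is zero. -/
lemma ae_eq_zero_of_fourier {f : S → ℂ} (hf : MemLp f 2 (volume : Measure S))
    (h : ∀ n : ℤ, ∫ x : S, fourier (-n) x * f x = 0) : f =ᵐ[volume] 0 := by
  have hf' : MemLp f 2 AddCircle.haarAddCircle := memLp_haarAddCircle_iff.2 hf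
  have h0 : hf'.toLp f = 0 := by
    apply fourierBasis.repr.injective
    ext n
    rw [fourierBasis_repr, fourierCoeff_congr_ae (hf'.coeFn_toLp)]
    simp only [fourierCoeff, AddCircle.integral_haarAddCircle, smul_eq_mul, h n, smul_zero]
    simp
  have h1 : f =ᵐ[AddCircle.haarAddCircle] 0 := by
    have := hf'.coeFn_toLp
    rw [h0] at this
    exact this.symm.trans (Lp.coeFn_zero _ _ _)
  rw [AddCircle.volume_eq_smul_haarAddCircle]
  exact Measure.ae_smul_measure h1 _

/-- Since `ℤ` is countable, one null set of heights serves all frequencies. Off it, completeness of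
the exponentials kills each row, and Fubini kills `f`. -/
lemma eq_zero_of_rowCoeff {b : ℝ} {f : Cyl → ℂ} (hf : MemLp f 2 (slabMeasure b))
    (h : ∀ n : ℤ, rowCoeff n f =ᵐ[segMeasure b] 0) : f =ᵐ[slabMeasure b] 0 := by
  have hsq := hf.integrable_norm_pow (p := 2) (by norm_num)
  have hm : AEStronglyMeasurable (fun q : ℝ × S => f q.swap) ((segMeasure b).prod volume) :=
    (hf.1 : AEStronglyMeasurable f (volume.prod (segMeasure b))).prod_swap
  have h1 : ∀ᵐ y ∂(segMeasure b), ∀ n : ℤ, rowCoeff n f y = 0 := ae_all_iff.2 h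
  have h2 : ∀ᵐ y ∂(segMeasure b), Integrable (fun x : S => ‖f (x, y)‖ ^ 2) :=
    hsq.prod_left_ae
  have h3 : ∀ᵐ y ∂(segMeasure b), AEStronglyMeasurable (fun x : S => f (x, y)) volume :=
    hm.prodMk_left
  have h4 : ∀ᵐ y ∂(segMeasure b), ∀ᵐ x ∂(volume : Measure S), f (x, y) = 0 := by
    filter_upwards [h1, h2, h3] with y h1 h2 h3
    refine ae_eq_zero_of_fourier ((memLp_two_iff_integrable_sq_norm h3).2 h2) fun n => ?_
    have := h1 n
    rw [rowCoeff] at this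
    exact (mul_eq_zero.1 this).resolve_left (by exact_mod_cast kap_pos.ne')
  have h5 : ∫ p, ‖f p‖ ^ 2 ∂(slabMeasure b) = 0 := by
    have : ∫ p, ‖f p‖ ^ 2 ∂(slabMeasure b) = ∫ y, (∫ x : S, ‖f (x, y)‖ ^ 2) ∂(segMeasure b) :=
      integral_prod_symm _ hsq
    rw [this]
    refine integral_eq_zero_of_ae ?_
    filter_upwards [h4] with y hy
    refine integral_eq_zero_of_ae ?_
    filter_upwards [hy] with x hx
    simp [hx]
  have h6 := (integral_eq_zero_iff_of_nonneg (fun p => by positivity) hsq).1 h5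
  filter_upwards [h6] with p hp
  simpa using hp

lemma isHilbertSum_mode (b : ℝ) :
    IsHilbertSum ℂ (fun _ : ℤ => Lp ℂ 2 (segMeasure b)) (mode b) := by
  refine IsHilbertSum.mk (fun n m hnm c d => ?_) ?_
  · exact (inner_modeLin_modeLin n m c d).trans (if_neg hnm)
  · rw [top_le_iff, Submodule.topologicalClosure_eq_top_iff, Submodule.eq_bot_iff]
    intro f hf
    have hn : ∀ n c, inner ℂ (mode b n c) f = 0 := fun n c =>
      (Submodule.mem_orthogonal _ f).1 hf _
        (Submodule.mem_iSup_of_mem n (LinearMap.mem_range_self _ c))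
    rw [Lp.eq_zero_iff_ae_eq_zero]
    refine eq_zero_of_rowCoeff (Lp.memLp f) fun n => ?_
    refine Integrable.ae_eq_zero_of_forall_setIntegral_eq_zero
      (integrable_rowCoeff n ((Lp.memLp f).integrable (by norm_num))) fun s hs hsm => ?_
    -- Orthogonality to `e^{inx}` times the indicator of `s` says that the coefficient function has
    -- integral zero over `s`.
    have h1 := hn n (indicatorConstLp 2 hs hsm.ne (1 : ℂ))
    rw [inner_mode] at h1
    rw [← integral_indicator hs, ← h1]
    refine integral_congr_ae ?_
    filter_upwards [indicatorConstLp_coeFn (p := 2) (hs := hs) (hμs := hsm.ne) (c := (1 : ℂ))] with y hy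
    rw [hy]
    by_cases hys : y ∈ s <;> simp [hys]

/-- The partial Fourier transform in `x`, an isometry `L²(Ω) ≃ ℓ²(ℤ; L²(-b, 0))`. -/
def four (b : ℝ) :
    Lp ℂ 2 (slabMeasure b) ≃ₗᵢ[ℂ] lp (fun _ : ℤ => Lp ℂ 2 (segMeasure b)) 2 :=
  (isHilbertSum_mode b).linearIsometryEquiv

/-- The `n`-th Fourier coefficient of `f`, a function of `y`. -/
def coeff (b : ℝ) (n : ℤ) : Lp ℂ 2 (slabMeasure b) →L[ℂ] Lp ℂ 2 (segMeasure b) :=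
  (mode b n).toContinuousLinearMap.adjoint

lemma inner_mode_left {b : ℝ} (n : ℤ) (c : Lp ℂ 2 (segMeasure b)) (f : Lp ℂ 2 (slabMeasure b)) :
    inner ℂ (mode b n c) f = inner ℂ c (coeff b n f) :=
  (ContinuousLinearMap.adjoint_inner_right (mode b n).toContinuousLinearMap c f).symm

lemma inner_mode_right {b : ℝ} (n : ℤ) (c : Lp ℂ 2 (segMeasure b)) (f : Lp ℂ 2 (slabMeasure b)) :
    inner ℂ f (mode b n c) = inner ℂ (coeff b n f) c :=
  (ContinuousLinearMap.adjoint_inner_left (mode b n).toContinuousLinearMap c f).symm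

lemma four_apply {b : ℝ} (n : ℤ) (f : Lp ℂ 2 (slabMeasure b)) : four b f n = coeff b n f := by
  refine ext_inner_left ℂ fun c => ?_
  have h1 : four b (mode b n c) = lp.single 2 n c := by
    rw [four, ← (isHilbertSum_mode b).linearIsometryEquiv_symm_apply_single,
      LinearIsometryEquiv.apply_symm_apply]
  have h2 := lp.inner_single_left (𝕜 := ℂ) n c (four b f)
  rw [← inner_mode_left, ← (four b).inner_map_map, h1]
  exact h2.symm

lemma hasSum_inner_coeff {b : ℝ} (f g : Lp ℂ 2 (slabMeasure b)) :
    HasSum (fun n => inner ℂ (coeff b n f) (coeff b n g)) (inner ℂ f g) := by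
  have := lp.hasSum_inner (𝕜 := ℂ) (four b f) (four b g)
  rw [(four b).inner_map_map] at this
  simpa only [four_apply] using this

lemma hasSum_norm_coeff {b : ℝ} (f : Lp ℂ 2 (slabMeasure b)) :
    HasSum (fun n => ‖coeff b n f‖ ^ 2) (‖f‖ ^ 2) := by
  have h := (Complex.reCLM.hasSum (hasSum_inner_coeff f f))
  have h1 : ∀ {X : Type} [NormedAddCommGroup X] [InnerProductSpace ℂ X] (x : X),
      Complex.reCLM (inner ℂ x x) = ‖x‖ ^ 2 := fun x => inner_self_eq_norm_sq (𝕜 := ℂ) x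
  simpa only [Function.comp_def, h1] using h

lemma coeff_mode {b : ℝ} (n m : ℤ) (c : Lp ℂ 2 (segMeasure b)) :
    coeff b n (mode b m c) = if n = m then c else 0 := by
  refine ext_inner_left ℂ fun d => ?_
  rw [← inner_mode_left]
  refine (inner_modeLin_modeLin n m d c).trans ?_
  split_ifs <;> simp

lemma ext_coeff {b : ℝ} {f g : Lp ℂ 2 (slabMeasure b)} (h : ∀ n, coeff b n f = coeff b n g) :
    f = g := by
  apply (four b).injective
  ext1; ext1 n
  rw [four_apply, four_apply, h]

lemma exists_of_coeff {b : ℝ} (c : ℤ → Lp ℂ 2 (segMeasure b))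
    (hc : Summable fun n => ‖c n‖ ^ 2) :
    ∃ f : Lp ℂ 2 (slabMeasure b), ∀ n, coeff b n f = c n := by
  have h : Memℓp c 2 := memℓp_gen (by simpa using hc)
  refine ⟨(four b).symm ⟨c, h⟩, fun n => ?_⟩
  rw [← four_apply, LinearIsometryEquiv.apply_symm_apply]

lemma coeff_toLp {b : ℝ} (n : ℤ) {f : Cyl → ℂ} (hf : MemLp f 2 (slabMeasure b))
    (hr : MemLp (rowCoeff n f) 2 (segMeasure b)) : coeff b n (hf.toLp f) = hr.toLp _ := by
  refine ext_inner_left ℂ fun c => ?_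
  rw [← inner_mode_left]
  have h1 : inner ℂ (mode b n c) (hf.toLp f)
      = ∫ p, conj (modeFun n c p) * f p ∂(slabMeasure b) := by
    refine (inner_toLp_left (memLp_modeFun n (Lp.memLp c)) _).trans (integral_congr_ae ?_)
    filter_upwards [hf.coeFn_toLp] with p hp
    rw [hp]
  rw [h1, integral_conj_modeFun n (Lp.memLp c) hf, inner_eq_integral]
  refine integral_congr_ae ?_
  filter_upwards [hr.coeFn_toLp] with y hy
  rw [hy]

/-! ### Weak partial derivatives -/

/-- The space `L²(Ω)`. -/
abbrev LΩ (b : ℝ) : Type := Lp ℂ 2 (slabMeasure b)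

lemma IsSmooth.memLp {φ : Cyl → ℂ} (hφ : IsSmooth φ) (b : ℝ) : MemLp φ 2 (slabMeasure b) :=
  memLp_of_continuous hφ.continuous b 2

/-- A smooth function as an element of `L²(Ω)`. -/
def IsSmooth.toLp {φ : Cyl → ℂ} (hφ : IsSmooth φ) (b : ℝ) : LΩ b := (hφ.memLp b).toLp φ

lemma IsSmooth.toLp_congr {φ ψ : Cyl → ℂ} (hφ : IsSmooth φ) (hψ : IsSmooth ψ) (b : ℝ)
    (h : φ = ψ) : hφ.toLp b = hψ.toLp b := by subst h; rfl

lemma IsSmooth.inner_toLp {φ : Cyl → ℂ} (hφ : IsSmooth φ) {b : ℝ} (f : LΩ b) :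
    inner ℂ (hφ.toLp b) f = ∫ p, conj (φ p) * f p ∂(slabMeasure b) :=
  inner_toLp_left _ f

lemma IsWeakPartial.congr {b : ℝ} {i : Fin 2} {u u' w w' : Cyl → ℂ} (h : IsWeakPartial b i u w)
    (hu : u =ᵐ[slabMeasure b] u') (hw : w =ᵐ[slabMeasure b] w') : IsWeakPartial b i u' w' := by
  refine ⟨h.1.ae_eq hw, fun φ hφ => ?_⟩
  refine (integral_congr_ae (hu.mul (ae_eq_refl (pd i φ)))).symm.trans ((h.2 φ hφ).trans ?_)
  exact congrArg Neg.neg (integral_congr_ae (hw.mul (ae_eq_refl φ)))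

/-- Test functions are stable under conjugation, so the bilinear definition becomes a family of
inner product identities. In this form the relation is visibly linear and closed in `(f, g)`, which
is what makes `H1` a complete space. -/
lemma isWeakPartial_iff {b : ℝ} {i : Fin 2} {f g : LΩ b} :
    IsWeakPartial b i f g ↔ ∀ ψ (h : IsTest b ψ),
      inner ℂ ((h.1.pd i).toLp b) f = - inner ℂ (h.1.toLp b) g := by
  constructor
  · rintro ⟨-, h⟩ ψ hψ
    have := h _ hψ.conj
    simp only [pd_conj hψ.1] at this
    rw [IsSmooth.inner_toLp, IsSmooth.inner_toLp]
    simpa only [mul_comm] using this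
  · intro h
    refine ⟨Lp.memLp g, fun φ hφ => ?_⟩
    have := h _ hφ.conj
    rw [IsSmooth.inner_toLp, IsSmooth.inner_toLp] at this
    simp only [pd_conj hφ.1, Complex.conj_conj] at this
    simpa only [mul_comm] using this

lemma isWeakPartial_smooth {b : ℝ} (hb : 0 ≤ b) {φ : Cyl → ℂ} (hφ : IsSmooth φ) (i : Fin 2) :
    IsWeakPartial b i φ (pd i φ) := by
  refine ⟨(hφ.pd i).memLp b, fun ψ hψ => ?_⟩
  have h0 : ∫ p, pd i (fun p => φ p * ψ p) p ∂(slabMeasure b) = 0 := by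
    fin_cases i
    · exact integral_pd_zero (hφ.mul hψ.1) b
    · have h := integral_pd_one (hφ.mul hψ.1) hb
      have h1 : ∀ x : S, ψ (x, 0) = 0 := fun x => hψ.eq_zero (by simp)
      have h2 : ∀ x : S, ψ (x, -b) = 0 := fun x => hψ.eq_zero (by simp)
      simpa [h1, h2] using h
  simp only [pd_mul hφ hψ.1] at h0
  rw [integral_add (integrable_of_continuous ((hφ.pd i).mul hψ.1).continuous b)
    (integrable_of_continuous (hφ.mul (hψ.1.pd i)).continuous b)] at h0
  linear_combination h0

/-! ### Fourier coefficients of smooth functions -/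

lemma rowCoeff_eq_integral (n : ℤ) (f : Cyl → ℂ) :
    rowCoeff n f = fun y => ∫ x : S, (kap * fourier (-n) x) * f (x, y) := by
  ext y
  rw [rowCoeff, ← integral_const_mul]
  simp only [mul_assoc]

lemma isSmooth_kap_fourier (n : ℤ) : IsSmooth (fun p => (kap : ℂ) * fourier n p.1) :=
  ContDiff.mul contDiff_const (isSmooth_fourier n)

lemma pd_zero_kap_fourier (n : ℤ) (p : Cyl) :
    pd 0 (fun p => (kap : ℂ) * fourier n p.1) p = Complex.I * n * (kap * fourier n p.1) := by
  have h : IsSmooth (fun _ : Cyl => (kap : ℂ)) := contDiff_const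
  rw [pd_mul h (isSmooth_fourier n), pd_fourier]
  simp [pd]; ring

lemma rowCoeff_pd_zero {φ : Cyl → ℂ} (hφ : IsSmooth φ) (n : ℤ) (y : ℝ) :
    rowCoeff n (pd 0 φ) y = Complex.I * n * rowCoeff n φ y := by
  have h := integral_circle_pd_zero ((isSmooth_kap_fourier (-n)).mul hφ) y
  simp only [pd_mul (isSmooth_kap_fourier (-n)) hφ, pd_zero_kap_fourier] at h
  rw [integral_add (integrable_circle (continuous_slice
      (φ := fun p : Cyl => Complex.I * ((-n : ℤ) : ℂ) * (kap * fourier (-n) p.1) * φ p)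
      ((continuous_const.mul (isSmooth_kap_fourier (-n)).continuous).mul hφ.continuous) y))
    (integrable_circle (continuous_slice ((isSmooth_kap_fourier (-n)).mul (hφ.pd 0)).continuous y))] at h
  simp only [rowCoeff_eq_integral]
  rw [← integral_const_mul]
  rw [add_comm, add_eq_zero_iff_eq_neg] at h
  rw [h, ← integral_neg]
  congr 1; ext x
  push_cast; ring

lemma hasDerivAt_rowCoeff {φ : Cyl → ℂ} (hφ : IsSmooth φ) (n : ℤ) (y : ℝ) :
    HasDerivAt (rowCoeff n φ) (rowCoeff n (pd 1 φ) y) y := by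
  have h := hasDerivAt_integral_circle ((isSmooth_kap_fourier (-n)).mul hφ) y
  simp only [pd_mul (isSmooth_kap_fourier (-n)) hφ] at h
  rw [rowCoeff_eq_integral, rowCoeff_eq_integral]
  convert h using 2
  ext x
  rw [pd_one_fst (φ := fun x => (kap : ℂ) * fourier (-n) x)]; ring

lemma contDiff_rowCoeff {φ : Cyl → ℂ} (hφ : IsSmooth φ) (n : ℤ) : ContDiff ℝ ∞ (rowCoeff n φ) := by
  rw [rowCoeff_eq_integral]
  exact contDiff_integral_circle ((isSmooth_kap_fourier (-n)).mul hφ)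

lemma tsupport_rowCoeff {b : ℝ} {φ : Cyl → ℂ} (hφ : IsTest b φ) (n : ℤ) :
    HasCompactSupport (rowCoeff n φ) ∧ tsupport (rowCoeff n φ) ⊆ Ioo (-b) 0 := by
  have hc : IsCompact (Prod.snd '' tsupport φ) := hφ.2.1.isCompact.image continuous_snd
  have hs : tsupport (rowCoeff n φ) ⊆ Prod.snd '' tsupport φ := by
    refine closure_minimal (fun y hy => ?_) hc.isClosed
    by_contra h
    refine hy ?_
    have : ∀ x : S, φ (x, y) = 0 := fun x => by
      by_contra hx
      exact h ⟨(x, y), subset_tsupport φ hx, rfl⟩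
    simp [rowCoeff, this]
  refine ⟨hc.of_isClosed_subset (isClosed_tsupport _) hs, hs.trans ?_⟩
  rintro _ ⟨p, hp, rfl⟩
  exact (hφ.2.2 hp).2

lemma isSmooth_modeFun (n : ℤ) {c : ℝ → ℂ} (hc : ContDiff ℝ ∞ c) : IsSmooth (modeFun n c) :=
  (isSmooth_kap_fourier n).mul (isSmooth_snd hc)

lemma isTest_modeFun {b : ℝ} (n : ℤ) {c : ℝ → ℂ} (hc : ContDiff ℝ ∞ c) (hs : HasCompactSupport c)
    (ht : tsupport c ⊆ Ioo (-b) 0) : IsTest b (modeFun n c) :=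
  (isTest_snd hc hs ht).of_support (isSmooth_modeFun n hc) fun p hp =>
    subset_tsupport _ fun h => hp (by simp [modeFun, h])

lemma pd_zero_modeFun (n : ℤ) {c : ℝ → ℂ} (hc : ContDiff ℝ ∞ c) (p : Cyl) :
    pd 0 (modeFun n c) p = Complex.I * n * modeFun n c p := by
  refine (pd_mul (isSmooth_kap_fourier n) (isSmooth_snd hc) 0 p).trans ?_
  rw [pd_zero_kap_fourier, pd_zero_snd, modeFun]; ring

lemma pd_one_modeFun (n : ℤ) {c : ℝ → ℂ} (hc : ContDiff ℝ ∞ c) (p : Cyl) :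
    pd 1 (modeFun n c) p = modeFun n (deriv c) p := by
  refine (pd_mul (isSmooth_kap_fourier n) (isSmooth_snd hc) 1 p).trans ?_
  rw [pd_one_fst (φ := fun x => (kap : ℂ) * fourier n x), pd_one_snd hc, modeFun]; ring

/-- Projection onto frequency `n` commutes with both derivatives: `∂_x` acts as multiplication by
`in`, and `∂_y` passes under the integral over the circle. -/
lemma pd_modeFun_rowCoeff {φ : Cyl → ℂ} (hφ : IsSmooth φ) (n : ℤ) (i : Fin 2) :
    pd i (modeFun n (rowCoeff n φ)) = modeFun n (rowCoeff n (pd i φ)) := by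
  ext p
  fin_cases i
  · refine (pd_zero_modeFun n (contDiff_rowCoeff hφ n) p).trans ?_
    simp only [modeFun, Fin.zero_eta, rowCoeff_pd_zero hφ]; ring
  · refine (pd_one_modeFun n (contDiff_rowCoeff hφ n) p).trans ?_
    simp only [modeFun, (hasDerivAt_rowCoeff hφ n p.2).deriv]; rfl

lemma memLp_seg {c : ℝ → ℂ} (hc : Continuous c) (b : ℝ) (p : ℝ≥0∞) : MemLp c p (segMeasure b) := by
  obtain ⟨C, hC⟩ := (isCompact_Icc (a := -b) (b := 0)).exists_bound_of_continuousOn hc.continuousOn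
  refine MemLp.of_bound hc.aestronglyMeasurable C ?_
  filter_upwards [ae_restrict_mem measurableSet_Ioo] with y hy using hC y (Ioo_subset_Icc_self hy)

/-- A continuous function as an element of `L²(-b, 0)`. -/
def segLp {c : ℝ → ℂ} (hc : Continuous c) (b : ℝ) : Lp ℂ 2 (segMeasure b) := (memLp_seg hc b 2).toLp c

lemma toLp_modeFun {b : ℝ} (n : ℤ) {c : ℝ → ℂ} (hc : ContDiff ℝ ∞ c) :
    (isSmooth_modeFun n hc).toLp b = mode b n (segLp hc.continuous b) := by
  ext1
  refine (MemLp.coeFn_toLp _).trans ((?_ : _ =ᵐ[slabMeasure b] _).trans (mode_coe n _).symm)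
  have : (fun p : Cyl => segLp hc.continuous b p.2) =ᵐ[slabMeasure b] fun p => c p.2 :=
    Measure.quasiMeasurePreserving_snd.ae_eq_comp (MemLp.coeFn_toLp (memLp_seg hc.continuous b 2))
  filter_upwards [this] with p hp
  simp only [modeFun, hp]

lemma coeff_smooth {b : ℝ} {φ : Cyl → ℂ} (hφ : IsSmooth φ) (n : ℤ) :
    coeff b n (hφ.toLp b) = segLp (contDiff_rowCoeff hφ n).continuous b :=
  coeff_toLp n (hφ.memLp b) _

/-- The orthogonal projection of `L²(Ω)` onto the functions `e^{inx} c(y)`. -/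
def proj (b : ℝ) (n : ℤ) : LΩ b →L[ℂ] LΩ b := (mode b n).toContinuousLinearMap ∘L coeff b n

lemma proj_apply {b : ℝ} (n : ℤ) (f : LΩ b) : proj b n f = mode b n (coeff b n f) := rfl

lemma inner_proj_right {b : ℝ} (n : ℤ) (f g : LΩ b) :
    inner ℂ f (proj b n g) = inner ℂ (coeff b n f) (coeff b n g) := inner_mode_right n _ _

lemma inner_proj_left {b : ℝ} (n : ℤ) (f g : LΩ b) :
    inner ℂ (proj b n f) g = inner ℂ (coeff b n f) (coeff b n g) := inner_mode_left n _ _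

lemma coeff_proj {b : ℝ} (n m : ℤ) (f : LΩ b) :
    coeff b n (proj b m f) = if n = m then coeff b m f else 0 := coeff_mode n m _

lemma isTest_proj {b : ℝ} {φ : Cyl → ℂ} (hφ : IsTest b φ) (n : ℤ) :
    IsTest b (modeFun n (rowCoeff n φ)) :=
  isTest_modeFun n (contDiff_rowCoeff hφ.1 n) (tsupport_rowCoeff hφ n).1 (tsupport_rowCoeff hφ n).2

lemma toLp_proj {b : ℝ} {φ : Cyl → ℂ} (hφ : IsSmooth φ) (n : ℤ) :
    (isSmooth_modeFun n (contDiff_rowCoeff hφ n)).toLp b = proj b n (hφ.toLp b) := by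
  rw [toLp_modeFun n (contDiff_rowCoeff hφ n), proj_apply, coeff_smooth hφ]

lemma toLp_pd_proj {b : ℝ} {φ : Cyl → ℂ} (hφ : IsSmooth φ) (n : ℤ) (i : Fin 2) :
    ((isSmooth_modeFun n (contDiff_rowCoeff hφ n)).pd i).toLp b = proj b n ((hφ.pd i).toLp b) := by
  rw [← toLp_proj]
  exact IsSmooth.toLp_congr _ _ b (pd_modeFun_rowCoeff hφ n i)

/-- The projection is self-adjoint, preserves test functions and commutes with derivatives on them,
so it can be moved onto the test function. -/
lemma IsWeakPartial.proj {b : ℝ} {i : Fin 2} {f g : LΩ b} (h : IsWeakPartial b i f g) (n : ℤ) :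
    IsWeakPartial b i (proj b n f) (proj b n g) := by
  rw [isWeakPartial_iff] at h ⊢
  intro ψ hψ
  have := h _ (isTest_proj hψ n)
  rw [toLp_pd_proj hψ.1, toLp_proj hψ.1, inner_proj_left, inner_proj_left] at this
  rw [inner_proj_right, inner_proj_right, this]

lemma seg_eq_zero {b : ℝ} {c : Lp ℂ 2 (segMeasure b)}
    (h : ∀ χ : ℝ → ℂ, ∀ hχ : ContDiff ℝ ∞ χ, HasCompactSupport χ → tsupport χ ⊆ Ioo (-b) 0 →
      inner ℂ (segLp hχ.continuous b) c = 0) : c = 0 := by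
  rw [Lp.eq_zero_iff_ae_eq_zero]
  have hi : Integrable c (segMeasure b) := (Lp.memLp c).integrable (by norm_num)
  have h1 : ∀ᵐ y ∂(segMeasure b), y ∈ Ioo (-b) 0 → c y = 0 := by
    refine isOpen_Ioo.ae_eq_zero_of_integral_contDiff_smul_eq_zero
      (hi.locallyIntegrable.locallyIntegrableOn _) fun χ hχ hc hs => ?_
    have hχ' : ContDiff ℝ ∞ (fun y => (χ y : ℂ)) := Complex.ofRealCLM.contDiff.comp hχ
    have hsupp : Function.support (fun y => (χ y : ℂ)) = Function.support χ := by
      ext y; simp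
    have := h _ hχ' (by rw [HasCompactSupport, tsupport, hsupp]; exact hc)
      (by rw [tsupport, hsupp]; exact hs)
    rw [segLp, inner_toLp_left] at this
    simpa using this
  filter_upwards [h1, ae_restrict_mem measurableSet_Ioo] with y hy hy' using hy hy'

/-- The separated test functions `e^{inx} χ(y)` already suffice: they reduce the claim to the
fundamental lemma on the segment, one Fourier coefficient at a time. -/
lemma eq_zero_of_test {b : ℝ} {g : LΩ b} (h : ∀ ψ (hψ : IsTest b ψ), inner ℂ (hψ.1.toLp b) g = 0) :
    g = 0 := by
  refine ext_coeff fun n => ?_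
  rw [map_zero]
  refine seg_eq_zero fun χ hχ hc hs => ?_
  rw [← inner_mode_left, ← toLp_modeFun n hχ]
  exact h _ (isTest_modeFun n hχ hc hs)

lemma IsWeakPartial.unique {b : ℝ} {i : Fin 2} {u w w' : Cyl → ℂ} (hu : MemLp u 2 (slabMeasure b))
    (h : IsWeakPartial b i u w) (h' : IsWeakPartial b i u w') : w =ᵐ[slabMeasure b] w' := by
  have hw := h.congr hu.coeFn_toLp.symm h.1.coeFn_toLp.symm
  have hw' := h'.congr hu.coeFn_toLp.symm h'.1.coeFn_toLp.symm
  rw [isWeakPartial_iff] at hw hw'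
  rw [← h.1.toLp_eq_toLp_iff h'.1, ← sub_eq_zero]
  refine eq_zero_of_test fun ψ hψ => ?_
  rw [inner_sub_right]
  linear_combination hw ψ hψ - hw' ψ hψ

lemma coeff_of_isWeakPartial {b : ℝ} {f g : LΩ b} (h : IsWeakPartial b 0 f g) (n : ℤ) :
    coeff b n g = (Complex.I * n) • coeff b n f := by
  rw [isWeakPartial_iff] at h
  rw [← sub_eq_zero]
  refine seg_eq_zero fun χ hχ hc hs => ?_
  have h1 := h _ (isTest_modeFun n hχ hc hs)
  have h2 : ((isSmooth_modeFun n hχ).pd 0).toLp b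
      = (Complex.I * n) • mode b n (segLp hχ.continuous b) := by
    rw [← toLp_modeFun n hχ]
    ext1
    refine (MemLp.coeFn_toLp _).trans ((?_ : _ =ᵐ[slabMeasure b] _).trans (Lp.coeFn_smul _ _).symm)
    filter_upwards [MemLp.coeFn_toLp ((isSmooth_modeFun n hχ).memLp b)] with p hp
    rw [pd_zero_modeFun n hχ, Pi.smul_apply, smul_eq_mul]
    congr 1
    exact hp.symm
  rw [h2, toLp_modeFun n hχ, inner_smul_left, inner_mode_left, inner_mode_left] at h1
  rw [inner_sub_right, inner_smul_right]
  simp only [map_mul, Complex.conj_I, map_intCast] at h1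
  linear_combination h1

lemma coeff_pd_zero {b : ℝ} (hb : 0 ≤ b) {φ : Cyl → ℂ} (hφ : IsSmooth φ) (n : ℤ) :
    coeff b n ((hφ.pd 0).toLp b) = (Complex.I * n) • coeff b n (hφ.toLp b) :=
  coeff_of_isWeakPartial ((isWeakPartial_smooth hb hφ 0).congr (hφ.memLp b).coeFn_toLp.symm
    ((hφ.pd 0).memLp b).coeFn_toLp.symm) n

/-- A function whose Fourier coefficients decay has a weak derivative in `x`. -/
lemma exists_isWeakPartial_zero {b : ℝ} (hb : 0 ≤ b) (f : LΩ b)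
    (hf : Summable fun n : ℤ => (n : ℝ) ^ 2 * ‖coeff b n f‖ ^ 2) :
    ∃ z : LΩ b, IsWeakPartial b 0 f z ∧ ‖z‖ ^ 2 = ∑' n : ℤ, (n : ℝ) ^ 2 * ‖coeff b n f‖ ^ 2 := by
  have hn : ∀ n : ℤ, ‖(Complex.I * n) • coeff b n f‖ ^ 2 = (n : ℝ) ^ 2 * ‖coeff b n f‖ ^ 2 := by
    intro n
    rw [norm_smul, mul_pow]
    simp
  obtain ⟨z, hz⟩ := exists_of_coeff (fun n : ℤ => (Complex.I * n) • coeff b n f)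
    (by simpa only [hn] using hf)
  refine ⟨z, isWeakPartial_iff.2 fun ψ hψ => ?_, ?_⟩
  · have h1 := hasSum_inner_coeff ((hψ.1.pd 0).toLp b) f
    have h2 := (hasSum_inner_coeff (hψ.1.toLp b) z).neg
    refine h1.unique (h2.congr_fun ?_)
    intro n
    rw [hz, coeff_pd_zero hb hψ.1, inner_smul_left, inner_smul_right]
    simp
  · have h1 := hasSum_norm_coeff z
    simp only [hz, hn] at h1
    exact h1.tsum_eq.symm

/-! ### Cutoff functions -/

lemma exists_bound_deriv_smoothTransition :
    ∃ M, 0 ≤ M ∧ (∀ t, |deriv Real.smoothTransition t| ≤ M) := by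
  have hc : Continuous (deriv Real.smoothTransition) :=
    (Real.smoothTransition.contDiff (n := 1)).continuous_deriv le_rfl
  obtain ⟨M, hM⟩ := (isCompact_Icc (a := (0 : ℝ)) (b := 1)).exists_bound_of_continuousOn hc.continuousOn
  refine ⟨max M 0, le_max_right _ _, fun t => ?_⟩
  by_cases ht : t ∈ Icc (0 : ℝ) 1
  · exact (hM t ht).trans (le_max_left _ _)
  · rw [mem_Icc, not_and_or, not_le, not_le] at ht
    have h0 : deriv Real.smoothTransition t = 0 := by
      rcases ht with ht | ht
      · have : Real.smoothTransition =ᶠ[𝓝 t] fun _ => 0 := by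
          filter_upwards [Iio_mem_nhds ht] with s hs
          exact Real.smoothTransition.zero_of_nonpos (le_of_lt hs)
        simpa using this.deriv_eq
      · have : Real.smoothTransition =ᶠ[𝓝 t] fun _ => 1 := by
          filter_upwards [Ioi_mem_nhds ht] with s hs
          exact Real.smoothTransition.one_of_one_le (le_of_lt hs)
        simpa using this.deriv_eq
    rw [h0]; simp

lemma deriv_smoothTransition_of_one_lt {t : ℝ} (ht : 1 < t) : deriv Real.smoothTransition t = 0 := by
  have : Real.smoothTransition =ᶠ[𝓝 t] fun _ => 1 := by
    filter_upwards [Ioi_mem_nhds ht] with s hs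
    exact Real.smoothTransition.one_of_one_le (le_of_lt hs)
  simpa using this.deriv_eq

/-- A smooth cutoff, equal to `1` at distance at least `2 / k` from the ends of `(-b, 0)` and to `0`
at distance at most `1 / k`. -/
def cutoff (b k y : ℝ) : ℝ :=
  Real.smoothTransition (k * (y + b) - 1) * Real.smoothTransition (k * (-y) - 1)

/-- The derivative of `cutoff`. -/
def cutoffDeriv (b k y : ℝ) : ℝ :=
  k * deriv Real.smoothTransition (k * (y + b) - 1) * Real.smoothTransition (k * (-y) - 1)
    - Real.smoothTransition (k * (y + b) - 1) * (k * deriv Real.smoothTransition (k * (-y) - 1))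

lemma contDiff_cutoff (b k : ℝ) : ContDiff ℝ ∞ (fun y => (cutoff b k y : ℂ)) := by
  have h1 : ContDiff ℝ ∞ (fun y : ℝ => k * (y + b) - 1) := by fun_prop
  have h2 : ContDiff ℝ ∞ (fun y : ℝ => k * (-y) - 1) := by fun_prop
  exact Complex.ofRealCLM.contDiff.comp
    ((Real.smoothTransition.contDiff.comp h1).mul (Real.smoothTransition.contDiff.comp h2))

lemma hasDerivAt_cutoff (b k y : ℝ) :
    HasDerivAt (fun y => (cutoff b k y : ℂ)) (cutoffDeriv b k y : ℂ) y := by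
  have hd : ∀ t, HasDerivAt Real.smoothTransition (deriv Real.smoothTransition t) t := fun t =>
    ((Real.smoothTransition.contDiff (n := 1)).differentiable (by simp) t).hasDerivAt
  have h1 : HasDerivAt (fun y : ℝ => k * (y + b) - 1) k y := by
    simpa using (((hasDerivAt_id y).add_const b).const_mul k).sub_const 1
  have h2 : HasDerivAt (fun y : ℝ => k * (-y) - 1) (-k) y := by
    simpa using (((hasDerivAt_id y).neg).const_mul k).sub_const 1
  have := ((hd _).comp y h1).mul ((hd _).comp y h2)
  have h3 : HasDerivAt (cutoff b k) (cutoffDeriv b k y) y := by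
    refine HasDerivAt.congr_deriv (f := cutoff b k) this ?_
    simp only [cutoffDeriv, Function.comp]; ring
  exact h3.ofReal_comp

lemma cutoff_support {b k : ℝ} (hk : 0 < k) :
    HasCompactSupport (fun y => (cutoff b k y : ℂ)) ∧
      tsupport (fun y => (cutoff b k y : ℂ)) ⊆ Ioo (-b) 0 := by
  have hs : tsupport (fun y => (cutoff b k y : ℂ)) ⊆ Icc (-b + k⁻¹) (-k⁻¹) := by
    refine closure_minimal (fun y hy => ?_) isClosed_Icc
    have hne : cutoff b k y ≠ 0 := by simpa using hy
    rw [cutoff] at hne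
    have h1 : 0 < k * (y + b) - 1 := by
      by_contra h
      exact (left_ne_zero_of_mul hne) (Real.smoothTransition.zero_of_nonpos (not_lt.1 h))
    have h2 : 0 < k * (-y) - 1 := by
      by_contra h
      exact (right_ne_zero_of_mul hne) (Real.smoothTransition.zero_of_nonpos (not_lt.1 h))
    have hkk : k * k⁻¹ = 1 := mul_inv_cancel₀ hk.ne'
    constructor
    · by_contra h; nlinarith
    · by_contra h; nlinarith
  have hi : 0 < k⁻¹ := inv_pos.2 hk
  exact ⟨isCompact_Icc.of_isClosed_subset (isClosed_tsupport _) hs,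
    hs.trans fun y hy => ⟨by linarith [hy.1], by linarith [hy.2]⟩⟩

lemma abs_cutoff_le (b k y : ℝ) : |cutoff b k y| ≤ 1 := by
  rw [cutoff, abs_mul, abs_of_nonneg (Real.smoothTransition.nonneg _),
    abs_of_nonneg (Real.smoothTransition.nonneg _)]
  exact mul_le_one₀ (Real.smoothTransition.le_one _) (Real.smoothTransition.nonneg _)
    (Real.smoothTransition.le_one _)

/-- The derivative vanishes where `k s > 2`. Elsewhere the large factor `k` is absorbed by `a ≤ L
s`. -/
lemma scaled_deriv_bound {M L k s a : ℝ} (hM : ∀ t, |deriv Real.smoothTransition t| ≤ M)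
    (hM0 : 0 ≤ M) (hk : 0 ≤ k) (ha : 0 ≤ a) (haL : a ≤ L * s) (hL : 0 ≤ L) :
    k * |deriv Real.smoothTransition (k * s - 1)| * a ≤ 2 * M * L := by
  by_cases h : 1 < k * s - 1
  · rw [deriv_smoothTransition_of_one_lt h]; simp; positivity
  · calc k * |deriv Real.smoothTransition (k * s - 1)| * a ≤ k * M * (L * s) := by
          gcongr; exact hM _
      _ = M * L * (k * s) := by ring
      _ ≤ M * L * 2 := by gcongr; linarith
      _ = 2 * M * L := by ring

lemma abs_cutoffDeriv_mul_le {b M L k y a : ℝ} (hM : ∀ t, |deriv Real.smoothTransition t| ≤ M)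
    (hM0 : 0 ≤ M) (hk : 0 ≤ k) (ha : 0 ≤ a) (h1 : a ≤ L * (y + b)) (h2 : a ≤ L * (-y)) (hL : 0 ≤ L) :
    |cutoffDeriv b k y| * a ≤ 4 * M * L := by
  have e1 := scaled_deriv_bound hM hM0 hk ha h1 hL
  have e2 := scaled_deriv_bound hM hM0 hk ha h2 hL
  have n1 := Real.smoothTransition.nonneg (k * (y + b) - 1)
  have n2 := Real.smoothTransition.nonneg (k * (-y) - 1)
  have l1 := Real.smoothTransition.le_one (k * (y + b) - 1)
  have l2 := Real.smoothTransition.le_one (k * (-y) - 1)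
  have : |cutoffDeriv b k y| ≤ k * |deriv Real.smoothTransition (k * (y + b) - 1)|
      + k * |deriv Real.smoothTransition (k * (-y) - 1)| := by
    refine (abs_sub _ _).trans (add_le_add ?_ ?_)
    · rw [abs_mul, abs_mul, abs_of_nonneg hk, abs_of_nonneg n2]
      exact mul_le_of_le_one_right (by positivity) l2
    · rw [abs_mul, abs_mul, abs_of_nonneg hk, abs_of_nonneg n1]
      exact mul_le_of_le_one_left (by positivity) l1
  calc |cutoffDeriv b k y| * a ≤ _ := mul_le_mul_of_nonneg_right this ha
    _ ≤ 4 * M * L := by rw [add_mul]; linarith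

/-! ### The Gauss-Green formula -/

lemma IsSmooth.lipschitz_snd {φ : Cyl → ℂ} (hφ : IsSmooth φ) (b : ℝ) :
    ∃ L, 0 ≤ L ∧ ∀ x : S, ∀ y ∈ Icc (-b) 0, ∀ z ∈ Icc (-b) 0, ‖φ (x, y) - φ (x, z)‖ ≤ L * |y - z| := by
  obtain ⟨L, hL0, hL⟩ := exists_bound_slab (hφ.pd 1).continuous b
  refine ⟨L, hL0, fun x y hy z hz => ?_⟩
  exact (convex_Icc (-b) 0).norm_image_sub_le_of_norm_hasDerivWithin_le
    (f := fun t => φ (x, t)) (f' := fun t => HelmholtzSlab.pd 1 φ (x, t))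
    (fun t _ => (hφ.hasDerivAt_snd x t).hasDerivWithinAt) (fun t ht => hL x t ht) hz hy

/-- Multiplying `φ` by a cutoff gives a genuine test function. The derivative of the cutoff is of
the size of its scale, but `φ` vanishes linearly at both ends, so the product stays bounded, and at
each interior point it is eventually zero. Dominated convergence removes the cutoff. -/
lemma gauss_green_of_zero {b : ℝ} (hb : 0 < b) {u w φ : Cyl → ℂ} (hu : MemLp u 2 (slabMeasure b))
    (hw : IsWeakPartial b 1 u w) (hφ : IsSmooth φ) (h0 : ∀ x : S, φ (x, 0) = 0)
    (h1 : ∀ x : S, φ (x, -b) = 0) :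
    ∫ p, (w p * φ p + u p * pd 1 φ p) ∂(slabMeasure b) = 0 := by
  obtain ⟨M, hM0, hM⟩ := exists_bound_deriv_smoothTransition
  obtain ⟨L, hL0, hL⟩ := hφ.lipschitz_snd b
  obtain ⟨C, hC0, hC⟩ := exists_bound_slab hφ.continuous b
  obtain ⟨C', hC0', hC'⟩ := exists_bound_slab (hφ.pd 1).continuous b
  have hui : Integrable u (slabMeasure b) := hu.integrable (by norm_num)
  have hwi : Integrable w (slabMeasure b) := hw.1.integrable (by norm_num)
  -- The Gauss-Green integrand of the truncated `φ`; the scale `k + 1` is positive already at `k =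
  -- 0`.
  let F : ℕ → Cyl → ℂ := fun k p =>
    w p * (φ p * cutoff b (k + 1) p.2)
      + u p * (pd 1 φ p * cutoff b (k + 1) p.2 + φ p * cutoffDeriv b (k + 1) p.2)
  have hpd : ∀ k : ℕ, ∀ p, pd 1 (fun p => φ p * cutoff b (k + 1) p.2) p
      = pd 1 φ p * cutoff b (k + 1) p.2 + φ p * cutoffDeriv b (k + 1) p.2 := by
    intro k p
    have hs := isSmooth_snd (contDiff_cutoff b (k + 1))
    rw [pd_mul hφ hs]
    congr 2
    exact hs.pd_one_eq (x := p.1) (y := p.2) (hasDerivAt_cutoff b (k + 1) p.2)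
  have htest : ∀ k : ℕ, IsTest b (fun p => φ p * cutoff b (k + 1) p.2) := by
    intro k
    have hs := cutoff_support (b := b) (k := k + 1) (by positivity)
    have := (isTest_snd (contDiff_cutoff b (k + 1)) hs.1 hs.2).mul_right hφ
    simpa only [mul_comm] using this
  have hi : ∀ (k : ℕ), Integrable (F k) (slabMeasure b) ∧ ∫ p, F k p ∂(slabMeasure b) = 0 := by
    intro k
    have ht := htest k
    have e := hw.2 _ ht
    simp only [hpd] at e
    have i1 : Integrable (fun p => w p * (φ p * cutoff b (k + 1) p.2)) (slabMeasure b) :=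
      hw.1.integrable_mul (ht.1.memLp b)
    have i2 : Integrable (fun p => u p *
        (pd 1 φ p * cutoff b (k + 1) p.2 + φ p * cutoffDeriv b (k + 1) p.2)) (slabMeasure b) := by
      have := hu.integrable_mul ((ht.1.pd 1).memLp b)
      refine this.congr (Eventually.of_forall fun p => ?_)
      simp only [Pi.mul_apply, hpd]
    refine ⟨i1.add i2, ?_⟩
    simp only [F]
    rw [integral_add i1 i2, e]; ring
  have hlim : Tendsto (fun k => ∫ p, F k p ∂(slabMeasure b)) atTop
      (𝓝 (∫ p, (w p * φ p + u p * pd 1 φ p) ∂(slabMeasure b))) := by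
    refine tendsto_integral_of_dominated_convergence
      (fun p => ‖w p‖ * C + ‖u p‖ * (C' + 4 * M * L)) (fun k => (hi k).1.aestronglyMeasurable)
      ((hwi.norm.mul_const _).add (hui.norm.mul_const _)) (fun k => ?_) ?_
    · filter_upwards [ae_mem_slab b] with p hp
      have hp' := Ioo_subset_Icc_self hp
      have b1 : ‖φ p‖ ≤ L * (p.2 + b) := by
        have := hL p.1 p.2 hp' (-b) ⟨le_rfl, by linarith⟩
        rw [h1, sub_zero, abs_of_nonneg (by linarith [hp.1])] at this
        simpa using this
      have b2 : ‖φ p‖ ≤ L * (-p.2) := by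
        have := hL p.1 p.2 hp' 0 ⟨by linarith, le_rfl⟩
        rw [h0, sub_zero, sub_zero, abs_of_neg hp.2] at this
        exact this
      have b3 := abs_cutoffDeriv_mul_le (k := (k : ℝ) + 1) hM hM0 (by positivity) (norm_nonneg (φ p)) b1 b2 hL0
      have b4 := abs_cutoff_le b (k + 1) p.2
      have n4 : ‖(cutoff b (k + 1) p.2 : ℂ)‖ ≤ 1 := by
        rwa [Complex.norm_real]
      have n3 : ‖(cutoffDeriv b (k + 1) p.2 : ℂ)‖ = |cutoffDeriv b (k + 1) p.2| := by
        rw [Complex.norm_real, Real.norm_eq_abs]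
      refine (norm_add_le _ _).trans (add_le_add ?_ ?_)
      · rw [norm_mul, norm_mul]
        gcongr
        exact (mul_le_of_le_one_right (norm_nonneg _) n4).trans (hC p.1 p.2 hp')
      · rw [norm_mul]
        gcongr
        refine (norm_add_le _ _).trans (add_le_add ?_ ?_)
        · rw [norm_mul]
          exact (mul_le_of_le_one_right (norm_nonneg _) n4).trans (hC' p.1 p.2 hp')
        · rw [norm_mul, n3, mul_comm]; exact b3
    · filter_upwards [ae_mem_slab b] with p hp
      refine tendsto_const_nhds.congr' ?_
      have hk : Tendsto (fun k : ℕ => (k : ℝ) + 1) atTop atTop :=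
        tendsto_atTop_add_const_right _ _ tendsto_natCast_atTop_atTop
      have e1 := (hk.atTop_mul_const (show 0 < p.2 + b by linarith [hp.1])).eventually_gt_atTop 2
      have e2 := (hk.atTop_mul_const (show 0 < -p.2 by linarith [hp.2])).eventually_gt_atTop 2
      filter_upwards [e1, e2] with k e1 e2
      have c1 : cutoff b (k + 1) p.2 = 1 := by
        rw [cutoff, Real.smoothTransition.one_of_one_le (by linarith),
          Real.smoothTransition.one_of_one_le (by linarith), one_mul]
      have c2 : cutoffDeriv b (k + 1) p.2 = 0 := by
        rw [cutoffDeriv, deriv_smoothTransition_of_one_lt (by linarith),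
          deriv_smoothTransition_of_one_lt (by linarith)]; ring
      simp [F, c1, c2]
  simp only [(hi _).2] at hlim
  exact (tendsto_nhds_unique tendsto_const_nhds hlim).symm

/-- Cauchy-Schwarz against the constant `1`, obtained from the nonnegativity of the variance of
`‖g‖`. -/
lemma sq_integral_norm_le {b : ℝ} (hb : 0 < b) {g : ℝ → ℂ} (hg : MemLp g 2 (segMeasure b)) :
    ‖∫ y, g y ∂(segMeasure b)‖ ^ 2 ≤ b * ∫ y, ‖g y‖ ^ 2 ∂(segMeasure b) := by
  have h1 : Integrable (fun y => ‖g y‖) (segMeasure b) := (hg.integrable (by norm_num)).norm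
  have h2 : Integrable (fun y => ‖g y‖ ^ 2) (segMeasure b) := hg.integrable_norm_pow (p := 2) (by norm_num)
  have hvol : (segMeasure b).real univ = b := by
    simp [segMeasure, Measure.real, hb.le]
  set A := ∫ y, ‖g y‖ ∂(segMeasure b) with hA
  have h3 : 0 ≤ ∫ y, (‖g y‖ - A / b) ^ 2 ∂(segMeasure b) := integral_nonneg fun y => sq_nonneg _
  have h4 : ∫ y, (‖g y‖ - A / b) ^ 2 ∂(segMeasure b)
      = (∫ y, ‖g y‖ ^ 2 ∂(segMeasure b)) - A ^ 2 / b := by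
    have : ∀ y, (‖g y‖ - A / b) ^ 2 = ‖g y‖ ^ 2 - (2 * (A / b) * ‖g y‖ - (A / b) ^ 2) := fun y => by ring
    simp only [this]
    have e : Integrable (fun y => 2 * (A / b) * ‖g y‖ - (A / b) ^ 2) (segMeasure b) :=
      (h1.const_mul _).sub (integrable_const _)
    rw [integral_sub h2 e, integral_sub (h1.const_mul _) (integrable_const _), integral_const_mul, integral_const, hvol, ← hA]
    simp only [smul_eq_mul]
    field_simp; ring
  rw [h4] at h3
  have h5 : A ^ 2 ≤ b * ∫ y, ‖g y‖ ^ 2 ∂(segMeasure b) := by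
    rw [sub_nonneg, div_le_iff₀ hb] at h3; linarith
  exact (pow_le_pow_left₀ (norm_nonneg _) (norm_integral_le_integral_norm _) 2).trans h5

lemma memLp_integral_snd {b : ℝ} (hb : 0 < b) {f : Cyl → ℂ} (hf : MemLp f 2 (slabMeasure b)) :
    MemLp (fun x : S => ∫ y, f (x, y) ∂(segMeasure b)) 2 volume := by
  have hm : AEStronglyMeasurable f ((volume : Measure S).prod (segMeasure b)) := hf.1
  have hsq : Integrable (fun p => ‖f p‖ ^ 2) ((volume : Measure S).prod (segMeasure b)) :=
    hf.integrable_norm_pow (p := 2) (by norm_num)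
  have hm' := hm.integral_prod_right'
  rw [memLp_two_iff_integrable_sq_norm hm']
  refine (hsq.integral_prod_left.const_mul b).mono' (hm'.norm.pow 2) ?_
  filter_upwards [hm.prodMk_left, hsq.prod_right_ae] with x h1 h2
  rw [Real.norm_of_nonneg (by positivity)]
  exact sq_integral_norm_le hb ((memLp_two_iff_integrable_sq_norm h1).2 h2)

/-- Subtracting from `φ` the interpolation of its boundary values that is affine in `y` leaves a
function vanishing at both ends, to which `gauss_green_of_zero` applies. The interpolant contributes
integrals against the boundary values alone, and their densities are the traces. -/
lemma exists_gauss_green {b : ℝ} (hb : 0 < b) {u w : Cyl → ℂ} (hu : MemLp u 2 (slabMeasure b))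
    (hw : IsWeakPartial b 1 u w) :
    ∃ τ : (S → ℂ) × (S → ℂ), MemLp τ.1 2 (volume : Measure S) ∧ MemLp τ.2 2 (volume : Measure S) ∧
      ∀ φ : Cyl → ℂ, IsSmooth φ →
        ∫ p, (w p * φ p + u p * pd 1 φ p) ∂(slabMeasure b)
          = (∫ x : S, τ.1 x * φ (x, 0)) - ∫ x : S, τ.2 x * φ (x, -b) := by
  have hbc : (b : ℂ) ≠ 0 := by exact_mod_cast hb.ne'
  have s0 : ContDiff ℝ ∞ (fun y : ℝ => ((y : ℂ) + b) / b) :=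
    (Complex.ofRealCLM.contDiff.add contDiff_const).div_const _
  have s1 : ContDiff ℝ ∞ (fun y : ℝ => (y : ℂ) / b) := Complex.ofRealCLM.contDiff.div_const _
  have d0 : ∀ p : Cyl, pd 1 (fun p : Cyl => ((p.2 : ℂ) + b) / b) p = 1 / b := fun p =>
    (isSmooth_snd s0).pd_one_eq (x := p.1) (y := p.2)
      ((((hasDerivAt_id p.2).ofReal_comp).add_const (b : ℂ)).div_const (b : ℂ))
  have d1 : ∀ p : Cyl, pd 1 (fun p : Cyl => (p.2 : ℂ) / b) p = 1 / b := fun p =>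
    (isSmooth_snd s1).pd_one_eq (x := p.1) (y := p.2)
      (((hasDerivAt_id p.2).ofReal_comp).div_const (b : ℂ))
  have c0 : Continuous (fun p : Cyl => ((p.2 : ℂ) + b) / b) := (isSmooth_snd s0).continuous
  have c1 : Continuous (fun p : Cyl => (p.2 : ℂ) / b) := (isSmooth_snd s1).continuous
  -- Formally `f₀ = ∂_y (u (y + b) / b)` and `f₁ = ∂_y (u y / b)`, so their integrals in `y` are
  -- `u(x, 0)` and `u(x, -b)`.
  obtain ⟨f₀, hf₀⟩ : ∃ f : Cyl → ℂ, f = fun p => u p / b + w p * (((p.2 : ℂ) + b) / b) := ⟨_, rfl⟩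
  obtain ⟨f₁, hf₁⟩ : ∃ f : Cyl → ℂ, f = fun p => u p / b + w p * ((p.2 : ℂ) / b) := ⟨_, rfl⟩
  have hub : MemLp (fun p => u p / b) 2 (slabMeasure b) := by
    simpa only [div_eq_inv_mul] using hu.const_mul ((b : ℂ)⁻¹)
  have m0 : MemLp f₀ 2 (slabMeasure b) := by
    rw [hf₀]; exact hub.add ((memLp_of_continuous c0 b ∞).mul hw.1)
  have m1 : MemLp f₁ 2 (slabMeasure b) := by
    rw [hf₁]; exact hub.add ((memLp_of_continuous c1 b ∞).mul hw.1)
  refine ⟨(fun x => ∫ y, f₀ (x, y) ∂(segMeasure b), fun x => ∫ y, f₁ (x, y) ∂(segMeasure b)),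
    memLp_integral_snd hb m0, memLp_integral_snd hb m1, fun φ hφ => ?_⟩
  have hA := hφ.slice 0
  have hB := hφ.slice (-b)
  have hAs := hA.mul (isSmooth_snd s0)
  have hBs := hB.mul (isSmooth_snd s1)
  have pA : ∀ p, pd 1 (fun p : Cyl => φ (p.1, 0) * (((p.2 : ℂ) + b) / b)) p = φ (p.1, 0) / b := by
    intro p
    rw [pd_mul hA (isSmooth_snd s0), d0, pd_one_fst (φ := fun x => φ (x, 0))]; ring
  have pB : ∀ p, pd 1 (fun p : Cyl => φ (p.1, -b) * ((p.2 : ℂ) / b)) p = φ (p.1, -b) / b := by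
    intro p
    rw [pd_mul hB (isSmooth_snd s1), d1, pd_one_fst (φ := fun x => φ (x, -b))]; ring
  have hψ : IsSmooth (fun p : Cyl => φ p - (φ (p.1, 0) * (((p.2 : ℂ) + b) / b)
      - φ (p.1, -b) * ((p.2 : ℂ) / b))) := hφ.sub (hAs.sub hBs)
  have pψ : ∀ p, pd 1 (fun p : Cyl => φ p - (φ (p.1, 0) * (((p.2 : ℂ) + b) / b)
      - φ (p.1, -b) * ((p.2 : ℂ) / b))) p = pd 1 φ p - (φ (p.1, 0) / b - φ (p.1, -b) / b) := by
    intro p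
    rw [← pA, ← pB]
    exact hψ.pd_one_eq (x := p.1) (y := p.2)
      ((hφ.hasDerivAt_snd _ _).sub ((hAs.hasDerivAt_snd _ _).sub (hBs.hasDerivAt_snd _ _)))
  have key := gauss_green_of_zero hb hu hw hψ (fun x => by simp [hbc]) (fun x => by simp [hbc])
  simp only [pψ] at key
  have iφ : Integrable (fun p => w p * φ p + u p * pd 1 φ p) (slabMeasure b) :=
    (hw.1.integrable_mul (hφ.memLp b)).add (hu.integrable_mul ((hφ.pd 1).memLp b))
  have i0 : Integrable (fun p : Cyl => f₀ p * φ (p.1, 0)) (slabMeasure b) :=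
    m0.integrable_mul (hA.memLp b)
  have i1 : Integrable (fun p : Cyl => f₁ p * φ (p.1, -b)) (slabMeasure b) :=
    m1.integrable_mul (hB.memLp b)
  have split : ∫ p, (w p * φ p + u p * pd 1 φ p) ∂(slabMeasure b)
      = (∫ p : Cyl, f₀ p * φ (p.1, 0) ∂(slabMeasure b))
        - ∫ p : Cyl, f₁ p * φ (p.1, -b) ∂(slabMeasure b) := by
    have hsub : Integrable (fun p : Cyl => f₀ p * φ (p.1, 0) - f₁ p * φ (p.1, -b)) (slabMeasure b) :=
      i0.sub i1
    rw [← integral_sub i0 i1, ← sub_eq_zero, ← integral_sub iφ hsub, ← key]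
    congr 1; ext p; rw [hf₀, hf₁]; ring
  rw [split, integral_slab' i0, integral_slab' i1]
  simp only [integral_mul_const, segMeasure]

/-! ### The Hilbert space `H¹(Ω)` -/

/-- The triples `(u, w₀, w₁)` in `L²(Ω)³` such that `w₀` and `w₁` are the weak partial derivatives
of `u`. -/
def H1 (b : ℝ) : Submodule ℂ (PiLp 2 fun _ : Fin 3 => LΩ b) where
  carrier := {U | ∀ i : Fin 2, IsWeakPartial b i (U 0) (U i.succ)}
  zero_mem' i := isWeakPartial_iff.2 fun ψ hψ => by simp
  add_mem' {U V} hU hV i := isWeakPartial_iff.2 fun ψ hψ => by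
    have h1 := isWeakPartial_iff.1 (hU i) ψ hψ
    have h2 := isWeakPartial_iff.1 (hV i) ψ hψ
    simp only [PiLp.add_apply, inner_add_right, h1, h2]; ring
  smul_mem' c U hU i := isWeakPartial_iff.2 fun ψ hψ => by
    have h1 := isWeakPartial_iff.1 (hU i) ψ hψ
    simp only [PiLp.smul_apply, inner_smul_right, h1]; ring

lemma isClosed_H1 (b : ℝ) : IsClosed (H1 b : Set (PiLp 2 fun _ : Fin 3 => LΩ b)) := by
  have : (H1 b : Set (PiLp 2 fun _ : Fin 3 => LΩ b)) = ⋂ (i : Fin 2) (ψ : Cyl → ℂ) (h : IsTest b ψ),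
      {U | inner ℂ ((h.1.pd i).toLp b) (U 0) = - inner ℂ (h.1.toLp b) (U i.succ)} := by
    ext U
    simp only [mem_iInter, mem_ofPred_eq]
    exact forall_congr' fun i => isWeakPartial_iff
  rw [this]
  refine isClosed_iInter fun i => isClosed_iInter fun ψ => isClosed_iInter fun h => ?_
  have hc : ∀ j : Fin 3, Continuous fun U : PiLp 2 (fun _ : Fin 3 => LΩ b) => U j := fun j =>
    PiLp.continuous_apply 2 _ j
  exact isClosed_eq (continuous_const.inner (hc 0)) (continuous_const.inner (hc i.succ)).neg

instance (b : ℝ) : CompleteSpace (H1 b) := (isClosed_H1 b).completeSpace_coe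

namespace H1

/-- The underlying function of an element of `H¹(Ω)`. -/
def fn (b : ℝ) : H1 b →L[ℂ] LΩ b :=
  (PiLp.proj 2 (fun _ : Fin 3 => LΩ b) 0).comp (H1 b).subtypeL

/-- The weak partial derivatives of an element of `H¹(Ω)`. -/
def grad (b : ℝ) (i : Fin 2) : H1 b →L[ℂ] LΩ b :=
  (PiLp.proj 2 (fun _ : Fin 3 => LΩ b) i.succ).comp (H1 b).subtypeL

variable {b : ℝ}

lemma isWeakPartial (U : H1 b) (i : Fin 2) : IsWeakPartial b i (fn b U) (grad b i U) := U.2 i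

lemma norm_sq_eq (U : H1 b) :
    ‖U‖ ^ 2 = ‖fn b U‖ ^ 2 + ‖grad b 0 U‖ ^ 2 + ‖grad b 1 U‖ ^ 2 := by
  rw [Submodule.coe_norm, PiLp.norm_sq_eq_of_L2, Fin.sum_univ_three]; rfl

lemma norm_fn_le (U : H1 b) : ‖fn b U‖ ≤ ‖U‖ := by
  refine le_of_sq_le_sq ?_ (norm_nonneg _)
  rw [norm_sq_eq]; nlinarith [sq_nonneg ‖grad b 0 U‖, sq_nonneg ‖grad b 1 U‖]

lemma norm_grad_le (i : Fin 2) (U : H1 b) : ‖grad b i U‖ ≤ ‖U‖ := by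
  refine le_of_sq_le_sq ?_ (norm_nonneg _)
  rw [norm_sq_eq]
  fin_cases i <;>
    simp only [Fin.zero_eta, Fin.mk_one] <;>
    nlinarith [sq_nonneg ‖grad b 0 U‖, sq_nonneg ‖grad b 1 U‖, sq_nonneg ‖fn b U‖]

/-- The element of `H¹(Ω)` with given function and weak partial derivatives. -/
def mk (f g₀ g₁ : LΩ b) (h₀ : IsWeakPartial b 0 f g₀) (h₁ : IsWeakPartial b 1 f g₁) : H1 b :=
  ⟨WithLp.toLp 2 ![f, g₀, g₁], fun i => by fin_cases i; exacts [h₀, h₁]⟩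

lemma grad_mk (f g₀ g₁ : LΩ b) (h₀ : IsWeakPartial b 0 f g₀) (h₁ : IsWeakPartial b 1 f g₁)
    (i : Fin 2) : grad b i (mk f g₀ g₁ h₀ h₁) = ![g₀, g₁] i := by
  fin_cases i <;> rfl

/-- The part of frequency `n` of an element of `H¹(Ω)`. -/
def modePart (n : ℤ) (U : H1 b) : H1 b :=
  mk (proj b n (fn b U)) (proj b n (grad b 0 U)) (proj b n (grad b 1 U))
    ((isWeakPartial U 0).proj n) ((isWeakPartial U 1).proj n)

lemma fn_modePart (n : ℤ) (U : H1 b) : fn b (modePart n U) = proj b n (fn b U) := rfl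

lemma grad_modePart (n : ℤ) (U : H1 b) (i : Fin 2) :
    grad b i (modePart n U) = proj b n (grad b i U) := by fin_cases i <;> rfl

lemma norm_proj (n : ℤ) (f : LΩ b) : ‖proj b n f‖ = ‖coeff b n f‖ := (mode b n).norm_map _

lemma norm_sq_modePart (n : ℤ) (U : H1 b) : ‖modePart n U‖ ^ 2 = ‖coeff b n (fn b U)‖ ^ 2
    + ‖coeff b n (grad b 0 U)‖ ^ 2 + ‖coeff b n (grad b 1 U)‖ ^ 2 := by
  rw [norm_sq_eq, fn_modePart, grad_modePart, grad_modePart, norm_proj, norm_proj, norm_proj]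

lemma hasSum_norm_modePart (U : H1 b) : HasSum (fun n => ‖modePart n U‖ ^ 2) (‖U‖ ^ 2) := by
  simp only [norm_sq_modePart]
  rw [norm_sq_eq]
  exact ((hasSum_norm_coeff _).add (hasSum_norm_coeff _)).add (hasSum_norm_coeff _)

lemma coeff_grad_zero (n : ℤ) (U : H1 b) :
    coeff b n (grad b 0 U) = (Complex.I * n) • coeff b n (fn b U) :=
  coeff_of_isWeakPartial (isWeakPartial U 0) n

lemma norm_sq_coeff_grad_zero (n : ℤ) (U : H1 b) :
    ‖coeff b n (grad b 0 U)‖ ^ 2 = (n : ℝ) ^ 2 * ‖coeff b n (fn b U)‖ ^ 2 := by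
  rw [coeff_grad_zero, norm_smul, mul_pow]; simp

/-- Cauchy-Schwarz in `ℓ²(ℤ)` combined with Parseval; this is the majorant for the
Dirichlet-to-Neumann series. -/
lemma tsum_modePart_mul (U V : H1 b) : Summable (fun n => ‖modePart n U‖ * ‖modePart n V‖) ∧
    ∑' n, ‖modePart n U‖ * ‖modePart n V‖ ≤ ‖U‖ * ‖V‖ := by
  have h := Real.summable_and_inner_le_Lp_mul_Lq_tsum_of_nonneg (p := 2) (q := 2)
    (by constructor <;> norm_num) (f := fun n => ‖modePart n U‖) (g := fun n => ‖modePart n V‖)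
    (fun n => norm_nonneg _) (fun n => norm_nonneg _)
    (by simpa using (hasSum_norm_modePart U).summable)
    (by simpa using (hasSum_norm_modePart V).summable)
  refine ⟨h.1, h.2.trans_eq ?_⟩
  simp only [Real.rpow_two, (hasSum_norm_modePart U).tsum_eq, (hasSum_norm_modePart V).tsum_eq]
  rw [← Real.sqrt_eq_rpow, ← Real.sqrt_eq_rpow, Real.sqrt_sq (norm_nonneg _),
    Real.sqrt_sq (norm_nonneg _)]

end H1

/-! ### Fourier coefficients of traces -/

/-- A power function on `[-b, 0]` concentrated near the end `0` (for `s = 0`) or `-b` (for `s = 1`),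
at which it equals `1`, and vanishing at the other end. -/
def bump (b : ℝ) (s : Fin 2) (n : ℤ) (y : ℝ) : ℂ :=
  match s with
  | 0 => ((((y + b) / b) ^ (n.natAbs + 1) : ℝ) : ℂ)
  | 1 => (((-y / b) ^ (n.natAbs + 1) : ℝ) : ℂ)

/-- The derivative of `bump`. -/
def bumpDeriv (b : ℝ) (s : Fin 2) (n : ℤ) (y : ℝ) : ℂ :=
  match s with
  | 0 => (((n.natAbs + 1) * ((y + b) / b) ^ n.natAbs * (1 / b) : ℝ) : ℂ)
  | 1 => (((n.natAbs + 1) * (-y / b) ^ n.natAbs * (-1 / b) : ℝ) : ℂ)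

lemma contDiff_bump (b : ℝ) (s : Fin 2) (n : ℤ) : ContDiff ℝ ∞ (bump b s n) := by
  fin_cases s
  · have h : ContDiff ℝ ∞ (fun y : ℝ => ((y + b) / b) ^ (n.natAbs + 1)) := by fun_prop
    exact Complex.ofRealCLM.contDiff.comp h
  · have h : ContDiff ℝ ∞ (fun y : ℝ => (-y / b) ^ (n.natAbs + 1)) := by fun_prop
    exact Complex.ofRealCLM.contDiff.comp h

lemma hasDerivAt_bump (b : ℝ) (s : Fin 2) (n : ℤ) (y : ℝ) :
    HasDerivAt (bump b s n) (bumpDeriv b s n y) y := by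
  fin_cases s
  · have h := ((((hasDerivAt_id y).add_const b).div_const b).pow (n.natAbs + 1)).ofReal_comp
    refine h.congr_deriv ?_
    simp [bumpDeriv]
  · have h := ((((hasDerivAt_id y).neg).div_const b).pow (n.natAbs + 1)).ofReal_comp
    refine h.congr_deriv ?_
    simp [bumpDeriv]

lemma deriv_bump (b : ℝ) (s : Fin 2) (n : ℤ) : deriv (bump b s n) = bumpDeriv b s n :=
  funext fun y => (hasDerivAt_bump b s n y).deriv

lemma continuous_bumpDeriv (b : ℝ) (s : Fin 2) (n : ℤ) : Continuous (bumpDeriv b s n) := by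
  rw [← deriv_bump]
  exact (contDiff_bump b s n).continuous_deriv (by simp)

lemma norm_sq_segLp {c : ℝ → ℂ} (hc : Continuous c) {b : ℝ} (hb : 0 ≤ b) :
    ‖segLp hc b‖ ^ 2 = ∫ y in (-b)..0, ‖c y‖ ^ 2 := by
  have h : (inner ℂ (segLp hc b) (segLp hc b) : ℂ) = ((∫ y in (-b)..0, ‖c y‖ ^ 2 : ℝ) : ℂ) := by
    rw [intervalIntegral.integral_of_le (by linarith), integral_Ioc_eq_integral_Ioo,
      ← integral_complex_ofReal]
    refine (inner_toLp_left (memLp_seg hc b 2) _).trans (integral_congr_ae ?_)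
    filter_upwards [MemLp.coeFn_toLp (memLp_seg hc b 2)] with y hy
    rw [show (segLp hc b : ℝ → ℂ) y = c y from hy, mul_comm, Complex.mul_conj, Complex.normSq_eq_norm_sq]
  rw [inner_self_eq_norm_sq_to_K] at h
  apply Complex.ofReal_injective
  rw [← h]; push_cast; rfl

lemma integral_shift_pow {b : ℝ} (hb : 0 < b) (k : ℕ) :
    ∫ y in (-b)..0, ((y + b) / b) ^ k = b / (k + 1) := by
  have h : ∀ y, HasDerivAt (fun y : ℝ => b / (k + 1) * ((y + b) / b) ^ (k + 1)) (((y + b) / b) ^ k) y := by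
    intro y
    refine (((((hasDerivAt_id y).add_const b).div_const b).pow (k + 1)).const_mul _).congr_deriv ?_
    simp only [id]; push_cast; field_simp
  rw [intervalIntegral.integral_eq_sub_of_hasDerivAt (fun y _ => h y)
    ((by fun_prop : Continuous fun y : ℝ => ((y + b) / b) ^ k).intervalIntegrable _ _)]
  simp [hb.ne']

lemma integral_neg_pow {b : ℝ} (hb : 0 < b) (k : ℕ) :
    ∫ y in (-b)..0, (-y / b) ^ k = b / (k + 1) := by
  have h : ∀ y, HasDerivAt (fun y : ℝ => -(b / (k + 1)) * (-y / b) ^ (k + 1)) ((-y / b) ^ k) y := by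
    intro y
    refine (((((hasDerivAt_id y).neg).div_const b).pow (k + 1)).const_mul _).congr_deriv ?_
    simp; field_simp
  rw [intervalIntegral.integral_eq_sub_of_hasDerivAt (fun y _ => h y)
    ((by fun_prop : Continuous fun y : ℝ => (-y / b) ^ k).intervalIntegrable _ _)]
  simp [hb.ne']

/-- The exponent `|n| + 1` concentrates the function in a layer of width about `b / (1 + |n|)`. Its
squared norm therefore gains a factor `1 + |n|`, while that of its derivative loses one. -/
lemma norm_sq_bump {b : ℝ} (hb : 0 < b) (s : Fin 2) (n : ℤ) :
    (1 + |(n : ℝ)|) * ‖segLp (contDiff_bump b s n).continuous b‖ ^ 2 ≤ b := by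
  have hn : ((n.natAbs : ℕ) : ℝ) = |(n : ℝ)| := by rw [Nat.cast_natAbs, Int.cast_abs]
  have h : ‖segLp (contDiff_bump b s n).continuous b‖ ^ 2
      = b / (((2 * (n.natAbs + 1) : ℕ) : ℝ) + 1) := by
    rw [norm_sq_segLp _ hb.le]
    fin_cases s
    · rw [← integral_shift_pow hb]
      congr 1; ext y
      simp only [bump, Complex.norm_real, Real.norm_eq_abs, sq_abs, ← pow_mul, mul_comm]
    · rw [← integral_neg_pow hb]
      congr 1; ext y
      simp only [bump, Complex.norm_real, Real.norm_eq_abs, sq_abs, ← pow_mul, mul_comm]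
  rw [h]
  push_cast
  rw [hn, ← mul_div_assoc, div_le_iff₀ (by positivity)]
  nlinarith [abs_nonneg (n : ℝ)]

lemma norm_sq_bumpDeriv {b : ℝ} (hb : 0 < b) (s : Fin 2) (n : ℤ) :
    (1 + |(n : ℝ)|) * ‖segLp (continuous_bumpDeriv b s n) b‖ ^ 2 ≤ (1 + |(n : ℝ)|) ^ 2 * b⁻¹ * 1 := by
  have hn : ((n.natAbs : ℕ) : ℝ) = |(n : ℝ)| := by rw [Nat.cast_natAbs, Int.cast_abs]
  have h : ‖segLp (continuous_bumpDeriv b s n) b‖ ^ 2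
      = ((n.natAbs + 1) * (1 / b)) ^ 2 * (b / (((2 * n.natAbs : ℕ) : ℝ) + 1)) := by
    rw [norm_sq_segLp _ hb.le]
    fin_cases s
    · rw [← integral_shift_pow hb, ← intervalIntegral.integral_const_mul]
      congr 1; ext y
      simp only [bumpDeriv, Complex.norm_real, Real.norm_eq_abs, sq_abs]
      ring
    · rw [← integral_neg_pow hb, ← intervalIntegral.integral_const_mul]
      congr 1; ext y
      simp only [bumpDeriv, Complex.norm_real, Real.norm_eq_abs, sq_abs]
      ring
  rw [h]
  push_cast
  rw [hn]
  have : (1 + |(n : ℝ)|) * (((|(n : ℝ)| + 1) * (1 / b)) ^ 2 * (b / (2 * |(n : ℝ)| + 1)))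
      = (1 + |(n : ℝ)|) ^ 2 * b⁻¹ * ((1 + |(n : ℝ)|) / (2 * |(n : ℝ)| + 1)) := by
    field_simp; ring
  rw [this]
  gcongr
  rw [div_le_one (by positivity)]
  linarith [abs_nonneg (n : ℝ)]

/-- The sign of the outward normal at the end `0` (`s = 0`) and `-b` (`s = 1`). -/
def endSign : Fin 2 → ℂ
  | 0 => 1
  | 1 => -1

lemma norm_endSign (s : Fin 2) : ‖endSign s‖ = 1 := by fin_cases s <;> simp [endSign]

/-- The `n`-th Fourier coefficient of the trace of an element of `H¹(Ω)` on `Γ₀` (for `s = 0`) and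
`Γ_b` (for `s = 1`). -/
def trCoeff (b : ℝ) (s : Fin 2) (n : ℤ) : H1 b →L[ℂ] ℂ :=
  (endSign s * kap) •
    (((innerSL ℂ (segLp (contDiff_bump b s n).continuous b)).comp ((coeff b n).comp (H1.grad b 1)))
      + (innerSL ℂ (segLp (continuous_bumpDeriv b s n) b)).comp ((coeff b n).comp (H1.fn b)))

lemma trCoeff_apply {b : ℝ} (s : Fin 2) (n : ℤ) (U : H1 b) :
    trCoeff b s n U = endSign s * kap *
      (inner ℂ (segLp (contDiff_bump b s n).continuous b) (coeff b n (H1.grad b 1 U))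
        + inner ℂ (segLp (continuous_bumpDeriv b s n) b) (coeff b n (H1.fn b U))) := rfl

lemma trCoeff_modePart {b : ℝ} (s : Fin 2) (n m : ℤ) (U : H1 b) :
    trCoeff b s n (H1.modePart m U) = if n = m then trCoeff b s n U else 0 := by
  rw [trCoeff_apply, trCoeff_apply, H1.grad_modePart, H1.fn_modePart, coeff_proj, coeff_proj]
  split_ifs with h
  · subst h; rfl
  · simp

lemma kap_sq_le : kap ^ 2 ≤ 1 := by
  have h := kap_sq
  have := Real.pi_gt_three
  nlinarith [sq_nonneg kap]

/-- The constant of the trace inequality. -/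
def traceConst (b : ℝ) : ℝ := 2 * b + 4 * b⁻¹

lemma traceConst_pos {b : ℝ} (hb : 0 < b) : 0 < traceConst b := by unfold traceConst; positivity

/-- The trace inequality into `H^{1/2}`, frequency by frequency. After Cauchy-Schwarz the `∂_y` term
carries a bounded factor, and the remaining term carries a factor of order `1 + n²`, which is
absorbed by `u` and `∂_x u = in u`. -/
lemma trCoeff_sq_le {b : ℝ} (hb : 0 < b) (s : Fin 2) (n : ℤ) (U : H1 b) :
    (1 + |(n : ℝ)|) * ‖trCoeff b s n U‖ ^ 2 ≤ traceConst b * ‖H1.modePart n U‖ ^ 2 := by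
  rw [H1.norm_sq_modePart, H1.norm_sq_coeff_grad_zero]
  set θ := segLp (contDiff_bump b s n).continuous b with hθ
  set θ' := segLp (continuous_bumpDeriv b s n) b with hθ'
  have h1 : (1 + |(n : ℝ)|) * ‖θ‖ ^ 2 ≤ b := norm_sq_bump hb s n
  have h2 : (1 + |(n : ℝ)|) * ‖θ'‖ ^ 2 ≤ (1 + |(n : ℝ)|) ^ 2 * b⁻¹ * 1 := norm_sq_bumpDeriv hb s n
  set u := coeff b n (H1.fn b U)
  set w := coeff b n (H1.grad b 1 U)
  have h3 : ‖trCoeff b s n U‖ ≤ kap * (‖θ‖ * ‖w‖ + ‖θ'‖ * ‖u‖) := by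
    rw [trCoeff_apply, norm_mul, norm_mul, norm_endSign, one_mul, Complex.norm_real,
      Real.norm_of_nonneg kap_pos.le]
    refine mul_le_mul_of_nonneg_left ?_ kap_pos.le
    exact (norm_add_le _ _).trans (add_le_add (norm_inner_le_norm _ _) (norm_inner_le_norm _ _))
  have h4 : ‖trCoeff b s n U‖ ^ 2 ≤ 2 * (‖θ‖ ^ 2 * ‖w‖ ^ 2 + ‖θ'‖ ^ 2 * ‖u‖ ^ 2) := by
    calc ‖trCoeff b s n U‖ ^ 2 ≤ (kap * (‖θ‖ * ‖w‖ + ‖θ'‖ * ‖u‖)) ^ 2 := by gcongr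
      _ = kap ^ 2 * (‖θ‖ * ‖w‖ + ‖θ'‖ * ‖u‖) ^ 2 := by ring
      _ ≤ 1 * (‖θ‖ * ‖w‖ + ‖θ'‖ * ‖u‖) ^ 2 := by gcongr; exact kap_sq_le
      _ ≤ _ := by nlinarith [sq_nonneg (‖θ‖ * ‖w‖ - ‖θ'‖ * ‖u‖)]
  have h5 : (1 + |(n : ℝ)|) ^ 2 ≤ 2 * (1 + (n : ℝ) ^ 2) := by
    nlinarith [sq_nonneg (1 - |(n : ℝ)|), sq_abs (n : ℝ)]
  have hbi : 0 < b⁻¹ := inv_pos.2 hb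
  calc (1 + |(n : ℝ)|) * ‖trCoeff b s n U‖ ^ 2
      ≤ (1 + |(n : ℝ)|) * (2 * (‖θ‖ ^ 2 * ‖w‖ ^ 2 + ‖θ'‖ ^ 2 * ‖u‖ ^ 2)) := by gcongr
    _ = 2 * (((1 + |(n : ℝ)|) * ‖θ‖ ^ 2) * ‖w‖ ^ 2 + ((1 + |(n : ℝ)|) * ‖θ'‖ ^ 2) * ‖u‖ ^ 2) := by ring
    _ ≤ 2 * (b * ‖w‖ ^ 2 + ((1 + |(n : ℝ)|) ^ 2 * b⁻¹ * 1) * ‖u‖ ^ 2) := by gcongr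
    _ ≤ 2 * (b * ‖w‖ ^ 2 + ((2 * (1 + (n : ℝ) ^ 2)) * b⁻¹ * 1) * ‖u‖ ^ 2) := by gcongr
    _ = 2 * b * ‖w‖ ^ 2 + 4 * b⁻¹ * (‖u‖ ^ 2 + (n : ℝ) ^ 2 * ‖u‖ ^ 2) := by ring
    _ ≤ traceConst b * (‖u‖ ^ 2 + (n : ℝ) ^ 2 * ‖u‖ ^ 2 + ‖w‖ ^ 2) := by
        rw [traceConst]
        have : 0 ≤ 2 * b * (‖u‖ ^ 2 + (n : ℝ) ^ 2 * ‖u‖ ^ 2) := by positivity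
        have : 0 ≤ 4 * b⁻¹ * ‖w‖ ^ 2 := by positivity
        linarith

lemma mul_le_mul_of_sq_le {t c x y p q : ℝ} (ht : 0 ≤ t) (hc : 0 ≤ c) (hp : 0 ≤ p)
    (hq : 0 ≤ q) (h1 : t * x ^ 2 ≤ c * p ^ 2) (h2 : t * y ^ 2 ≤ c * q ^ 2) :
    t * (x * y) ≤ c * (p * q) := by
  refine le_of_sq_le_sq ?_ (by positivity)
  calc (t * (x * y)) ^ 2 = (t * x ^ 2) * (t * y ^ 2) := by ring
    _ ≤ (c * p ^ 2) * (c * q ^ 2) := by gcongr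
    _ = _ := by ring

lemma trCoeff_mul_le {b : ℝ} (hb : 0 < b) (s : Fin 2) (n : ℤ) (U V : H1 b) :
    (1 + |(n : ℝ)|) * (‖trCoeff b s n U‖ * ‖trCoeff b s n V‖)
      ≤ traceConst b * (‖H1.modePart n U‖ * ‖H1.modePart n V‖) :=
  mul_le_mul_of_sq_le (by positivity) (traceConst_pos hb).le (norm_nonneg _) (norm_nonneg _)
    (trCoeff_sq_le hb s n U) (trCoeff_sq_le hb s n V)

lemma norm_trCoeff_le {b : ℝ} (hb : 0 < b) (s : Fin 2) (n : ℤ) (U : H1 b) :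
    ‖trCoeff b s n U‖ ≤ Real.sqrt (traceConst b) * ‖H1.modePart n U‖ := by
  have h1 := trCoeff_sq_le hb s n U
  refine le_of_sq_le_sq ?_ (by positivity)
  rw [mul_pow, Real.sq_sqrt (traceConst_pos hb).le]
  refine le_trans ?_ h1
  exact le_mul_of_one_le_left (by positivity) (by linarith [abs_nonneg (n : ℝ)])

lemma norm_modePart_le {b : ℝ} (n : ℤ) (U : H1 b) : ‖H1.modePart n U‖ ≤ ‖U‖ :=
  le_of_sq_le_sq (le_hasSum (H1.hasSum_norm_modePart U) n fun m _ => by positivity) (norm_nonneg _)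

/-! ### Identification of `weakD` and `trace` -/

lemma MemH1.isWeakPartial {b : ℝ} {u : Cyl → ℂ} (hu : MemH1 b u) (i : Fin 2) :
    IsWeakPartial b i u (weakD b i u) := by
  have h := hu.2 i
  rw [weakD, dif_pos h]
  exact h.choose_spec

lemma H1.memH1 {b : ℝ} (U : H1 b) : MemH1 b (H1.fn b U) :=
  ⟨Lp.memLp _, fun i => ⟨_, H1.isWeakPartial U i⟩⟩

/-- Uniqueness of weak derivatives makes the arbitrary choice in `weakD` harmless. -/
lemma weakD_ae {b : ℝ} {i : Fin 2} {u w : Cyl → ℂ} (hu : MemLp u 2 (slabMeasure b))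
    (h : IsWeakPartial b i u w) : weakD b i u =ᵐ[slabMeasure b] w := by
  have h' : ∃ w, IsWeakPartial b i u w := ⟨w, h⟩
  rw [weakD, dif_pos h']
  exact h'.choose_spec.unique hu h

lemma isTrace_trace {b : ℝ} (hb : 0 < b) {u : Cyl → ℂ} (hu : MemH1 b u) :
    IsTrace b u (trace b u) := by
  have h : ∃ τ, IsTrace b u τ := exists_gauss_green hb hu.1 (hu.isWeakPartial 1)
  rw [trace, dif_pos h]
  exact h.choose_spec

/-- `U` represents the function `u` of `H¹(Ω)`. -/
structure Represents {b : ℝ} (U : H1 b) (u : Cyl → ℂ) : Prop where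
  memH1 : MemH1 b u
  fn_ae : H1.fn b U =ᵐ[slabMeasure b] u
  grad_ae : ∀ i, H1.grad b i U =ᵐ[slabMeasure b] weakD b i u

lemma represents_fn {b : ℝ} (U : H1 b) : Represents U (H1.fn b U) :=
  ⟨H1.memH1 U, ae_eq_refl _, fun i => (weakD_ae (Lp.memLp _) (H1.isWeakPartial U i)).symm⟩

lemma exists_represents {b : ℝ} {u : Cyl → ℂ} (hu : MemH1 b u) : ∃ U : H1 b, Represents U u := by
  have h := fun i => (hu.isWeakPartial i).congr hu.1.coeFn_toLp.symm
    (hu.isWeakPartial i).1.coeFn_toLp.symm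
  refine ⟨H1.mk _ _ _ (h 0) (h 1), hu, hu.1.coeFn_toLp, fun i => ?_⟩
  rw [H1.grad_mk]
  fin_cases i
  · exact (hu.isWeakPartial 0).1.coeFn_toLp
  · exact (hu.isWeakPartial 1).1.coeFn_toLp

lemma toLp_pd_one_bump {b : ℝ} (s : Fin 2) (n : ℤ) :
    ((isSmooth_modeFun n (contDiff_bump b s n)).pd 1).toLp b
      = mode b n (segLp (continuous_bumpDeriv b s n) b) := by
  ext1
  refine (MemLp.coeFn_toLp _).trans ((?_ : _ =ᵐ[slabMeasure b] _).trans (mode_coe n _).symm)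
  have : (fun p : Cyl => segLp (continuous_bumpDeriv b s n) b p.2) =ᵐ[slabMeasure b]
      fun p => bumpDeriv b s n p.2 :=
    Measure.quasiMeasurePreserving_snd.ae_eq_comp
      (MemLp.coeFn_toLp (memLp_seg (continuous_bumpDeriv b s n) b 2))
  filter_upwards [this] with p hp
  rw [pd_one_modeFun n (contDiff_bump b s n), deriv_bump]
  simp only [modeFun, hp]

/-- The defining formula of the trace, applied to the conjugate of `e^{inx}` times `bump`. As `bump`
is `1` at one end and `0` at the other, only one boundary term survives when `s` is fixed. -/
lemma Represents.gauss_green {b : ℝ} (hb : 0 < b) {U : H1 b} {u : Cyl → ℂ} (h : Represents U u)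
    (s : Fin 2) (n : ℤ) :
    inner ℂ (segLp (contDiff_bump b s n).continuous b) (coeff b n (H1.grad b 1 U))
        + inner ℂ (segLp (continuous_bumpDeriv b s n) b) (coeff b n (H1.fn b U))
      = (∫ x : S, (trace b u).1 x * conj (modeFun n (bump b s n) (x, 0)))
        - ∫ x : S, (trace b u).2 x * conj (modeFun n (bump b s n) (x, -b)) := by
  have hs := isSmooth_modeFun n (contDiff_bump b s n)
  rw [← (isTrace_trace hb h.memH1).2.2 _ hs.conj, ← inner_mode_left, ← inner_mode_left,
    ← toLp_modeFun n (contDiff_bump b s n), hs.inner_toLp]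
  have h1 : inner ℂ (mode b n (segLp (continuous_bumpDeriv b s n) b)) (H1.fn b U)
      = ∫ p, conj (pd 1 (modeFun n (bump b s n)) p) * H1.fn b U p ∂(slabMeasure b) := by
    rw [← toLp_pd_one_bump, IsSmooth.inner_toLp]
  rw [h1, ← integral_add (integrable_conj_mul (hs.memLp b) (Lp.memLp _))
    (integrable_conj_mul ((hs.pd 1).memLp b) (Lp.memLp _))]
  refine integral_congr_ae ?_
  filter_upwards [h.fn_ae, h.grad_ae 1] with p h1 h2
  rw [h1, h2, pd_conj hs]; ring

lemma kap_integral_fourier (τ : S → ℂ) (n : ℤ) :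
    (kap : ℂ) * ∫ x : S, τ x * (kap * fourier (-n) x) = fourierCoeff τ n := by
  rw [fourierCoeff, AddCircle.integral_haarAddCircle]
  have : ∀ x : S, τ x * (kap * fourier (-n) x) = kap * (fourier (-n) x * τ x) := fun x => by ring
  simp only [this, integral_const_mul, smul_eq_mul, Complex.real_smul]
  have h := kap_sq'
  have hp : (Real.pi : ℂ) ≠ 0 := by exact_mod_cast Real.pi_ne_zero
  generalize ∫ x : S, fourier (-n) x * τ x = I
  push_cast
  rw [mul_inv]
  field_simp
  linear_combination I * h

lemma Represents.trCoeff_zero {b : ℝ} (hb : 0 < b) {U : H1 b} {u : Cyl → ℂ} (h : Represents U u)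
    (n : ℤ) : fourierCoeff (trace b u).1 n = trCoeff b 0 n U := by
  rw [trCoeff_apply, h.gauss_green hb, ← kap_integral_fourier]
  have h0 : bump b 0 n 0 = 1 := by simp [bump, hb.ne']
  have h1 : bump b 0 n (-b) = 0 := by simp [bump]
  simp only [modeFun, h0, h1, mul_zero, map_zero, integral_zero, sub_zero, mul_one, endSign, one_mul,
    map_mul, Complex.conj_ofReal, fourier_neg]

lemma Represents.trCoeff_one {b : ℝ} (hb : 0 < b) {U : H1 b} {u : Cyl → ℂ} (h : Represents U u)
    (n : ℤ) : fourierCoeff (trace b u).2 n = trCoeff b 1 n U := by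
  rw [trCoeff_apply, h.gauss_green hb, ← kap_integral_fourier]
  have h0 : bump b 1 n 0 = 0 := by simp [bump]
  have h1 : bump b 1 n (-b) = 1 := by simp [bump, hb.ne']
  simp only [modeFun, h0, h1, mul_zero, map_zero, integral_zero, zero_sub, mul_one, endSign,
    map_mul, Complex.conj_ofReal, fourier_neg]
  ring

end HelmholtzSlab

end

noncomputable section

namespace HelmholtzSlab

open MeasureTheory Set Filter Topology
open scoped ComplexConjugate ENNReal

/-! ### The Lax-Milgram lemma for sesquilinear forms -/

/-- Coercivity makes the operator representing the form invertible, and the Riesz representation of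
the load is then pulled back. Only the modulus of `a u u` has to be bounded below, so no rotation of
the form is needed. -/
lemma lax_milgram {H : Type*} [NormedAddCommGroup H] [InnerProductSpace ℂ H] [CompleteSpace H]
    {a : H → H → ℂ} (add_left : ∀ u u' v, a (u + u') v = a u v + a u' v)
    (smul_left : ∀ (c : ℂ) u v, a (c • u) v = c * a u v)
    (add_right : ∀ u v v', a u (v + v') = a u v + a u v')
    (smul_right : ∀ (c : ℂ) u v, a u (c • v) = conj c * a u v)
    {C : ℝ} (bound : ∀ u v, ‖a u v‖ ≤ C * (‖u‖ * ‖v‖))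
    {c : ℝ} (hc : 0 < c) (coercive : ∀ u, c * ‖u‖ ^ 2 ≤ ‖a u u‖)
    {l : H → ℂ} (l_add : ∀ v v', l (v + v') = l v + l v') (l_smul : ∀ (c : ℂ) v, l (c • v) = conj c * l v)
    {D : ℝ} (l_bound : ∀ v, ‖l v‖ ≤ D * ‖v‖) :
    ∃! u, ∀ v, a u v = l v := by
  let B : H →L⋆[ℂ] H →L[ℂ] ℂ := LinearMap.mkContinuous₂
    (LinearMap.mk₂'ₛₗ (starRingEnd ℂ) (RingHom.id ℂ) (fun v u => a u v)
      (fun v v' u => add_right u v v') (fun c v u => smul_right c u v)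
      (fun v u u' => add_left u u' v) (fun c v u => smul_left c u v)) C
    (fun v u => by
      have := bound u v
      simp only [LinearMap.mk₂'ₛₗ_apply]
      linarith [mul_comm ‖u‖ ‖v‖, mul_assoc C ‖v‖ ‖u‖, congrArg (C * ·) (mul_comm ‖u‖ ‖v‖)])
  let A : H →L[ℂ] H := InnerProductSpace.continuousLinearMapOfBilin B
  have hA : ∀ v u, inner ℂ (A v) u = a u v := fun v u =>
    InnerProductSpace.continuousLinearMapOfBilin_apply B v u
  have hunit : IsUnit A := by
    refine ContinuousLinearMap.isUnit_of_forall_le_norm_inner_map A (c := ⟨c, hc.le⟩) hc fun u => ?_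
    rw [hA]
    rw [mul_comm]
    exact coercive u
  let L : H →L[ℂ] ℂ := LinearMap.mkContinuous
    { toFun := fun v => conj (l v)
      map_add' := fun v v' => by rw [l_add, map_add]
      map_smul' := fun c v => by simp [l_smul] } D (fun v => by simpa using l_bound v)
  have hL : ∀ v, inner ℂ v ((InnerProductSpace.toDual ℂ H).symm L) = l v := by
    intro v
    rw [← inner_conj_symm, InnerProductSpace.toDual_symm_apply]
    simp [L]
  -- Since `a u v = ⟨A v, u⟩ = ⟨v, A* u⟩`, the equation to solve involves the adjoint of `A`.
  have huA : IsUnit A.adjoint := by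
    rw [← ContinuousLinearMap.star_eq_adjoint]; exact hunit.star
  obtain ⟨T, hT⟩ := huA.exists_right_inv
  refine ⟨T ((InnerProductSpace.toDual ℂ H).symm L), fun v => ?_, fun u hu => ?_⟩
  · rw [← hA, ← ContinuousLinearMap.adjoint_inner_right, ← mul_apply_eq_comp, hT,
      one_apply_eq_self, hL]
  · have h1 : A.adjoint u = (InnerProductSpace.toDual ℂ H).symm L := by
      refine ext_inner_left ℂ fun v => ?_
      rw [ContinuousLinearMap.adjoint_inner_right, hA, hu, hL]
    obtain ⟨T', hT'⟩ := huA.exists_left_inv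
    have h2 : T' = T := left_inv_eq_right_inv hT' hT
    rw [← h1, ← h2, ← mul_apply_eq_comp, hT', one_apply_eq_self]

/-! ### The symbol of the Dirichlet-to-Neumann operator -/

lemma beta_re_nonneg (ω ξ : ℝ) : 0 ≤ (beta ω ξ).re := by
  unfold beta
  split_ifs
  · simp
  · simp

lemma beta_im_nonneg (ω ξ : ℝ) : 0 ≤ (beta ω ξ).im := by
  unfold beta
  split_ifs
  · simp
  · simp

lemma norm_beta_le {ω : ℝ} (hω : 0 ≤ ω) (ξ : ℝ) : ‖beta ω ξ‖ ≤ ω + |ξ| := by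
  unfold beta
  split_ifs
  · rw [Complex.norm_real, Real.norm_of_nonneg (Real.sqrt_nonneg _)]
    refine Real.sqrt_le_iff.2 ⟨by positivity, ?_⟩
    nlinarith [sq_abs ξ, abs_nonneg ξ, mul_nonneg hω (abs_nonneg ξ)]
  · rw [norm_mul, Complex.norm_I, one_mul, Complex.norm_real, Real.norm_of_nonneg (Real.sqrt_nonneg _)]
    refine Real.sqrt_le_iff.2 ⟨by positivity, ?_⟩
    nlinarith [sq_abs ξ, abs_nonneg ξ, mul_nonneg hω (abs_nonneg ξ)]

/-- Valid for all `ξ`, the left side being negative for propagating modes; it yields the exponential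
decay of the incident field. -/
lemma le_beta_im {ω : ℝ} (hω : 0 ≤ ω) (ξ : ℝ) : |ξ| - ω ≤ (beta ω ξ).im := by
  unfold beta
  split_ifs with h
  · simp only [Complex.ofReal_im]
    have : |ξ| ^ 2 < ω ^ 2 := by rw [sq_abs]; linarith
    linarith [lt_of_pow_lt_pow_left₀ 2 hω this]
  · have h1 : ω ≤ |ξ| := by
      refine le_of_sq_le_sq ?_ (abs_nonneg _)
      rw [sq_abs]; linarith
    simp only [Complex.mul_im, Complex.I_re, Complex.ofReal_im, mul_zero, Complex.I_im,
      Complex.ofReal_re, one_mul, zero_add]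
    refine Real.le_sqrt_of_sq_le ?_
    nlinarith [sq_abs ξ, abs_nonneg ξ]

lemma abs_add_le_of_mem {α : ℝ} (hα : α ∈ Icc (-(1 / 2) : ℝ) (1 / 2)) (n : ℤ) :
    |(n : ℝ)| - 1 / 2 ≤ |(n : ℝ) + α| ∧ |(n : ℝ) + α| ≤ |(n : ℝ)| + 1 / 2 := by
  have hα' : |α| ≤ 1 / 2 := abs_le.2 ⟨by linarith [hα.1], hα.2⟩
  constructor
  · have := abs_sub_abs_le_abs_sub (n : ℝ) (-α)
    rw [abs_neg, sub_neg_eq_add] at this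
    linarith
  · linarith [abs_add_le (n : ℝ) α]

lemma norm_beta_shift_le {ω α : ℝ} (hω : 0 ≤ ω) (hα : α ∈ Icc (-(1 / 2) : ℝ) (1 / 2)) (n : ℤ) :
    ‖beta ω ((n : ℝ) + α)‖ ≤ (1 + ω) * (1 + |(n : ℝ)|) := by
  have h1 := norm_beta_le hω ((n : ℝ) + α)
  have h2 := (abs_add_le_of_mem hα n).2
  nlinarith [mul_nonneg hω (abs_nonneg (n : ℝ)), abs_nonneg (n : ℝ)]

/-- The Fourier coefficients of the incident field, up to a constant. -/
def incCoeff (ω h α : ℝ) (n : ℤ) : ℂ :=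
  Complex.exp (Complex.I * beta ω ((n : ℝ) + α) * (h : ℂ))

/-- The modulus is `e^{-h Im β}` and `Im β ≥ |n| - 1/2 - ω`, uniformly in `α`. -/
lemma norm_incCoeff_le {ω h α : ℝ} (hω : 0 ≤ ω) (hh : 0 ≤ h) (hα : α ∈ Icc (-(1 / 2) : ℝ) (1 / 2))
    (n : ℤ) : ‖incCoeff ω h α n‖ ≤ Real.exp (h * (ω + 1 / 2)) * Real.exp (-h * |(n : ℝ)|) := by
  rw [incCoeff, Complex.norm_exp, ← Real.exp_add]
  refine Real.exp_le_exp.2 ?_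
  have h1 := le_beta_im hω ((n : ℝ) + α)
  have h2 := (abs_add_le_of_mem hα n).1
  have h3 : (Complex.I * beta ω ((n : ℝ) + α) * (h : ℂ)).re = -(beta ω ((n : ℝ) + α)).im * h := by
    simp [Complex.mul_re]
  rw [h3]
  nlinarith

lemma summable_pow_mul_exp_int {h : ℝ} (hh : 0 < h) (k : ℕ) :
    Summable fun n : ℤ => |(n : ℝ)| ^ k * Real.exp (-h * |(n : ℝ)|) := by
  have h1 := Real.summable_pow_mul_exp_neg_nat_mul k hh
  refine Summable.of_nat_of_neg ?_ ?_
  · simpa using h1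
  · simpa using h1

/-! ### The sesquilinear form on `H¹(Ω)` -/

section Form

variable {b : ℝ}

/-- The pairing with the Dirichlet-to-Neumann operator in terms of trace coefficients. -/
def dtnSum (ω b α : ℝ) (s : Fin 2) (U V : H1 b) : ℂ :=
  2 * (Real.pi : ℂ) * ∑' n : ℤ,
    (Complex.I * beta ω ((n : ℝ) + α) * trCoeff b s n U) * conj (trCoeff b s n V)

/-- The linear growth of `β` is exactly compensated by the weight `1 + |n|` of the trace inequality.
-/
lemma norm_dtn_term_le (hb : 0 < b) {ω α : ℝ} (hω : 0 ≤ ω) (hα : α ∈ Icc (-(1 / 2) : ℝ) (1 / 2))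
    (s : Fin 2) (U V : H1 b) (n : ℤ) :
    ‖(Complex.I * beta ω ((n : ℝ) + α) * trCoeff b s n U) * conj (trCoeff b s n V)‖
      ≤ (1 + ω) * traceConst b * (‖H1.modePart n U‖ * ‖H1.modePart n V‖) := by
  rw [norm_mul, norm_mul, norm_mul, Complex.norm_I, one_mul, RCLike.norm_conj]
  calc ‖beta ω ((n : ℝ) + α)‖ * ‖trCoeff b s n U‖ * ‖trCoeff b s n V‖
      ≤ ((1 + ω) * (1 + |(n : ℝ)|)) * ‖trCoeff b s n U‖ * ‖trCoeff b s n V‖ := by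
        gcongr; exact norm_beta_shift_le hω hα n
    _ = (1 + ω) * ((1 + |(n : ℝ)|) * (‖trCoeff b s n U‖ * ‖trCoeff b s n V‖)) := by ring
    _ ≤ (1 + ω) * (traceConst b * (‖H1.modePart n U‖ * ‖H1.modePart n V‖)) :=
        mul_le_mul_of_nonneg_left (trCoeff_mul_le hb s n U V) (by linarith)
    _ = _ := by ring

lemma summable_dtn (hb : 0 < b) {ω α : ℝ} (hω : 0 ≤ ω) (hα : α ∈ Icc (-(1 / 2) : ℝ) (1 / 2))
    (s : Fin 2) (U V : H1 b) : Summable fun n : ℤ =>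
      (Complex.I * beta ω ((n : ℝ) + α) * trCoeff b s n U) * conj (trCoeff b s n V) :=
  Summable.of_norm_bounded ((H1.tsum_modePart_mul U V).1.mul_left _)
    (norm_dtn_term_le hb hω hα s U V)

lemma norm_dtnSum_le (hb : 0 < b) {ω α : ℝ} (hω : 0 ≤ ω) (hα : α ∈ Icc (-(1 / 2) : ℝ) (1 / 2))
    (s : Fin 2) (U V : H1 b) :
    ‖dtnSum ω b α s U V‖ ≤ 2 * Real.pi * ((1 + ω) * traceConst b) * (‖U‖ * ‖V‖) := by
  have h1 := tsum_of_norm_bounded ((H1.tsum_modePart_mul U V).1.mul_left _).hasSum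
    (norm_dtn_term_le hb hω hα s U V)
  rw [tsum_mul_left] at h1
  have hc : 0 ≤ (1 + ω) * traceConst b := mul_nonneg (by linarith) (traceConst_pos hb).le
  have h2 := h1.trans (mul_le_mul_of_nonneg_left (H1.tsum_modePart_mul U V).2 hc)
  rw [dtnSum, norm_mul, norm_mul, Complex.norm_real, Real.norm_of_nonneg Real.pi_pos.le]
  simp only [Complex.norm_ofNat]
  rw [mul_assoc (2 * Real.pi)]
  exact mul_le_mul_of_nonneg_left h2 (by positivity)

/-- On the diagonal each term is `iβ` times a nonnegative number; evanescent modes contribute to the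
real part and propagating ones to the imaginary part. -/
lemma dtnSum_self (hb : 0 < b) {ω α : ℝ} (hω : 0 ≤ ω) (hα : α ∈ Icc (-(1 / 2) : ℝ) (1 / 2))
    (s : Fin 2) (U : H1 b) : (dtnSum ω b α s U U).re ≤ 0 ∧ 0 ≤ (dtnSum ω b α s U U).im := by
  have hs := (summable_dtn hb hω hα s U U).hasSum
  have hterm : ∀ n : ℤ, (Complex.I * beta ω ((n : ℝ) + α) * trCoeff b s n U) * conj (trCoeff b s n U)
      = (Complex.I * beta ω ((n : ℝ) + α)) * ((‖trCoeff b s n U‖ ^ 2 : ℝ) : ℂ) := by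
    intro n
    rw [mul_assoc, Complex.mul_conj, Complex.normSq_eq_norm_sq]
  have hp : (2 * (Real.pi : ℂ)) = ((2 * Real.pi : ℝ) : ℂ) := by push_cast; rfl
  rw [dtnSum, hp, Complex.re_ofReal_mul, Complex.im_ofReal_mul]
  constructor
  · refine mul_nonpos_of_nonneg_of_nonpos (by positivity) ?_
    refine (Complex.hasSum_re hs).nonpos fun n => ?_
    rw [hterm, Complex.re_mul_ofReal]
    refine mul_nonpos_of_nonpos_of_nonneg ?_ (by positivity)
    simpa using beta_im_nonneg ω _
  · refine mul_nonneg (by positivity) ?_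
    refine (Complex.hasSum_im hs).nonneg fun n => ?_
    rw [hterm, Complex.im_mul_ofReal]
    refine mul_nonneg ?_ (by positivity)
    simpa using beta_re_nonneg ω _

/-- The sesquilinear form of the problem on `H¹(Ω)`, with `M` the multiplication by `ρ`. -/
def sesq (ω b α : ℝ) (M : LΩ b →L[ℂ] LΩ b) (U V : H1 b) : ℂ :=
  inner ℂ (H1.grad b 0 V) (H1.grad b 0 U) + inner ℂ (H1.grad b 1 V) (H1.grad b 1 U)
    - (ω : ℂ) ^ 2 * inner ℂ (H1.fn b V) (M (H1.fn b U))
    + (α : ℂ) ^ 2 * inner ℂ (H1.fn b V) (H1.fn b U)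
    - 2 * Complex.I * (α : ℂ) * inner ℂ (H1.fn b V) (H1.grad b 0 U)
    - dtnSum ω b α 0 U V - dtnSum ω b α 1 U V

lemma dtnSum_add_left (hb : 0 < b) {ω α : ℝ} (hω : 0 ≤ ω) (hα : α ∈ Icc (-(1 / 2) : ℝ) (1 / 2))
    (s : Fin 2) (U U' V : H1 b) :
    dtnSum ω b α s (U + U') V = dtnSum ω b α s U V + dtnSum ω b α s U' V := by
  rw [dtnSum, dtnSum, dtnSum, ← mul_add, ← (summable_dtn hb hω hα s U V).tsum_add
    (summable_dtn hb hω hα s U' V)]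
  refine congrArg _ (tsum_congr fun n => ?_); rw [map_add]; ring

lemma dtnSum_add_right (hb : 0 < b) {ω α : ℝ} (hω : 0 ≤ ω) (hα : α ∈ Icc (-(1 / 2) : ℝ) (1 / 2))
    (s : Fin 2) (U V V' : H1 b) :
    dtnSum ω b α s U (V + V') = dtnSum ω b α s U V + dtnSum ω b α s U V' := by
  rw [dtnSum, dtnSum, dtnSum, ← mul_add, ← (summable_dtn hb hω hα s U V).tsum_add
    (summable_dtn hb hω hα s U V')]
  refine congrArg _ (tsum_congr fun n => ?_); rw [map_add, map_add]; ring

lemma dtnSum_smul_left (ω α : ℝ) (s : Fin 2) (c : ℂ) (U V : H1 b) :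
    dtnSum ω b α s (c • U) V = c * dtnSum ω b α s U V := by
  rw [dtnSum, dtnSum]
  simp only [← tsum_mul_left]
  refine tsum_congr fun n => ?_
  rw [map_smul, smul_eq_mul]; ring

lemma dtnSum_smul_right (ω α : ℝ) (s : Fin 2) (c : ℂ) (U V : H1 b) :
    dtnSum ω b α s U (c • V) = conj c * dtnSum ω b α s U V := by
  rw [dtnSum, dtnSum]
  simp only [← tsum_mul_left]
  refine tsum_congr fun n => ?_
  rw [map_smul, smul_eq_mul, map_mul]; ring

lemma sesq_add_left (hb : 0 < b) {ω α : ℝ} (hω : 0 ≤ ω) (hα : α ∈ Icc (-(1 / 2) : ℝ) (1 / 2))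
    (M : LΩ b →L[ℂ] LΩ b) (U U' V : H1 b) :
    sesq ω b α M (U + U') V = sesq ω b α M U V + sesq ω b α M U' V := by
  simp only [sesq, map_add, inner_add_right, dtnSum_add_left hb hω hα]; ring

lemma sesq_add_right (hb : 0 < b) {ω α : ℝ} (hω : 0 ≤ ω) (hα : α ∈ Icc (-(1 / 2) : ℝ) (1 / 2))
    (M : LΩ b →L[ℂ] LΩ b) (U V V' : H1 b) :
    sesq ω b α M U (V + V') = sesq ω b α M U V + sesq ω b α M U V' := by
  simp only [sesq, map_add, inner_add_left, dtnSum_add_right hb hω hα]; ring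

lemma sesq_smul_left (ω α : ℝ) (M : LΩ b →L[ℂ] LΩ b) (c : ℂ) (U V : H1 b) :
    sesq ω b α M (c • U) V = c * sesq ω b α M U V := by
  simp only [sesq, map_smul, inner_smul_right, dtnSum_smul_left]; ring

lemma sesq_smul_right (ω α : ℝ) (M : LΩ b →L[ℂ] LΩ b) (c : ℂ) (U V : H1 b) :
    sesq ω b α M U (c • V) = conj c * sesq ω b α M U V := by
  simp only [sesq, map_smul, inner_smul_left, dtnSum_smul_right]; ring

lemma norm_sesq_le (hb : 0 < b) {ω α : ℝ} (hω : 0 ≤ ω) (hα : α ∈ Icc (-(1 / 2) : ℝ) (1 / 2))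
    (M : LΩ b →L[ℂ] LΩ b) (U V : H1 b) : ‖sesq ω b α M U V‖ ≤
      (1 + 1 + ω ^ 2 * ‖M‖ + |α| ^ 2 + 2 * |α| + 2 * Real.pi * ((1 + ω) * traceConst b)
        + 2 * Real.pi * ((1 + ω) * traceConst b)) * (‖U‖ * ‖V‖) := by
  have hi : ∀ {f g : LΩ b}, ‖f‖ ≤ ‖V‖ → ‖g‖ ≤ ‖U‖ → ‖(inner ℂ f g : ℂ)‖ ≤ ‖U‖ * ‖V‖ := by
    intro f g hf hg
    refine (norm_inner_le_norm f g).trans ?_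
    rw [mul_comm]; gcongr
  have h0 := hi (H1.norm_grad_le 0 V) (H1.norm_grad_le 0 U)
  have h1 := hi (H1.norm_grad_le 1 V) (H1.norm_grad_le 1 U)
  have h2 : ‖(ω : ℂ) ^ 2 * inner ℂ (H1.fn b V) (M (H1.fn b U))‖ ≤ ω ^ 2 * ‖M‖ * (‖U‖ * ‖V‖) := by
    rw [norm_mul, norm_pow, Complex.norm_real, Real.norm_of_nonneg hω, mul_assoc]
    refine mul_le_mul_of_nonneg_left ?_ (by positivity)
    refine (norm_inner_le_norm _ _).trans ?_
    calc ‖H1.fn b V‖ * ‖M (H1.fn b U)‖ ≤ ‖V‖ * (‖M‖ * ‖U‖) := by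
          gcongr
          · exact H1.norm_fn_le V
          · exact (M.le_opNorm _).trans (by gcongr; exact H1.norm_fn_le U)
      _ = _ := by ring
  have h3 : ‖(α : ℂ) ^ 2 * inner ℂ (H1.fn b V) (H1.fn b U)‖ ≤ |α| ^ 2 * (‖U‖ * ‖V‖) := by
    rw [norm_mul, norm_pow, Complex.norm_real, Real.norm_eq_abs]
    exact mul_le_mul_of_nonneg_left (hi (H1.norm_fn_le V) (H1.norm_fn_le U)) (by positivity)
  have h4 : ‖2 * Complex.I * (α : ℂ) * inner ℂ (H1.fn b V) (H1.grad b 0 U)‖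
      ≤ 2 * |α| * (‖U‖ * ‖V‖) := by
    rw [norm_mul, norm_mul, norm_mul, Complex.norm_real, Real.norm_eq_abs, Complex.norm_I]
    simp only [Complex.norm_ofNat, mul_one]
    exact mul_le_mul_of_nonneg_left (hi (H1.norm_fn_le V) (H1.norm_grad_le 0 U)) (by positivity)
  have h5 := norm_dtnSum_le hb hω hα 0 U V
  have h6 := norm_dtnSum_le hb hω hα 1 U V
  unfold sesq
  refine (norm_sub_le_of_le (norm_sub_le_of_le (norm_sub_le_of_le (norm_add_le_of_le
    (norm_sub_le_of_le (norm_add_le_of_le h0 h1) h2) h3) h4) h5) h6).trans_eq ?_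
  ring

/-- On frequency `n` the derivative `∂_x` is multiplication by `in`, so every term of the Parseval
series is purely imaginary. -/
lemma re_inner_fn_grad_zero (U : H1 b) : (inner ℂ (H1.fn b U) (H1.grad b 0 U) : ℂ).re = 0 := by
  have h := Complex.hasSum_re (hasSum_inner_coeff (H1.fn b U) (H1.grad b 0 U))
  have h0 : ∀ n : ℤ, (inner ℂ (coeff b n (H1.fn b U)) (coeff b n (H1.grad b 0 U)) : ℂ).re = 0 := by
    intro n
    rw [H1.coeff_grad_zero, inner_smul_right, inner_self_eq_norm_sq_to_K]
    have : Complex.I * n * ((‖coeff b n (H1.fn b U)‖ : ℝ) : ℂ) ^ 2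
        = ((n * ‖coeff b n (H1.fn b U)‖ ^ 2 : ℝ) : ℂ) * Complex.I := by push_cast; ring
    refine (congrArg Complex.re this).trans ?_
    rw [Complex.re_ofReal_mul, Complex.I_re, mul_zero]
  simp only [h0] at h
  exact h.unique hasSum_zero

/-- The constant of coercivity. -/
def coercConst (ω r i₀ : ℝ) : ℝ := (2 * (1 + (1 + ω ^ 2 * r) / (ω ^ 2 * i₀)))⁻¹

/-- The Dirichlet-to-Neumann terms are dropped by their sign. The first-order term is real by
`re_inner_fn_grad_zero`, so the imaginary part retains only `Im ρ`. -/
lemma sesq_self (hb : 0 < b) {ω α : ℝ} (hω : 0 ≤ ω) (hα : α ∈ Icc (-(1 / 2) : ℝ) (1 / 2))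
    (M : LΩ b →L[ℂ] LΩ b) (U : H1 b) :
    ‖H1.grad b 0 U‖ ^ 2 + ‖H1.grad b 1 U‖ ^ 2 + α ^ 2 * ‖H1.fn b U‖ ^ 2
        + 2 * α * (inner ℂ (H1.fn b U) (H1.grad b 0 U) : ℂ).im
        - ω ^ 2 * (inner ℂ (H1.fn b U) (M (H1.fn b U)) : ℂ).re ≤ (sesq ω b α M U U).re ∧
      (sesq ω b α M U U).im ≤ - (ω ^ 2 * (inner ℂ (H1.fn b U) (M (H1.fn b U)) : ℂ).im) := by
  obtain ⟨r0, i0⟩ := dtnSum_self hb hω hα 0 U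
  obtain ⟨r1, i1⟩ := dtnSum_self hb hω hα 1 U
  have hre := re_inner_fn_grad_zero U
  have hself : ∀ f : LΩ b, (inner ℂ f f : ℂ) = ((‖f‖ ^ 2 : ℝ) : ℂ) := fun f => by
    rw [inner_self_eq_norm_sq_to_K]; push_cast; rfl
  have hw2 : ((ω : ℂ) ^ 2) = ((ω ^ 2 : ℝ) : ℂ) := by push_cast; rfl
  have ha2 : ((α : ℂ) ^ 2) = ((α ^ 2 : ℝ) : ℂ) := by push_cast; rfl
  have ha : ∀ z : ℂ, 2 * Complex.I * (α : ℂ) * z = ((2 * α : ℝ) : ℂ) * (Complex.I * z) := fun z => by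
    push_cast; ring
  unfold sesq
  rw [hself, hself, hself, hw2, ha2, ha, ← Complex.ofReal_mul (α ^ 2)]
  simp only [Complex.sub_re, Complex.add_re, Complex.sub_im, Complex.add_im, Complex.ofReal_re,
    Complex.ofReal_im, Complex.re_ofReal_mul, Complex.im_ofReal_mul, Complex.I_mul_re, Complex.I_mul_im, hre]
  constructor <;> linarith

/-- The combination `Re a - K Im a` is at least `‖U‖² / 2` and at most `(1 + K) |a|`, whence the
value of `coercConst`. -/
lemma coercive_sesq (hb : 0 < b) {ω α r i₀ : ℝ} (hω : 0 < ω) (hα : α ∈ Icc (-(1 / 2) : ℝ) (1 / 2))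
    (hr : 0 ≤ r) (hi₀ : 0 < i₀) {M : LΩ b →L[ℂ] LΩ b}
    (hMr : ∀ f, (inner ℂ f (M f) : ℂ).re ≤ r * ‖f‖ ^ 2)
    (hMi : ∀ f, i₀ * ‖f‖ ^ 2 ≤ (inner ℂ f (M f) : ℂ).im) (U : H1 b) :
    coercConst ω r i₀ * ‖U‖ ^ 2 ≤ ‖sesq ω b α M U U‖ := by
  obtain ⟨h1, h2⟩ := sesq_self hb hω.le hα M U
  -- Chosen so that `K ω² i₀ = 1 + ω² r`: this pays for the term with `Re ρ` and leaves a full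
  -- `‖f‖²`, half of which covers the first-order term.
  set K := (1 + ω ^ 2 * r) / (ω ^ 2 * i₀) with hK
  have hK0 : 0 ≤ K := by positivity
  have hK1 : K * (ω ^ 2 * i₀) = 1 + ω ^ 2 * r := by rw [hK]; field_simp
  have hw : 0 < ω ^ 2 := by positivity
  set f := H1.fn b U
  set g := H1.grad b 0 U
  have e1 : ω ^ 2 * (inner ℂ f (M f) : ℂ).re ≤ ω ^ 2 * (r * ‖f‖ ^ 2) :=
    mul_le_mul_of_nonneg_left (hMr f) hw.le
  have e2 : ω ^ 2 * (i₀ * ‖f‖ ^ 2) ≤ ω ^ 2 * (inner ℂ f (M f) : ℂ).im :=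
    mul_le_mul_of_nonneg_left (hMi f) hw.le
  have e3 : K * (sesq ω b α M U U).im ≤ K * -(ω ^ 2 * (i₀ * ‖f‖ ^ 2)) :=
    mul_le_mul_of_nonneg_left (h2.trans (neg_le_neg e2)) hK0
  have e4 : K * -(ω ^ 2 * (i₀ * ‖f‖ ^ 2)) = -((1 + ω ^ 2 * r) * ‖f‖ ^ 2) := by rw [← hK1]; ring
  have e5 : -(1 / 2 * ‖f‖ ^ 2 + 1 / 2 * ‖g‖ ^ 2) ≤ 2 * α * (inner ℂ f g : ℂ).im := by
    have hα' : |α| ≤ 1 / 2 := abs_le.2 ⟨by linarith [hα.1], hα.2⟩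
    have hm : |(inner ℂ f g : ℂ).im| ≤ ‖f‖ * ‖g‖ :=
      (Complex.abs_im_le_norm _).trans (norm_inner_le_norm _ _)
    have h3 : |2 * α * (inner ℂ f g : ℂ).im| ≤ ‖f‖ * ‖g‖ := by
      rw [abs_mul, abs_mul, abs_two]
      calc 2 * |α| * |(inner ℂ f g : ℂ).im| ≤ 2 * (1 / 2) * (‖f‖ * ‖g‖) := by gcongr
        _ = _ := by ring
    nlinarith [(abs_le.1 h3).1, sq_nonneg (‖f‖ - ‖g‖)]
  have e6 := Complex.abs_re_le_norm (sesq ω b α M U U)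
  have e7 := Complex.abs_im_le_norm (sesq ω b α M U U)
  have e8 : K * -(sesq ω b α M U U).im ≤ K * ‖sesq ω b α M U U‖ :=
    mul_le_mul_of_nonneg_left ((neg_le_abs _).trans e7) hK0
  have e9 := (le_abs_self _).trans e6
  have hα2 : 0 ≤ α ^ 2 * ‖f‖ ^ 2 := by positivity
  rw [coercConst, ← hK, inv_mul_le_iff₀ (by positivity), H1.norm_sq_eq]
  nlinarith [sq_nonneg ‖H1.grad b 1 U‖]

/-! ### The load -/

/-- The antilinear functional of the problem on `H¹(Ω)`. -/
def loadSum (ω b h α : ℝ) (V : H1 b) : ℂ :=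
  -4 * Complex.I * ∑' n : ℤ, incCoeff ω h α n * conj (trCoeff b 0 n V)

/-- A bound for the sum of the Fourier coefficients of the incident field. -/
def incBound (ω h : ℝ) : ℝ :=
  Real.exp (h * (ω + 1 / 2)) * ∑' n : ℤ, Real.exp (-h * |(n : ℝ)|)

lemma summable_exp_int {h : ℝ} (hh : 0 < h) : Summable fun n : ℤ => Real.exp (-h * |(n : ℝ)|) := by
  simpa using summable_pow_mul_exp_int hh 0

lemma norm_load_term_le (hb : 0 < b) {ω h α : ℝ} (hω : 0 ≤ ω) (hh : 0 < h)
    (hα : α ∈ Icc (-(1 / 2) : ℝ) (1 / 2)) (V : H1 b) (n : ℤ) :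
    ‖incCoeff ω h α n * conj (trCoeff b 0 n V)‖
      ≤ Real.exp (h * (ω + 1 / 2)) * Real.exp (-h * |(n : ℝ)|) * (Real.sqrt (traceConst b) * ‖V‖) := by
  rw [norm_mul, RCLike.norm_conj]
  refine mul_le_mul (norm_incCoeff_le hω hh.le hα n) ?_ (norm_nonneg _) (by positivity)
  exact (norm_trCoeff_le hb 0 n V).trans
    (mul_le_mul_of_nonneg_left (norm_modePart_le n V) (Real.sqrt_nonneg _))

lemma summable_load (hb : 0 < b) {ω h α : ℝ} (hω : 0 ≤ ω) (hh : 0 < h)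
    (hα : α ∈ Icc (-(1 / 2) : ℝ) (1 / 2)) (V : H1 b) :
    Summable fun n : ℤ => incCoeff ω h α n * conj (trCoeff b 0 n V) :=
  Summable.of_norm_bounded (((summable_exp_int hh).mul_left _).mul_right _)
    (norm_load_term_le hb hω hh hα V)

lemma norm_loadSum_le (hb : 0 < b) {ω h α : ℝ} (hω : 0 ≤ ω) (hh : 0 < h)
    (hα : α ∈ Icc (-(1 / 2) : ℝ) (1 / 2)) (V : H1 b) :
    ‖loadSum ω b h α V‖ ≤ 4 * (incBound ω h * Real.sqrt (traceConst b)) * ‖V‖ := by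
  have h1 := tsum_of_norm_bounded (((summable_exp_int hh).mul_left _).mul_right _).hasSum
    (norm_load_term_le hb hω hh hα V)
  rw [tsum_mul_right, tsum_mul_left] at h1
  rw [loadSum, norm_mul, norm_mul, Complex.norm_I, norm_neg]
  simp only [Complex.norm_ofNat, mul_one]
  rw [incBound, mul_assoc 4, mul_assoc _ (Real.sqrt _)]
  exact mul_le_mul_of_nonneg_left h1 (by norm_num)

lemma loadSum_add (hb : 0 < b) {ω h α : ℝ} (hω : 0 ≤ ω) (hh : 0 < h)
    (hα : α ∈ Icc (-(1 / 2) : ℝ) (1 / 2)) (V V' : H1 b) :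
    loadSum ω b h α (V + V') = loadSum ω b h α V + loadSum ω b h α V' := by
  rw [loadSum, loadSum, loadSum, ← mul_add, ← (summable_load hb hω hh hα V).tsum_add
    (summable_load hb hω hh hα V')]
  refine congrArg _ (tsum_congr fun n => ?_); rw [map_add, map_add]; ring

lemma loadSum_smul (ω h α : ℝ) (c : ℂ) (V : H1 b) :
    loadSum ω b h α (c • V) = conj c * loadSum ω b h α V := by
  rw [loadSum, loadSum]
  simp only [← tsum_mul_left]
  refine tsum_congr fun n => ?_
  rw [map_smul, smul_eq_mul, map_mul]; ring

end Form

variable {b : ℝ}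

/-! ### Multiplication by the coefficient -/

/-- As an operator, `ρ` enters the estimates only through its norm bound, an upper bound on the real
part of its quadratic form and a lower bound on the imaginary part. -/
lemma exists_mulOp {ρ : Cyl → ℂ} (hm : AEStronglyMeasurable ρ (slabMeasure b)) {R : ℝ}
    (hR : ∀ᵐ p ∂(slabMeasure b), ‖ρ p‖ ≤ R) :
    ∃ M : LΩ b →L[ℂ] LΩ b, (∀ f : LΩ b, M f =ᵐ[slabMeasure b] fun p => ρ p * f p) ∧
      ∀ f, ‖M f‖ ≤ R * ‖f‖ := by
  have hρ : MemLp ρ ∞ (slabMeasure b) := memLp_top_of_bound hm R hR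
  have hmem : ∀ f : LΩ b, MemLp (fun p => ρ p * f p) 2 (slabMeasure b) := fun f =>
    (Lp.memLp f).mul hρ
  have hbound : ∀ f : LΩ b, ‖(hmem f).toLp _‖ ≤ R * ‖f‖ := fun f => by
    refine Lp.norm_le_mul_norm_of_ae_le_mul ?_
    filter_upwards [hR, (hmem f).coeFn_toLp] with p h1 h2
    rw [h2, norm_mul]
    gcongr
  refine ⟨LinearMap.mkContinuous
    { toFun := fun f => (hmem f).toLp _
      map_add' := fun f g => ?_
      map_smul' := fun c f => ?_ } R hbound, fun f => (hmem f).coeFn_toLp, hbound⟩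
  · rw [← MemLp.toLp_add]
    refine MemLp.toLp_congr _ _ ?_
    filter_upwards [Lp.coeFn_add f g] with p hp
    simp only [hp, Pi.add_apply]; ring
  · rw [RingHom.id_apply, ← MemLp.toLp_const_smul]
    refine MemLp.toLp_congr _ _ ?_
    filter_upwards [Lp.coeFn_smul c f] with p hp
    simp only [hp, Pi.smul_apply, smul_eq_mul]; ring

lemma inner_mulOp {ρ : Cyl → ℂ} {M : LΩ b →L[ℂ] LΩ b}
    (hM : ∀ f : LΩ b, M f =ᵐ[slabMeasure b] fun p => ρ p * f p) (f : LΩ b) :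
    Integrable (fun p => ρ p * ((‖f p‖ ^ 2 : ℝ) : ℂ)) (slabMeasure b) ∧
    inner ℂ f (M f) = ∫ p, ρ p * ((‖f p‖ ^ 2 : ℝ) : ℂ) ∂(slabMeasure b) := by
  have h : (fun p => conj (f p) * M f p) =ᵐ[slabMeasure b]
      fun p => ρ p * ((‖f p‖ ^ 2 : ℝ) : ℂ) := by
    filter_upwards [hM f] with p hp
    rw [hp, ← Complex.normSq_eq_norm_sq, ← Complex.mul_conj]; ring
  refine ⟨(integrable_conj_mul (Lp.memLp f) (Lp.memLp (M f))).congr h, ?_⟩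
  rw [inner_eq_integral, integral_congr_ae h]

lemma norm_sq_eq_integral (f : LΩ b) : ‖f‖ ^ 2 = ∫ p, ‖f p‖ ^ 2 ∂(slabMeasure b) := by
  have h : ((‖f‖ ^ 2 : ℝ) : ℂ) = ((∫ p, ‖f p‖ ^ 2 ∂(slabMeasure b) : ℝ) : ℂ) := by
    have h1 : (inner ℂ f f : ℂ) = ((‖f‖ ^ 2 : ℝ) : ℂ) := by
      rw [inner_self_eq_norm_sq_to_K]; push_cast; rfl
    rw [← h1, inner_eq_integral, ← integral_complex_ofReal]
    congr 1; ext p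
    rw [mul_comm, Complex.mul_conj, Complex.normSq_eq_norm_sq]
  exact_mod_cast h

lemma re_inner_mulOp_le {ρ : Cyl → ℂ} {M : LΩ b →L[ℂ] LΩ b}
    (hM : ∀ f : LΩ b, M f =ᵐ[slabMeasure b] fun p => ρ p * f p) {r : ℝ}
    (hr : ∀ᵐ p ∂(slabMeasure b), (ρ p).re ≤ r) (f : LΩ b) :
    (inner ℂ f (M f) : ℂ).re ≤ r * ‖f‖ ^ 2 := by
  obtain ⟨hi, he⟩ := inner_mulOp hM f
  rw [he, norm_sq_eq_integral, ← integral_const_mul]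
  refine ((integral_re hi).symm.trans_le ?_ : RCLike.re _ ≤ _)
  refine integral_mono_ae hi.re
    (((Lp.memLp f).integrable_norm_pow (p := 2) (by norm_num)).const_mul r) ?_
  filter_upwards [hr] with p hp
  change (ρ p * ((‖f p‖ ^ 2 : ℝ) : ℂ)).re ≤ r * ‖f p‖ ^ 2
  rw [Complex.re_mul_ofReal]
  gcongr

lemma le_im_inner_mulOp {ρ : Cyl → ℂ} {M : LΩ b →L[ℂ] LΩ b}
    (hM : ∀ f : LΩ b, M f =ᵐ[slabMeasure b] fun p => ρ p * f p) {i₀ : ℝ}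
    (hr : ∀ᵐ p ∂(slabMeasure b), i₀ ≤ (ρ p).im) (f : LΩ b) :
    i₀ * ‖f‖ ^ 2 ≤ (inner ℂ f (M f) : ℂ).im := by
  obtain ⟨hi, he⟩ := inner_mulOp hM f
  rw [he, norm_sq_eq_integral, ← integral_const_mul]
  refine le_trans ?_ (integral_im hi).le
  refine integral_mono_ae
    (((Lp.memLp f).integrable_norm_pow (p := 2) (by norm_num)).const_mul i₀) hi.im ?_
  filter_upwards [hr] with p hp
  change i₀ * ‖f p‖ ^ 2 ≤ (ρ p * ((‖f p‖ ^ 2 : ℝ) : ℂ)).im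
  rw [Complex.im_mul_ofReal]
  gcongr

/-! ### Identification of the weak formulation -/

lemma integral_mul_conj_eq_inner {F G : LΩ b} {f g : Cyl → ℂ} (hf : F =ᵐ[slabMeasure b] f)
    (hg : G =ᵐ[slabMeasure b] g) :
    ∫ p, f p * conj (g p) ∂(slabMeasure b) = inner ℂ G F := by
  rw [inner_eq_integral]
  refine integral_congr_ae ?_
  filter_upwards [hf, hg] with p h1 h2
  rw [h1, h2, mul_comm]

lemma form_eq_sesq (hb : 0 < b) {ρ : Cyl → ℂ} {M : LΩ b →L[ℂ] LΩ b}
    (hM : ∀ f : LΩ b, M f =ᵐ[slabMeasure b] fun p => ρ p * f p) (ω α : ℝ) {U V : H1 b}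
    {u v : Cyl → ℂ} (hU : Represents U u) (hV : Represents V v) :
    form ω b α ρ u v = sesq ω b α M U V := by
  have hMU : M (H1.fn b U) =ᵐ[slabMeasure b] fun p => ρ p * u p := by
    filter_upwards [hM (H1.fn b U), hU.fn_ae] with p h1 h2
    rw [h1, h2]
  have hint : ∀ i : Fin 2, Integrable (fun p => weakD b i u p * conj (weakD b i v p))
      (slabMeasure b) := fun i =>
    (hU.memH1.isWeakPartial i).1.integrable_mul (hV.memH1.isWeakPartial i).1.star
  have hd : ∀ s : Fin 2, ∀ f k : S → ℂ, (∀ n, fourierCoeff f n = trCoeff b s n U) →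
      (∀ n, fourierCoeff k n = trCoeff b s n V) → dtnPairing ω α f k = dtnSum ω b α s U V := by
    intro s f k hf hk
    simp only [dtnPairing, dtnSum, hf, hk]
  unfold form sesq
  simp only [Fin.sum_univ_two]
  rw [integral_add (hint 0) (hint 1), integral_mul_conj_eq_inner (hU.grad_ae 0) (hV.grad_ae 0),
    integral_mul_conj_eq_inner (hU.grad_ae 1) (hV.grad_ae 1),
    integral_mul_conj_eq_inner hMU hV.fn_ae, integral_mul_conj_eq_inner hU.fn_ae hV.fn_ae,
    integral_mul_conj_eq_inner (hU.grad_ae 0) hV.fn_ae,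
    hd 0 _ _ (hU.trCoeff_zero hb) (hV.trCoeff_zero hb),
    hd 1 _ _ (hU.trCoeff_one hb) (hV.trCoeff_one hb)]

lemma integral_fourier_mul_conj (τ : S → ℂ) (n : ℤ) :
    ∫ x : S, fourier n x * conj (τ x) = 2 * Real.pi * conj (fourierCoeff τ n) := by
  rw [fourierCoeff, AddCircle.integral_haarAddCircle, Complex.real_smul, map_mul, Complex.conj_ofReal,
    ← integral_conj]
  have : (Real.pi : ℂ) ≠ 0 := by exact_mod_cast Real.pi_ne_zero
  have h : ∀ x : S, conj (fourier (-n) x • τ x) = fourier n x * conj (τ x) := fun x => by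
    rw [smul_eq_mul, map_mul, ← fourier_neg, neg_neg]
  simp only [h]
  push_cast
  rw [mul_inv]
  field_simp

/-- Exponential decay of the coefficients allows termwise integration; the factor is `2 · (-i/π) ·
2π = -4i`. -/
lemma load_eq_loadSum (hb : 0 < b) {ω h α : ℝ} (hω : 0 ≤ ω) (hh : 0 < h)
    (hα : α ∈ Icc (-(1 / 2) : ℝ) (1 / 2)) {V : H1 b} {v : Cyl → ℂ} (hV : Represents V v) :
    load ω b h α v = loadSum ω b h α V := by
  have hτ : MemLp (trace b v).1 2 (volume : Measure S) := (isTrace_trace hb hV.memH1).1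
  have hτi : Integrable (fun x : S => conj ((trace b v).1 x)) :=
    hτ.star.integrable (by norm_num)
  have hnorm : ∀ n : ℤ, ∀ x : S, ‖incCoeff ω h α n * (fourier n x * conj ((trace b v).1 x))‖
      = ‖incCoeff ω h α n‖ * ‖conj ((trace b v).1 x)‖ := by
    intro n x
    rw [norm_mul, norm_mul, fourier_apply, Circle.norm_coe, one_mul]
  have hFi : ∀ n : ℤ, Integrable
      (fun x : S => incCoeff ω h α n * (fourier n x * conj ((trace b v).1 x))) := by
    intro n
    refine (hτi.bdd_mul (c := 1) (fourier n).continuous.aestronglyMeasurable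
      (Eventually.of_forall fun x => ?_)).const_mul _
    rw [fourier_apply, Circle.norm_coe]
  have hsum := integral_tsum_of_summable_integral_norm hFi (by
    simp only [hnorm, integral_const_mul]
    refine Summable.mul_right _ (Summable.of_nonneg_of_le (fun n => norm_nonneg _)
      (norm_incCoeff_le hω hh.le hα) ((summable_exp_int hh).mul_left _)))
  have hpt : ∀ x : S, gInc ω h α x * conj ((trace b v).1 x)
      = (-Complex.I / (Real.pi : ℂ)) *
        ∑' n : ℤ, incCoeff ω h α n * (fourier n x * conj ((trace b v).1 x)) := by
    intro x
    rw [gInc, mul_assoc, ← tsum_mul_right]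
    simp only [incCoeff, mul_assoc]
  unfold load loadSum
  simp only [hpt]
  rw [integral_const_mul, ← hsum]
  simp only [integral_const_mul, integral_fourier_mul_conj, hV.trCoeff_zero hb]
  have : (Real.pi : ℂ) ≠ 0 := by exact_mod_cast Real.pi_ne_zero
  simp only [mul_left_comm _ (2 * (Real.pi : ℂ)) _]
  rw [tsum_mul_left]
  field_simp
  ring

lemma isWeakSolution_iff (hb : 0 < b) {ρ : Cyl → ℂ} {M : LΩ b →L[ℂ] LΩ b}
    (hM : ∀ f : LΩ b, M f =ᵐ[slabMeasure b] fun p => ρ p * f p) {ω h α : ℝ} (hω : 0 ≤ ω)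
    (hh : 0 < h) (hα : α ∈ Icc (-(1 / 2) : ℝ) (1 / 2)) (U : H1 b) :
    IsWeakSolution ω b h α ρ (H1.fn b U) ↔ ∀ V, sesq ω b α M U V = loadSum ω b h α V := by
  constructor
  · intro hu V
    rw [← form_eq_sesq hb hM ω α (represents_fn U) (represents_fn V),
      ← load_eq_loadSum hb hω hh hα (represents_fn V)]
    exact hu.2 _ (H1.memH1 V)
  · intro hU
    refine ⟨H1.memH1 U, fun v hv => ?_⟩
    obtain ⟨V, hV⟩ := exists_represents hv
    rw [form_eq_sesq hb hM ω α (represents_fn U) hV, load_eq_loadSum hb hω hh hα hV, hU]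

lemma IsWeakSolution.exists_eq_fn {ω h α : ℝ} {ρ : Cyl → ℂ} {u : LΩ b}
    (hu : IsWeakSolution ω b h α ρ u) : ∃ U : H1 b, H1.fn b U = u := by
  obtain ⟨U, hU⟩ := exists_represents hu.1
  exact ⟨U, Lp.ext hU.fn_ae⟩

/-! ### A priori bounds -/

/-- The bound for the norm of the weak solution in `H¹(Ω)`. -/
def boundH1 (ω b h r i₀ : ℝ) : ℝ :=
  (coercConst ω r i₀)⁻¹ * (4 * (incBound ω h * Real.sqrt (traceConst b)))

lemma norm_le_boundH1 (hb : 0 < b) {ω h α r i₀ : ℝ} (hω : 0 < ω) (hh : 0 < h)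
    (hα : α ∈ Icc (-(1 / 2) : ℝ) (1 / 2)) (hr : 0 ≤ r) (hi₀ : 0 < i₀) {M : LΩ b →L[ℂ] LΩ b}
    (hMr : ∀ f, (inner ℂ f (M f) : ℂ).re ≤ r * ‖f‖ ^ 2)
    (hMi : ∀ f, i₀ * ‖f‖ ^ 2 ≤ (inner ℂ f (M f) : ℂ).im) {U : H1 b}
    (hU : ∀ V, sesq ω b α M U V = loadSum ω b h α V) : ‖U‖ ≤ boundH1 ω b h r i₀ := by
  have h1 := coercive_sesq hb hω hα hr hi₀ hMr hMi U
  rw [hU] at h1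
  have h2 := h1.trans (norm_loadSum_le hb hω.le hh hα U)
  have hc : 0 < coercConst ω r i₀ := by unfold coercConst; positivity
  rcases (norm_nonneg U).eq_or_lt with h0 | h0
  · rw [← h0, boundH1, incBound]
    have : 0 ≤ ∑' n : ℤ, Real.exp (-h * |(n : ℝ)|) := tsum_nonneg fun n => (Real.exp_pos _).le
    positivity
  · rw [boundH1, le_inv_mul_iff₀ hc]
    refine le_of_mul_le_mul_right ?_ h0
    linarith [pow_two ‖U‖]

/-- Orthogonality of frequencies leaves one term of the series, so the sign survives although the
two arguments differ. -/
lemma dtnSum_modePart (ω α : ℝ) (s : Fin 2) (n : ℤ) (U : H1 b) :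
    (dtnSum ω b α s U (H1.modePart n U)).re ≤ 0 := by
  have h : dtnSum ω b α s U (H1.modePart n U)
      = ((2 * Real.pi * ‖trCoeff b s n U‖ ^ 2 : ℝ) : ℂ) * (Complex.I * beta ω ((n : ℝ) + α)) := by
    rw [dtnSum, tsum_eq_single n]
    · rw [trCoeff_modePart, if_pos rfl, mul_assoc (Complex.I * _), Complex.mul_conj,
        Complex.normSq_eq_norm_sq]
      push_cast; ring
    · intro m hm
      rw [trCoeff_modePart, if_neg hm, map_zero, mul_zero]
  rw [h, Complex.re_ofReal_mul]
  refine mul_nonpos_of_nonneg_of_nonpos (by positivity) ?_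
  simpa using beta_im_nonneg ω _

lemma loadSum_modePart (ω h α : ℝ) (n : ℤ) (U : H1 b) :
    loadSum ω b h α (H1.modePart n U)
      = -4 * Complex.I * (incCoeff ω h α n * conj (trCoeff b 0 n U)) := by
  rw [loadSum, tsum_eq_single n]
  · rw [trCoeff_modePart, if_pos rfl]
  · intro m hm
    rw [trCoeff_modePart, if_neg hm, map_zero, mul_zero]

/-- The equation is tested with the frequency `n` part of its solution. The contributions `n²`,
`2αn` and `α²` combine into `(n + α)²`, the boundary terms are dropped by sign, and the only
coupling between modes, through `ρ`, stays on the right. -/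
lemma mode_energy (hb : 0 < b) {ω h α : ℝ} {M : LΩ b →L[ℂ] LΩ b} {U : H1 b}
    (hU : ∀ V, sesq ω b α M U V = loadSum ω b h α V) (n : ℤ) :
    ((n : ℝ) + α) ^ 2 * ‖coeff b n (H1.fn b U)‖ ^ 2 + ‖coeff b n (H1.grad b 1 U)‖ ^ 2
      ≤ ω ^ 2 * (‖coeff b n (H1.fn b U)‖ * ‖coeff b n (M (H1.fn b U))‖)
        + 4 * (‖incCoeff ω h α n‖ * (Real.sqrt (traceConst b) * ‖H1.modePart n U‖)) := by
  have h1 := hU (H1.modePart n U)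
  rw [loadSum_modePart] at h1
  unfold sesq at h1
  rw [H1.grad_modePart, H1.grad_modePart, H1.fn_modePart] at h1
  simp only [inner_proj_left] at h1
  have hself : ∀ f : Lp ℂ 2 (segMeasure b), (inner ℂ f f : ℂ) = ((‖f‖ ^ 2 : ℝ) : ℂ) := fun f => by
    rw [inner_self_eq_norm_sq_to_K]; push_cast; rfl
  have hcross : (inner ℂ (coeff b n (H1.fn b U)) (coeff b n (H1.grad b 0 U)) : ℂ)
      = Complex.I * ((n * ‖coeff b n (H1.fn b U)‖ ^ 2 : ℝ) : ℂ) := by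
    rw [H1.coeff_grad_zero, inner_smul_right, hself]; push_cast; ring
  have ha : ∀ z : ℂ, 2 * Complex.I * (α : ℂ) * (Complex.I * z) = ((-(2 * α) : ℝ) : ℂ) * z := fun z => by
    push_cast; linear_combination 2 * α * z * Complex.I_mul_I
  have hw2 : ((ω : ℂ) ^ 2) = ((ω ^ 2 : ℝ) : ℂ) := by push_cast; rfl
  have ha2 : ((α : ℂ) ^ 2) = ((α ^ 2 : ℝ) : ℂ) := by push_cast; rfl
  rw [hself, hself, hself, H1.norm_sq_coeff_grad_zero, hcross, ha, hw2, ha2, ← Complex.ofReal_mul,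
    ← Complex.ofReal_mul] at h1
  have h2 := congrArg Complex.re h1
  simp only [Complex.sub_re, Complex.add_re, Complex.ofReal_re, Complex.re_ofReal_mul] at h2
  have h3 := dtnSum_modePart ω α 0 n U
  have h4 := dtnSum_modePart ω α 1 n U
  have h5 : (inner ℂ (coeff b n (H1.fn b U)) (coeff b n (M (H1.fn b U))) : ℂ).re
      ≤ ‖coeff b n (H1.fn b U)‖ * ‖coeff b n (M (H1.fn b U))‖ :=
    (Complex.re_le_norm _).trans (norm_inner_le_norm _ _)
  have h6 : (-4 * Complex.I * (incCoeff ω h α n * conj (trCoeff b 0 n U))).re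
      ≤ 4 * (‖incCoeff ω h α n‖ * (Real.sqrt (traceConst b) * ‖H1.modePart n U‖)) := by
    refine (Complex.re_le_norm _).trans ?_
    rw [norm_mul, norm_mul, norm_mul, norm_neg, Complex.norm_I, RCLike.norm_conj]
    simp only [Complex.norm_ofNat, mul_one]
    gcongr
    exact norm_trCoeff_le hb 0 n U
  have h7 := mul_le_mul_of_nonneg_left h5 (sq_nonneg ω)
  nlinarith [h2, h3, h4, h6, h7]

/-- The elementary inequality behind the `H²` estimate of a Fourier mode. -/
lemma mode_inequality {m w2 x w F e T p N : ℝ} (hN : 1 ≤ N) (hm : N / 4 ≤ m)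
    (hp : p ^ 2 = x ^ 2 + N * x ^ 2 + w ^ 2)
    (hq : m * x ^ 2 + w ^ 2 ≤ w2 * (x * F) + 4 * (e * (T * p))) :
    N * (N * x ^ 2) + N * w ^ 2 ≤ 32 * w2 ^ 2 * F ^ 2 + 1024 * T ^ 2 * (N * e ^ 2) := by
  -- With these Young weights, after multiplication by `N` there remain `N² x² / 8` and `31 N w² /
  -- 32` on the left; a final factor `8` gives `32` and `1024`.
  have h1 : w2 * (N * x * F) ≤ (N * x) ^ 2 / 16 + 4 * (w2 * F) ^ 2 := by
    nlinarith [sq_nonneg (N * x / 4 - 2 * (w2 * F))]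
  have h2 : 4 * (e * (T * p)) ≤ p ^ 2 / 32 + 128 * (e * T) ^ 2 := by
    nlinarith [sq_nonneg (p - 64 * (e * T))]
  have hx : 0 ≤ x ^ 2 := sq_nonneg x
  have h3 : p ^ 2 ≤ 2 * (N * x ^ 2) + w ^ 2 := by nlinarith
  have h4 : N / 4 * x ^ 2 + w ^ 2 ≤ w2 * (x * F) + 4 * (e * (T * p)) := by nlinarith
  have h5 : N / 4 * x ^ 2 + w ^ 2 ≤ w2 * (x * F) + ((2 * (N * x ^ 2) + w ^ 2) / 32 + 128 * (e * T) ^ 2) := by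
    linarith
  have h6 : N * (N / 4 * x ^ 2 + w ^ 2)
      ≤ N * (w2 * (x * F) + ((2 * (N * x ^ 2) + w ^ 2) / 32 + 128 * (e * T) ^ 2)) :=
    mul_le_mul_of_nonneg_left h5 (by linarith)
  have h7 : 0 ≤ N * w ^ 2 := by positivity
  nlinarith

/-- The bound for the second derivatives of the weak solution that involve `∂_x`. -/
def boundMixed (ω b h r i₀ R : ℝ) : ℝ :=
  32 * (ω ^ 2) ^ 2 * (R * boundH1 ω b h r i₀) ^ 2
    + 1024 * traceConst b * (Real.exp (h * (ω + 1 / 2)) ^ 2 *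
      ∑' n : ℤ, |(n : ℝ)| ^ 2 * Real.exp (-h * |(n : ℝ)|))

lemma mode_bound (hb : 0 < b) {ω h α : ℝ} (hω : 0 ≤ ω) (hh : 0 < h)
    (hα : α ∈ Icc (-(1 / 2) : ℝ) (1 / 2)) {M : LΩ b →L[ℂ] LΩ b} {U : H1 b}
    (hU : ∀ V, sesq ω b α M U V = loadSum ω b h α V) (n : ℤ) :
    (n : ℝ) ^ 2 * ‖coeff b n (H1.grad b 0 U)‖ ^ 2 + (n : ℝ) ^ 2 * ‖coeff b n (H1.grad b 1 U)‖ ^ 2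
      ≤ 32 * (ω ^ 2) ^ 2 * ‖coeff b n (M (H1.fn b U))‖ ^ 2
        + 1024 * traceConst b * (Real.exp (h * (ω + 1 / 2)) ^ 2 *
          (|(n : ℝ)| ^ 2 * Real.exp (-h * |(n : ℝ)|))) := by
  have hT := Real.sq_sqrt (traceConst_pos hb).le
  -- The zero mode needs no estimate, as its left side carries the factor `n²`.
  rcases eq_or_ne n 0 with rfl | hn
  · have := (traceConst_pos hb).le
    exact le_trans (le_of_eq (by simp)) (add_nonneg (by positivity) (by positivity))
  have hN : 1 ≤ (n : ℝ) ^ 2 := by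
    have : 1 ≤ |n| := Int.one_le_abs hn
    have h1 : (1 : ℝ) ≤ |(n : ℝ)| := by exact_mod_cast this
    nlinarith [sq_abs (n : ℝ)]
  -- For `n ≠ 0`, `|n + α| ≥ |n| - 1/2 ≥ |n| / 2`.
  have hm : (n : ℝ) ^ 2 / 4 ≤ ((n : ℝ) + α) ^ 2 := by
    have h1 : (1 : ℝ) ≤ |(n : ℝ)| := by
      have : 1 ≤ |n| := Int.one_le_abs hn
      exact_mod_cast this
    have h2 := (abs_add_le_of_mem hα n).1
    nlinarith [sq_abs (n : ℝ), sq_abs ((n : ℝ) + α)]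
  have hp := H1.norm_sq_modePart n U
  rw [H1.norm_sq_coeff_grad_zero] at hp
  have key := mode_inequality hN hm hp (mode_energy hb hU n)
  rw [H1.norm_sq_coeff_grad_zero]
  refine key.trans ?_
  rw [hT]
  have he : (n : ℝ) ^ 2 * ‖incCoeff ω h α n‖ ^ 2
      ≤ Real.exp (h * (ω + 1 / 2)) ^ 2 * (|(n : ℝ)| ^ 2 * Real.exp (-h * |(n : ℝ)|)) := by
    have h1 := norm_incCoeff_le hω hh.le hα n
    have h2 : Real.exp (-h * |(n : ℝ)|) ≤ 1 :=
      Real.exp_le_one_iff.2 (by nlinarith [abs_nonneg (n : ℝ)])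
    have h3 := (Real.exp_pos (-h * |(n : ℝ)|)).le
    calc (n : ℝ) ^ 2 * ‖incCoeff ω h α n‖ ^ 2
        ≤ (n : ℝ) ^ 2 * (Real.exp (h * (ω + 1 / 2)) * Real.exp (-h * |(n : ℝ)|)) ^ 2 := by gcongr
      _ = Real.exp (h * (ω + 1 / 2)) ^ 2 * ((n : ℝ) ^ 2 *
          (Real.exp (-h * |(n : ℝ)|) * Real.exp (-h * |(n : ℝ)|))) := by ring
      _ ≤ Real.exp (h * (ω + 1 / 2)) ^ 2 * ((n : ℝ) ^ 2 * (Real.exp (-h * |(n : ℝ)|) * 1)) := by gcongr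
      _ = _ := by rw [sq_abs, mul_one]
  have hc := (traceConst_pos hb).le
  gcongr

lemma summable_mode_bound (hb : 0 < b) {ω h α r i₀ R : ℝ} (hω : 0 < ω) (hh : 0 < h)
    (hα : α ∈ Icc (-(1 / 2) : ℝ) (1 / 2)) {M : LΩ b →L[ℂ] LΩ b}
    (hR : 0 ≤ R) (hMR : ∀ f, ‖M f‖ ≤ R * ‖f‖) {U : H1 b}
    (hU : ∀ V, sesq ω b α M U V = loadSum ω b h α V) (hUb : ‖U‖ ≤ boundH1 ω b h r i₀)
    (i : Fin 2) : Summable (fun n : ℤ => (n : ℝ) ^ 2 * ‖coeff b n (H1.grad b i U)‖ ^ 2) ∧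
      ∑' n : ℤ, (n : ℝ) ^ 2 * ‖coeff b n (H1.grad b i U)‖ ^ 2 ≤ boundMixed ω b h r i₀ R := by
  have hs := ((hasSum_norm_coeff (M (H1.fn b U))).mul_left (32 * (ω ^ 2) ^ 2)).add
    (((summable_pow_mul_exp_int hh 2).hasSum.mul_left (Real.exp (h * (ω + 1 / 2)) ^ 2)).mul_left
      (1024 * traceConst b))
  have hle : ∀ n : ℤ, (n : ℝ) ^ 2 * ‖coeff b n (H1.grad b i U)‖ ^ 2 ≤
      32 * (ω ^ 2) ^ 2 * ‖coeff b n (M (H1.fn b U))‖ ^ 2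
        + 1024 * traceConst b * (Real.exp (h * (ω + 1 / 2)) ^ 2 *
          (|(n : ℝ)| ^ 2 * Real.exp (-h * |(n : ℝ)|))) := by
    intro n
    refine le_trans ?_ (mode_bound hb hω.le hh hα hU n)
    have h0 : 0 ≤ (n : ℝ) ^ 2 * ‖coeff b n (H1.grad b 0 U)‖ ^ 2 := by positivity
    have h1 : 0 ≤ (n : ℝ) ^ 2 * ‖coeff b n (H1.grad b 1 U)‖ ^ 2 := by positivity
    fin_cases i
    · exact le_add_of_nonneg_right h1
    · exact le_add_of_nonneg_left h0
  have hsum := Summable.of_nonneg_of_le (fun n => by positivity) hle hs.summable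
  refine ⟨hsum, (hasSum_le hle hsum.hasSum hs).trans ?_⟩
  rw [boundMixed]
  have hM : ‖M (H1.fn b U)‖ ≤ R * boundH1 ω b h r i₀ :=
    (hMR _).trans (mul_le_mul_of_nonneg_left ((H1.norm_fn_le U).trans hUb) hR)
  gcongr

/-! ### Regularity -/

/-- A test function as an element of `H¹(Ω)`. -/
def IsTest.toH1 (hb : 0 ≤ b) {ψ : Cyl → ℂ} (hψ : IsTest b ψ) : H1 b :=
  H1.mk (hψ.1.toLp b) ((hψ.1.pd 0).toLp b) ((hψ.1.pd 1).toLp b)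
    ((isWeakPartial_smooth hb hψ.1 0).congr (hψ.1.memLp b).coeFn_toLp.symm
      ((hψ.1.pd 0).memLp b).coeFn_toLp.symm)
    ((isWeakPartial_smooth hb hψ.1 1).congr (hψ.1.memLp b).coeFn_toLp.symm
      ((hψ.1.pd 1).memLp b).coeFn_toLp.symm)

/-- The two inner products in `trCoeff` cancel: this is the weak derivative identity of the smooth
function `e^{inx}` times `bump`, tested with `ψ`. -/
lemma trCoeff_test (hb : 0 ≤ b) {ψ : Cyl → ℂ} (hψ : IsTest b ψ) (s : Fin 2) (n : ℤ) :
    trCoeff b s n (hψ.toH1 hb) = 0 := by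
  have hs := isSmooth_modeFun n (contDiff_bump b s n)
  have h := isWeakPartial_iff.1 ((isWeakPartial_smooth hb hs 1).congr
    (hs.memLp b).coeFn_toLp.symm ((hs.pd 1).memLp b).coeFn_toLp.symm) ψ hψ
  have h' : inner ℂ ((hψ.1.pd 1).toLp b) (hs.toLp b) = - inner ℂ (hψ.1.toLp b) ((hs.pd 1).toLp b) := h
  rw [toLp_modeFun n (contDiff_bump b s n), toLp_pd_one_bump, inner_mode_right, inner_mode_right] at h'
  have h2 := congrArg conj h'
  rw [map_neg, inner_conj_symm, inner_conj_symm] at h2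
  have e1 : H1.grad b 1 (hψ.toH1 hb) = (hψ.1.pd 1).toLp b := rfl
  have e2 : H1.fn b (hψ.toH1 hb) = hψ.1.toLp b := rfl
  rw [trCoeff_apply, e1, e2, h2]
  ring

/-- Testing with `∂_x ψ` and `∂_y ψ` and commuting the classical derivatives shows that one function
serves as both mixed derivatives. -/
lemma isWeakPartial_grad_swap {U : H1 b} {z : LΩ b} (hz : IsWeakPartial b 0 (H1.grad b 1 U) z) :
    IsWeakPartial b 1 (H1.grad b 0 U) z := by
  rw [isWeakPartial_iff] at hz ⊢
  intro ψ hψ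
  have h1 := isWeakPartial_iff.1 (H1.isWeakPartial U 0) _ (hψ.pd 1)
  have h2 := isWeakPartial_iff.1 (H1.isWeakPartial U 1) _ (hψ.pd 0)
  have h3 := hz ψ hψ
  have h4 : ((hψ.pd 1).1.pd 0).toLp b = ((hψ.pd 0).1.pd 1).toLp b :=
    IsSmooth.toLp_congr _ _ b (pd_comm hψ.1 0 1)
  rw [h4] at h1
  linear_combination h1 - h2 + h3

/-- On test functions the boundary terms and the load vanish, so the weak equation can be solved for
`∂_y²u`. -/
lemma isWeakPartial_grad_one (hb : 0 < b) {ω h α : ℝ} {M : LΩ b →L[ℂ] LΩ b} {U : H1 b}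
    (hU : ∀ V, sesq ω b α M U V = loadSum ω b h α V) {z : LΩ b}
    (hz : IsWeakPartial b 0 (H1.grad b 0 U) z) {w : LΩ b}
    (hw : w = -z - ((ω : ℂ) ^ 2) • M (H1.fn b U)
      + ((α : ℂ) ^ 2) • H1.fn b U - (2 * Complex.I * (α : ℂ)) • H1.grad b 0 U) :
    IsWeakPartial b 1 (H1.grad b 1 U) w := by
  subst hw
  rw [isWeakPartial_iff] at hz ⊢
  intro ψ hψ
  have h1 := hU (hψ.toH1 hb.le)
  have hl : loadSum ω b h α (hψ.toH1 hb.le) = 0 := by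
    simp only [loadSum, trCoeff_test, map_zero, mul_zero, tsum_zero]
  have hd : ∀ s, dtnSum ω b α s U (hψ.toH1 hb.le) = 0 := fun s => by
    simp only [dtnSum, trCoeff_test, map_zero, mul_zero, tsum_zero]
  have e0 : H1.grad b 0 (hψ.toH1 hb.le) = (hψ.1.pd 0).toLp b := rfl
  have e1 : H1.grad b 1 (hψ.toH1 hb.le) = (hψ.1.pd 1).toLp b := rfl
  have e2 : H1.fn b (hψ.toH1 hb.le) = hψ.1.toLp b := rfl
  unfold sesq at h1
  rw [hl, hd, hd, e0, e1, e2, hz ψ hψ] at h1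
  simp only [inner_add_right, inner_sub_right, inner_neg_right, inner_smul_right]
  linear_combination h1

/-- The bound for the norm of the weak solution in `H²(Ω)`. -/
def boundH2 (ω b h r i₀ R : ℝ) : ℝ :=
  Real.sqrt (boundH1 ω b h r i₀ ^ 2 + (3 * boundMixed ω b h r i₀ R
    + (Real.sqrt (boundMixed ω b h r i₀ R) + (ω ^ 2 * R + 2) * boundH1 ω b h r i₀) ^ 2))

lemma normL2_eq {f : LΩ b} {g : Cyl → ℂ} (h : g =ᵐ[slabMeasure b] f) : normL2 b g = ‖f‖ := by
  rw [normL2, eLpNorm_congr_ae h, Lp.norm_def]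

lemma regularity (hb : 0 < b) {ω h α r i₀ R : ℝ} (hω : 0 < ω) (hh : 0 < h)
    (hα : α ∈ Icc (-(1 / 2) : ℝ) (1 / 2)) (hr : 0 ≤ r) (hi₀ : 0 < i₀) {M : LΩ b →L[ℂ] LΩ b}
    (hMr : ∀ f, (inner ℂ f (M f) : ℂ).re ≤ r * ‖f‖ ^ 2)
    (hMi : ∀ f, i₀ * ‖f‖ ^ 2 ≤ (inner ℂ f (M f) : ℂ).im)
    (hR : 0 ≤ R) (hMR : ∀ f, ‖M f‖ ≤ R * ‖f‖) {U : H1 b}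
    (hU : ∀ V, sesq ω b α M U V = loadSum ω b h α V) :
    MemH2 b (H1.fn b U) ∧ normH2 b (H1.fn b U) ≤ boundH2 ω b h r i₀ R := by
  have hUb := norm_le_boundH1 hb hω hh hα hr hi₀ hMr hMi hU
  obtain ⟨s0, t0⟩ := summable_mode_bound hb hω hh hα hR hMR hU hUb 0
  obtain ⟨s1, t1⟩ := summable_mode_bound hb hω hh hα hR hMR hU hUb 1
  obtain ⟨z₀, hz₀, nz₀⟩ := exists_isWeakPartial_zero hb.le _ s0
  obtain ⟨z₁, hz₁, nz₁⟩ := exists_isWeakPartial_zero hb.le _ s1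
  have hz₁' := isWeakPartial_grad_swap hz₁
  obtain ⟨z₂, hz₂, nz₂⟩ : ∃ z : LΩ b, IsWeakPartial b 1 (H1.grad b 1 U) z ∧
      ‖z‖ ≤ Real.sqrt (boundMixed ω b h r i₀ R) + (ω ^ 2 * R + 2) * boundH1 ω b h r i₀ := by
    refine ⟨_, isWeakPartial_grad_one hb hU hz₀ rfl, ?_⟩
    have n0 : ‖-z₀‖ ≤ Real.sqrt (boundMixed ω b h r i₀ R) := by
      rw [norm_neg]; exact Real.le_sqrt_of_sq_le (nz₀.trans_le t0)
    have nf := (H1.norm_fn_le U).trans hUb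
    have ng := (H1.norm_grad_le 0 U).trans hUb
    have hα' : |α| ≤ 1 / 2 := abs_le.2 ⟨by linarith [hα.1], hα.2⟩
    have hB : 0 ≤ boundH1 ω b h r i₀ := (norm_nonneg U).trans hUb
    have n1 : ‖((ω : ℂ) ^ 2) • M (H1.fn b U)‖ ≤ ω ^ 2 * (R * boundH1 ω b h r i₀) := by
      rw [norm_smul, norm_pow, Complex.norm_real, Real.norm_of_nonneg hω.le]
      refine mul_le_mul_of_nonneg_left ?_ (by positivity)
      exact (hMR _).trans (mul_le_mul_of_nonneg_left nf hR)
    -- The factors `α²` and `2|α|` are each bounded by `1`; together they make the `2` in `boundH2`.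
    have n2 : ‖((α : ℂ) ^ 2) • H1.fn b U‖ ≤ 1 * boundH1 ω b h r i₀ := by
      rw [norm_smul, norm_pow, Complex.norm_real, Real.norm_eq_abs]
      refine mul_le_mul ?_ nf (norm_nonneg _) zero_le_one
      nlinarith [abs_nonneg α]
    have n3 : ‖(2 * Complex.I * (α : ℂ)) • H1.grad b 0 U‖ ≤ 1 * boundH1 ω b h r i₀ := by
      rw [norm_smul, norm_mul, norm_mul, Complex.norm_real, Real.norm_eq_abs, Complex.norm_I]
      simp only [Complex.norm_ofNat, mul_one]
      refine mul_le_mul ?_ ng (norm_nonneg _) zero_le_one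
      linarith
    refine (norm_sub_le_of_le (norm_add_le_of_le (norm_sub_le_of_le n0 n1) n2) n3).trans_eq ?_
    ring
  have hu : MemLp (H1.fn b U) 2 (slabMeasure b) := Lp.memLp _
  have hD : ∀ i, weakD b i (H1.fn b U) =ᵐ[slabMeasure b] H1.grad b i U := fun i =>
    weakD_ae hu (H1.isWeakPartial U i)
  have hDm : ∀ i, MemLp (weakD b i (H1.fn b U)) 2 (slabMeasure b) := fun i =>
    (Lp.memLp (H1.grad b i U)).ae_eq (hD i).symm
  have w00 := hz₀.congr (hD 0).symm (ae_eq_refl _)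
  have w10 := hz₁'.congr (hD 0).symm (ae_eq_refl _)
  have w01 := hz₁.congr (hD 1).symm (ae_eq_refl _)
  have w11 := hz₂.congr (hD 1).symm (ae_eq_refl _)
  refine ⟨⟨H1.memH1 U, fun i => ⟨hDm i, fun j => ?_⟩⟩, ?_⟩
  · fin_cases i <;> fin_cases j
    exacts [⟨_, w00⟩, ⟨_, w10⟩, ⟨_, w01⟩, ⟨_, w11⟩]
  · rw [normH2, boundH2]
    refine Real.sqrt_le_sqrt ?_
    simp only [Fin.sum_univ_two]
    rw [normL2_eq (ae_eq_refl (H1.fn b U)), normL2_eq (hD 0), normL2_eq (hD 1),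
      normL2_eq (weakD_ae (hDm 0) w00), normL2_eq (weakD_ae (hDm 0) w10),
      normL2_eq (weakD_ae (hDm 1) w01), normL2_eq (weakD_ae (hDm 1) w11)]
    have hsq : ‖U‖ ^ 2 ≤ boundH1 ω b h r i₀ ^ 2 := by gcongr
    rw [H1.norm_sq_eq] at hsq
    have hz2 : ‖z₂‖ ^ 2 ≤ (Real.sqrt (boundMixed ω b h r i₀ R)
      + (ω ^ 2 * R + 2) * boundH1 ω b h r i₀) ^ 2 := by gcongr
    -- `boundMixed` is used three times: for `∂_x²u` and for the mixed derivative in each order.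
    linarith

end HelmholtzSlab

end

/-! ### Existence, uniqueness and the uniform bound -/

theorem lemma2p1 (ω b h r₀ r₁ i₀ i₁ : ℝ) (hω : 0 < ω) (hb : 0 < b) (hh : 0 < h)
    (hr₀ : 0 < r₀) (hi₀ : 0 < i₀) :
    ∃ C : ℝ, ∀ ρ ∈ HelmholtzSlab.admissible b r₀ r₁ i₀ i₁,
      ∀ α ∈ Set.Icc (-(1 / 2) : ℝ) (1 / 2),
        (∃! u : MeasureTheory.Lp ℂ 2 (HelmholtzSlab.slabMeasure b),
          HelmholtzSlab.IsWeakSolution ω b h α ρ u) ∧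
        ∀ u : MeasureTheory.Lp ℂ 2 (HelmholtzSlab.slabMeasure b),
          HelmholtzSlab.IsWeakSolution ω b h α ρ u →
            HelmholtzSlab.MemH2 b u ∧ HelmholtzSlab.normH2 b u ≤ C := by
  open HelmholtzSlab in
  -- The constant is fixed before `ρ`, when the signs of `r₁` and `i₁` are not yet known; hence the
  -- absolute values.
  refine ⟨boundH2 ω b h |r₁| i₀ (|r₁| + |i₁|), fun ρ hρ α hα => ?_⟩
  obtain ⟨hρm, hρb⟩ := hρ
  have hR : ∀ᵐ p ∂(slabMeasure b), ‖ρ p‖ ≤ |r₁| + |i₁| := by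
    filter_upwards [hρb] with p hp
    obtain ⟨h1, h2, h3, h4⟩ := hp
    refine (Complex.norm_le_abs_re_add_abs_im _).trans (add_le_add ?_ ?_)
    · rw [abs_of_nonneg (by linarith)]; exact h2.trans (le_abs_self _)
    · rw [abs_of_nonneg (by linarith)]; exact h4.trans (le_abs_self _)
  obtain ⟨M, hM, hMR⟩ := exists_mulOp hρm.1 hR
  have hMr : ∀ f, (inner ℂ f (M f) : ℂ).re ≤ |r₁| * ‖f‖ ^ 2 := re_inner_mulOp_le hM (by
    filter_upwards [hρb] with p hp using hp.2.1.trans (le_abs_self _))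
  have hMi : ∀ f, i₀ * ‖f‖ ^ 2 ≤ (inner ℂ f (M f) : ℂ).im := le_im_inner_mulOp hM (by
    filter_upwards [hρb] with p hp using hp.2.2.1)
  have hiff := isWeakSolution_iff hb hM hω.le hh hα
  obtain ⟨U, hU, huniq⟩ := lax_milgram (a := sesq ω b α M) (l := loadSum ω b h α)
    (sesq_add_left hb hω.le hα M) (sesq_smul_left ω α M) (sesq_add_right hb hω.le hα M)
    (sesq_smul_right ω α M) (norm_sesq_le hb hω.le hα M)
    (c := coercConst ω |r₁| i₀) (by unfold coercConst; positivity)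
    (coercive_sesq hb hω hα (abs_nonneg _) hi₀ hMr hMi)
    (loadSum_add hb hω.le hh hα) (loadSum_smul ω h α) (norm_loadSum_le hb hω.le hh hα)
  refine ⟨⟨H1.fn b U, (hiff U).2 hU, fun u hu => ?_⟩, fun u hu => ?_⟩
  -- Any weak solution has weak derivatives, so it lifts to `H1 b`, where uniqueness is available.
  · obtain ⟨U', rfl⟩ := hu.exists_eq_fn
    rw [huniq U' ((hiff U').1 hu)]
  · obtain ⟨U', rfl⟩ := hu.exists_eq_fn
    exact regularity hb hω hh hα (abs_nonneg _) hi₀ hMr hMi (by positivity) hMR ((hiff U').1 hu)
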